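/- **Setting.** Let $n\ge 1$. In $sp(2n)\subset gl(2n)$ over $\mathbb C$ put $C_{i,j}=E_{i,j}-E_{n+j,n+i}$, $C_{j,n+k}=E_{j,n+k}+E_{k,n+j}$ and $C_{n+j,k}=E_{n+j,k}+E_{n+k,j}$ for $j\ne k$, $C_{r,n+r}=E_{r,n+r}$, $C_{n+r,r}=E_{n+r,r}$ (all indices in $\{1,\dots,n\}$), and let $$\Omega=\sum_{i,j=1}^nC_{i,j}C_{j,i}+\sum_{s<r}(C_{n+r,s}C_{s,n+r}+C_{s,n+r}C_{n+r,s})+2\sum_{p=1}^n(C_{n+p,p}C_{p,n+p}+C_{p,n+p}C_{n+p,p})\in U(sp(2n)).$$ A weight is identified with the vector $\kappa\in\mathbb C^n$ of its values $\kappa_i$ on $C_{i,i}$. For an $sp(2n)$-module $M$ with representation $\pi_M$ let $\tilde M$ be the space of formal Laurent series $\sum_{j\in\mathbb Z^n}w_j\,x^jx^*$, $w_j\in M$, $x^*=(x_1\cdots x_n)^{-1/2}$; let $sp(2n)$ act on $\tilde M$ by $\pi=\pi_M+\pi'$, where $\pi_M$ acts on coefficients and $$\pi'(C_{p,q})=x_p\partial_{x_q}+\tfrac{\delta_{p,q}}2,\quad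 \pi'(C_{p,n+q})=-\tfrac{x_px_q}{1+\delta_{p,q}},\quad \pi'(C_{n+p,q})=\tfrac{\partial_{x_p}\partial_{x_q}}{1+\delta_{p,q}} .$$ An intertwiner is a linear map $\Phi:M\to\tilde M$ with $\Phi(\pi_M(u)w)=\pi(u)\Phi(w)$ for all $u\in sp(2n)$, $w\in M$. If $M$ is a weight module (the direct sum of its weight spaces $M^\kappa$) with finite-dimensional weight spaces, its trace function is $$\mathcal E=(x^*)^{-1}\,\mathrm{tr}_M\,\Phi\, z_1^{\pi_M(C_{1,1})}\cdots z_n^{\pi_M(C_{n,n})},$$ a formal series in $x^j$ ($j\in\mathbb Z^n$) and $z^\kappa$ ($\kappa\in\mathbb C^n$), whose coefficient at $x^jz^\kappa$ is the trace of the diagonal $M^\kappa$-block of the coefficient of $x^jx^*$ in $\Phi$. Let $$\mathcal W_{C_n}=\prod_{r=1}^n(z_r-z_r^{-1})\prod_{i<j}(z_i+z_i^{-1}-z_j-z_j^{-1}),\qquad \Psi=\mathcal W_{C_n}\mathcal E .$$ A product of a rational function $P/Q$ and a formal series $f$ is a formal series $g$ with $Qg=Pf$. **Theorem 7.1.** (a)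 Let $M$ be a weight $sp(2n)$-module with finite-dimensional weight spaces on which $\Omega$ acts as a scalar $\mu\in\mathbb C$, and let $\Phi:M\to\tilde M$ be an intertwiner. Then $\mathcal E$ does not involve $x$ (its coefficients at $x^jz^\kappa$ vanish for $j\neq0$), and $\Psi$ satisfies the Olshanetsky–Perelomov equation of type $C$ (the one with $K_3=0$) $$\sum_{i=1}^n(z_i\partial_{z_i})^2\Psi+\Big[\sum_{1\le i<j\le n}\tfrac12\Big(\tfrac{z_iz_j}{(z_i-z_j)^2}+\tfrac{z_iz_j}{(z_iz_j-1)^2}\Big)+\tfrac34\sum_{p=1}^n\tfrac{z_p^2}{(z_p^2-1)^2}\Big]\Psi=\Big(\mu+\tfrac{n(n+1)(2n+1)}6\Big)\Psi,$$ in the sense that there are products of $\Psi$ with each of the rational functions displayed, for which the equation holds. If moreover the weights of $M$ are bounded above (for every $\kappa\in\mathbb C^n$ and every positive root $\beta\in\{\varepsilon_i\pm\varepsilon_j\ (i<j),\ 2\varepsilon_i\}$, $M^{\kappa+k\beta}=0$ for all large integers $k$; this holds for every highest-weight module), then the equation holds with the rational functions expanded in $|z_1|>\dots>|z_n|>1$,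 i.e. as $\sum_{k\ge1}kz^{-k\beta}$ with $\beta=\varepsilon_i-\varepsilon_j,\ \varepsilon_i+\varepsilon_j,\ 2\varepsilon_p$; all sums that occur are finite, and the series so obtained are products of $\Psi$ with the rational functions. (b) In particular, let $c\in\mathbb C\setminus\mathbb N$ (where $0\in\mathbb N$), and let $M_\lambda$ be the Verma module with highest weight $\lambda$, $\lambda_i=c-\frac{n-i}2$, and highest-weight vector $v_\lambda$. Then $M_\lambda$ is a weight module with finite-dimensional weight spaces and weights bounded above, $\Omega$ acts on it as $$\mu=\sum_{i=0}^{n-1}\Big(c-\tfrac i2\Big)\Big(c+\tfrac{3i}2+2\Big),$$ there is a unique intertwiner $\Phi:M_\lambda\to\tilde M_\lambda$ with $$\Phi(v_\lambda)=\sum_{i\in\mathbb N^n}\frac{(-1)^{i_1+\dots+i_{n-1}}}{i_1!\cdots i_n!\,2^{i_n}\,c(c-1)\cdots(c-i_n+1)}\,C_{2,1}^{i_1}C_{3,2}^{i_2}\cdots C_{n,n-1}^{i_{n-1}}C_{2n,n}^{i_n}v_\lambda\; x_1^{i_1}x_2^{i_2-i_1}\cdots x_{n-1}^{i_{n-1}-i_{n-2}}x_n^{2i_n-i_{n-1}}\,x^*$$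 (for $n=1$ the summand is $\frac{1}{i_1!\,2^{i_1}c(c-1)\cdots(c-i_1+1)}C_{2,1}^{i_1}v_\lambda\,x_1^{2i_1}x^*$), its trace function $E_C$ does not involve $x$, and $\Psi=\mathcal W_{C_n}E_C$ satisfies the above equation, with this $\mu$ and with the rational functions expanded in $|z_1|>\dots>|z_n|>1$. -/

import Mathlib

noncomputable section

namespace SpTrace

attribute [local instance 100] LieRing.ofAssociativeRing

/-! ### The symplectic Lie algebra `sp(2n)` and its standard root vectors

Indices `p : Fin n` (running from `0`) stand for `p + 1` in the usual numbering; `Sum.inl p` is the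
index `p` and `Sum.inr p` is the index `n + p` of a `2n × 2n` matrix. -/

/-- The symplectic Lie algebra `sp(2n)` over `ℂ`, inside `gl(2n)`. -/
abbrev sp (n : ℕ) : LieSubalgebra ℂ (Matrix (Fin n ⊕ Fin n) (Fin n ⊕ Fin n) ℂ) :=
  LieAlgebra.Symplectic.sp (Fin n) ℂ

/-- The matrix unit `E_{a,b}` of `gl(2n)`. -/
abbrev E {n : ℕ} (a b : Fin n ⊕ Fin n) : Matrix (Fin n ⊕ Fin n) (Fin n ⊕ Fin n) ℂ :=
  Matrix.single a b 1

theorem mem_sp_iff {n : ℕ} (A : Matrix (Fin n ⊕ Fin n) (Fin n ⊕ Fin n) ℂ) :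
    A ∈ sp n ↔ Matrix.transpose A * Matrix.J (Fin n) ℂ = Matrix.J (Fin n) ℂ * (-A) := by
  change A ∈ skewAdjointMatricesLieSubalgebra (Matrix.J (Fin n) ℂ) ↔ _
  rw [mem_skewAdjointMatricesLieSubalgebra, mem_skewAdjointMatricesSubmodule]
  rfl

/-- `C_{p,q} = E_{p,q} - E_{n+q,n+p}`. -/
def C {n : ℕ} (p q : Fin n) : sp n :=
  ⟨E (.inl p) (.inl q) - E (.inr q) (.inr p), by
    rw [mem_sp_iff]
    ext (i | i) (j | j) <;>
      simp [Matrix.mul_apply, Matrix.J, Matrix.single_apply, Matrix.one_apply, ite_and] <;>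
      grind⟩

/-- `C_{p,n+q} = E_{p,n+q} + E_{q,n+p}` for `p ≠ q`, and `C_{p,n+p} = E_{p,n+p}`. -/
def CUp {n : ℕ} (p q : Fin n) : sp n :=
  ⟨if p = q then E (.inl p) (.inr p) else E (.inl p) (.inr q) + E (.inl q) (.inr p), by
    rw [mem_sp_iff]
    split_ifs <;> ext (i | i) (j | j) <;>
      simp [Matrix.mul_apply, Matrix.J, Matrix.single_apply, Matrix.one_apply, ite_and] <;>
      grind⟩

/-- `C_{n+p,q} = E_{n+p,q} + E_{n+q,p}` for `p ≠ q`, and `C_{n+p,p} = E_{n+p,p}`. -/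
def CLow {n : ℕ} (p q : Fin n) : sp n :=
  ⟨if p = q then E (.inr p) (.inl p) else E (.inr p) (.inl q) + E (.inr q) (.inl p), by
    rw [mem_sp_iff]
    split_ifs <;> ext (i | i) (j | j) <;>
      simp [Matrix.mul_apply, Matrix.J, Matrix.single_apply, Matrix.one_apply, ite_and] <;>
      grind⟩

/-- The universal enveloping algebra `U(sp(2n))`. -/
abbrev U (n : ℕ) : Type := UniversalEnvelopingAlgebra ℂ (sp n)

/-- The inclusion `sp(2n) → U(sp(2n))`. -/
abbrev ι {n : ℕ} (u : sp n) : U n := UniversalEnvelopingAlgebra.ι ℂ u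

/-- The quadratic Casimir element `Ω` of `U(sp(2n))`. -/
def casimir (n : ℕ) : U n :=
  (∑ i : Fin n, ∑ j : Fin n, ι (C i j) * ι (C j i))
  + (∑ s : Fin n, ∑ r ∈ Finset.Ioi s, (ι (CLow r s) * ι (CUp s r) + ι (CUp s r) * ι (CLow r s)))
  + 2 * ∑ p : Fin n, (ι (CLow p p) * ι (CUp p p) + ι (CUp p p) * ι (CLow p p))

/-! ### Weight modules -/

section Modules

variable {n : ℕ} (M : Type*) [AddCommGroup M] [Module ℂ M] [LieRingModule (sp n) M]
  [LieModule ℂ (sp n) M]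

/-- The endomorphism of an `sp(2n)`-module by which an element of `U(sp(2n))` acts. -/
def actU (a : U n) : Module.End ℂ M :=
  UniversalEnvelopingAlgebra.lift ℂ (LieModule.toEnd ℂ (sp n) M) a

/-- The weight space `M^κ`. A weight, i.e. a linear function on the Cartan subalgebra with basis
`C_{1,1}, …, C_{n,n}`, is recorded by its values `κ i` on the `C_{i,i}`. -/
def wtSpace (κ : Fin n → ℂ) : Submodule ℂ M where
  carrier := {w | ∀ i : Fin n, ⁅(C i i : sp n), w⁆ = κ i • w}
  add_mem' := fun {a b} ha hb i => by rw [lie_add, ha i, hb i, smul_add]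
  zero_mem' := fun i => by simp
  smul_mem' := fun c w hw i => by rw [lie_smul, hw i, smul_comm]

/-- `M` is a weight module: the direct sum of its weight spaces. -/
def IsWeightModule : Prop := DirectSum.IsInternal (wtSpace (n := n) M)

/-- The simple coordinate vector `ε_i`, and through it the roots of `sp(2n)`. -/
abbrev eps {n : ℕ} (i : Fin n) : Fin n → ℤ := Pi.single i 1

/-- `β` is a positive root of `sp(2n)`: `ε_i - ε_j` or `ε_i + ε_j` with `i < j`, or `2 ε_i`. -/
def IsPosRoot {n : ℕ} (β : Fin n → ℤ) : Prop :=
  (∃ i j : Fin n, i < j ∧ (β = eps i - eps j ∨ β = eps i + eps j)) ∨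
    ∃ i : Fin n, β = eps i + eps i

/-- The weights of `M` are bounded above along every positive root (as is the case for
highest-weight modules). -/
def WeightsBoundedAbove : Prop :=
  ∀ (κ : Fin n → ℂ) (β : Fin n → ℤ), IsPosRoot β →
    ∃ K : ℕ, ∀ k : ℕ, K ≤ k → wtSpace (n := n) M (fun i => κ i + k * β i) = ⊥

variable {M}

/-- The projection of a weight module onto its weight space `M^κ`. -/
def wtProj (hM : IsWeightModule (n := n) M) (κ : Fin n → ℂ) : M →ₗ[ℂ] wtSpace (n := n) M κ :=
  DirectSum.component ℂ (Fin n → ℂ) (fun κ => wtSpace (n := n) M κ) κ ∘ₗ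
    (LinearEquiv.ofBijective (DirectSum.coeLinearMap (wtSpace (n := n) M)) hM).symm.toLinearMap

end Modules

/-! ### Laurent series in `x₁, …, xₙ` and the point representation -/

/-- The space `M̃` of formal Laurent series `∑_{j ∈ ℤⁿ} w_j x^j x^*`, where
`x^* = (x₁ ⋯ xₙ)^{-1/2}`, with coefficients `w_j` in `M`; a series is its family of coefficients. -/
abbrev LaurentX (n : ℕ) (M : Type*) : Type _ := (Fin n → ℤ) → M

section PointRep

variable {n : ℕ} {M : Type*} [AddCommGroup M] [Module ℂ M]

/-- Multiplication by `x_p` on `M̃`. -/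
def xMul (p : Fin n) : LaurentX n M →ₗ[ℂ] LaurentX n M where
  toFun f := fun j => f (j - eps p)
  map_add' _ _ := rfl
  map_smul' _ _ := rfl

/-- The derivation `∂/∂x_q` on `M̃`: it maps `w x^j x^*` to `(j_q - 1/2) w x^{j - ε_q} x^*`. -/
def xDer (q : Fin n) : LaurentX n M →ₗ[ℂ] LaurentX n M where
  toFun f := fun j => ((j q : ℂ) + 1 / 2) • f (j + eps q)
  map_add' _ _ := by ext; simp
  map_smul' c _ := by ext; simp [smul_comm c]

/-- The representation `π'` of `sp(2n)` on `M̃` through the variables `x`: the linear map with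
`C_{p,q} ↦ x_p ∂_q + δ_{p,q}/2`, `C_{p,n+q} ↦ - x_p x_q / (1 + δ_{p,q})` and
`C_{n+p,q} ↦ ∂_p ∂_q / (1 + δ_{p,q})`; see the three lemmas below. -/
def pointRep (u : sp n) : LaurentX n M →ₗ[ℂ] LaurentX n M :=
  (∑ p : Fin n, ∑ q : Fin n, u.1 (.inl p) (.inl q) •
      (xMul p ∘ₗ xDer q + (if p = q then (1 / 2 : ℂ) else 0) • LinearMap.id))
  - (1 / 2 : ℂ) • (∑ p : Fin n, ∑ q : Fin n, u.1 (.inl p) (.inr q) • (xMul p ∘ₗ xMul q))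
  + (1 / 2 : ℂ) • (∑ p : Fin n, ∑ q : Fin n, u.1 (.inr p) (.inl q) • (xDer p ∘ₗ xDer q))

theorem sum_unit_smul {V : Type*} [AddCommGroup V] [Module ℂ V] (a b : Fin n)
    (T : Fin n → Fin n → V) :
    ∑ p : Fin n, ∑ q : Fin n, (if a = p ∧ b = q then (1 : ℂ) else 0) • T p q = T a b := by
  rw [Finset.sum_eq_single a, Finset.sum_eq_single b] <;> simp +contextual [eq_comm]

theorem xMul_comm (p q : Fin n) :
    (xMul q ∘ₗ xMul p : LaurentX n M →ₗ[ℂ] LaurentX n M) = xMul p ∘ₗ xMul q := by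
  ext1 f
  funext j
  change f (j - eps q - eps p) = f (j - eps p - eps q)
  rw [sub_right_comm]

theorem xDer_comm (p q : Fin n) :
    (xDer q ∘ₗ xDer p : LaurentX n M →ₗ[ℂ] LaurentX n M) = xDer p ∘ₗ xDer q := by
  by_cases h : p = q
  · rw [h]
  ext1 f
  funext j
  change ((j q : ℂ) + 1 / 2) • (((j + eps q) p : ℤ) + 1 / 2 : ℂ) • f (j + eps q + eps p) =
    ((j p : ℂ) + 1 / 2) • (((j + eps p) q : ℤ) + 1 / 2 : ℂ) • f (j + eps p + eps q)
  rw [add_right_comm, smul_comm]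
  simp [h, Ne.symm h]

theorem pointRep_C (p q : Fin n) : (pointRep (C p q) : LaurentX n M →ₗ[ℂ] LaurentX n M) =
    xMul p ∘ₗ xDer q + (if p = q then (1 / 2 : ℂ) else 0) • LinearMap.id := by
  have h₁ : ∀ x y, (C p q).1 (.inl x) (.inl y) = if p = x ∧ q = y then 1 else 0 := by
    simp [C, Matrix.single_apply]
  have h₂ : ∀ x y, (C p q).1 (.inl x) (.inr y) = 0 := by simp [C]
  have h₃ : ∀ x y, (C p q).1 (.inr x) (.inl y) = 0 := by simp [C]
  have h := sum_unit_smul p q fun x y : Fin n =>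
    (xMul x ∘ₗ xDer y + (if x = y then (1 / 2 : ℂ) else 0) • LinearMap.id :
      LaurentX n M →ₗ[ℂ] LaurentX n M)
  simp only [pointRep, h₁, h₂, h₃, zero_smul, Finset.sum_const_zero, smul_zero, sub_zero, add_zero]
  exact h

theorem pointRep_CUp (p q : Fin n) : (pointRep (CUp p q) : LaurentX n M →ₗ[ℂ] LaurentX n M) =
    (-(1 / (1 + if p = q then (1 : ℂ) else 0))) • (xMul p ∘ₗ xMul q) := by
  have h₁ : ∀ x y, (CUp p q).1 (.inl x) (.inl y) = 0 := by
    intro x y; by_cases h : p = q <;> simp [CUp, h]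
  have h₃ : ∀ x y, (CUp p q).1 (.inr x) (.inl y) = 0 := by
    intro x y; by_cases h : p = q <;> simp [CUp, h]
  by_cases h : p = q
  · subst h
    have h₂ : ∀ x y, (CUp p p).1 (.inl x) (.inr y) = if p = x ∧ p = y then 1 else 0 := by
      simp [CUp, Matrix.single_apply]
    have h := sum_unit_smul p p fun x y : Fin n =>
      (xMul x ∘ₗ xMul y : LaurentX n M →ₗ[ℂ] LaurentX n M)
    simp only [pointRep, h₁, h₂, h₃, zero_smul, Finset.sum_const_zero, if_true]
    rw [h]
    module
  · have h₂ : ∀ x y, (CUp p q).1 (.inl x) (.inr y) =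
        (if p = x ∧ q = y then 1 else 0) + if q = x ∧ p = y then 1 else 0 := by
      simp [CUp, h, Matrix.single_apply]
    simp only [pointRep, h₁, h₂, h₃, add_smul, Finset.sum_add_distrib, sum_unit_smul, zero_smul,
      Finset.sum_const_zero, if_neg h, xMul_comm p q]
    module

theorem pointRep_CLow (p q : Fin n) : (pointRep (CLow p q) : LaurentX n M →ₗ[ℂ] LaurentX n M) =
    (1 / (1 + if p = q then (1 : ℂ) else 0)) • (xDer p ∘ₗ xDer q) := by
  have h₁ : ∀ x y, (CLow p q).1 (.inl x) (.inl y) = 0 := by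
    intro x y; by_cases h : p = q <;> simp [CLow, h]
  have h₂ : ∀ x y, (CLow p q).1 (.inl x) (.inr y) = 0 := by
    intro x y; by_cases h : p = q <;> simp [CLow, h]
  by_cases h : p = q
  · subst h
    have h₃ : ∀ x y, (CLow p p).1 (.inr x) (.inl y) = if p = x ∧ p = y then 1 else 0 := by
      simp [CLow, Matrix.single_apply]
    have h := sum_unit_smul p p fun x y : Fin n =>
      (xDer x ∘ₗ xDer y : LaurentX n M →ₗ[ℂ] LaurentX n M)
    simp only [pointRep, h₁, h₂, h₃, zero_smul, Finset.sum_const_zero, if_true]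
    rw [h]
    module
  · have h₃ : ∀ x y, (CLow p q).1 (.inr x) (.inl y) =
        (if p = x ∧ q = y then 1 else 0) + if q = x ∧ p = y then 1 else 0 := by
      simp [CLow, h, Matrix.single_apply]
    simp only [pointRep, h₁, h₂, h₃, add_smul, Finset.sum_add_distrib, sum_unit_smul, zero_smul,
      Finset.sum_const_zero, if_neg h, xDer_comm p q]
    module

/-- `Φ : M → M̃` intertwines `π_M` with `π = π_M + π'`, where `π_M` acts on `M̃`
coefficientwise. -/
def IsIntertwiner [LieRingModule (sp n) M] (Φ : M →ₗ[ℂ] LaurentX n M) : Prop :=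
  ∀ (u : sp n) (w : M) (j : Fin n → ℤ), Φ ⁅u, w⁆ j = ⁅u, Φ w j⁆ + pointRep u (Φ w) j

end PointRep

/-! ### Formal series in `z₁, …, zₙ` with complex exponents -/

/-- Formal series `∑_{κ ∈ ℂⁿ} f_κ z^κ`; a series is its family of coefficients. -/
abbrev ZSeries (n : ℕ) : Type := (Fin n → ℂ) → ℂ

/-- Laurent polynomials in `z₁, …, zₙ`. -/
abbrev ZPoly (n : ℕ) : Type := AddMonoidAlgebra ℂ (Fin n → ℤ)

/-- The monomial `z^m`. -/
def zPow {n : ℕ} (m : Fin n → ℤ) : ZPoly n := AddMonoidAlgebra.single m 1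

/-- The variable `z_i`. -/
abbrev z {n : ℕ} (i : Fin n) : ZPoly n := zPow (eps i)

/-- The inverse variable `z_i⁻¹`. -/
abbrev zInv {n : ℕ} (i : Fin n) : ZPoly n := zPow (-eps i)

/-- The product of a Laurent polynomial and a formal series. -/
def zMul {n : ℕ} (P : ZPoly n) (f : ZSeries n) : ZSeries n := fun κ =>
  ∑ m ∈ P.coeff.support, P.coeff m * f (fun i => κ i - m i)

/-- The operator `z_i ∂/∂z_i`. -/
def theta {n : ℕ} (i : Fin n) (f : ZSeries n) : ZSeries n := fun κ => κ i * f κ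

/-- The Weyl function `𝒲_{C_n}` of `sp(2n)`. -/
def weylC (n : ℕ) : ZPoly n :=
  (∏ r : Fin n, (z r - zInv r)) *
    ∏ i : Fin n, ∏ j ∈ Finset.Ioi i, (z i + zInv i - (z j + zInv j))

/-- `g` is a product of the rational function `P / Q` and the formal series `f`. -/
def IsRatMul {n : ℕ} (P Q : ZPoly n) (f g : ZSeries n) : Prop := zMul Q g = zMul P f

/-- `A i j`, `B i j` (for `i < j`) and `D p` are products of `Ψ` with the rational functions
`z_i z_j / (z_i - z_j)²`, `z_i z_j / (z_i z_j - 1)²` and `z_p² / (z_p² - 1)²`. -/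
def ArePotentialProducts {n : ℕ} (Ψ : ZSeries n) (A B : Fin n → Fin n → ZSeries n)
    (D : Fin n → ZSeries n) : Prop :=
  (∀ i j : Fin n, i < j → IsRatMul (z i * z j) ((z i - z j) ^ 2) Ψ (A i j)) ∧
  (∀ i j : Fin n, i < j → IsRatMul (z i * z j) ((z i * z j - 1) ^ 2) Ψ (B i j)) ∧
  (∀ p : Fin n, IsRatMul (z p ^ 2) ((z p ^ 2 - 1) ^ 2) Ψ (D p))

/-- The equation
`∑ᵢ (zᵢ∂ᵢ)² Ψ + [∑_{i<j} (K₁ zᵢzⱼ/(zᵢ-zⱼ)² + K₂ zᵢzⱼ/(zᵢzⱼ-1)²) + ∑ₚ K₄ zₚ²/(zₚ²-1)²] Ψ = ν Ψ`,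
in which `A i j`, `B i j`, `D p` are put for the products of `Ψ` with the rational functions. -/
def OPEquation {n : ℕ} (K₁ K₂ K₄ ν : ℂ) (Ψ : ZSeries n) (A B : Fin n → Fin n → ZSeries n)
    (D : Fin n → ZSeries n) : Prop :=
  (∑ i : Fin n, theta i (theta i Ψ))
    + ((∑ i : Fin n, ∑ j ∈ Finset.Ioi i, (K₁ • A i j + K₂ • B i j)) + ∑ p : Fin n, K₄ • D p)
    = ν • Ψ

/-- `Ψ` satisfies the Olshanetsky–Perelomov equation of type `C` (the one with `K₃ = 0`). -/
def SolvesOP {n : ℕ} (K₁ K₂ K₄ ν : ℂ) (Ψ : ZSeries n) : Prop :=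
  ∃ (A B : Fin n → Fin n → ZSeries n) (D : Fin n → ZSeries n),
    ArePotentialProducts Ψ A B D ∧ OPEquation K₁ K₂ K₄ ν Ψ A B D

/-- The product of `f` with the expansion `∑_{k ≥ 1} k z^{-kβ}` of `z^β / (z^β - 1)²`. -/
def expandMul {n : ℕ} (β : Fin n → ℤ) (f : ZSeries n) : ZSeries n := fun κ =>
  ∑ᶠ k : ℕ, (k : ℂ) * f (fun i => κ i + k * β i)

/-- `Ψ` satisfies the Olshanetsky–Perelomov equation of type `C`, the rational functions being
expanded in the domain `|z₁| > |z₂| > ⋯ > |zₙ| > 1`; the sums that give the products with `Ψ` are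
finite and these series are indeed products of `Ψ` with the rational functions. -/
def SolvesOPExpanded {n : ℕ} (K₁ K₂ K₄ ν : ℂ) (Ψ : ZSeries n) : Prop :=
  (∀ (κ : Fin n → ℂ) (β : Fin n → ℤ), IsPosRoot β →
    {k : ℕ | Ψ (fun i => κ i + k * β i) ≠ 0}.Finite) ∧
  ArePotentialProducts Ψ (fun i j => expandMul (eps i - eps j) Ψ)
    (fun i j => expandMul (eps i + eps j) Ψ) (fun p => expandMul (eps p + eps p) Ψ) ∧
  OPEquation K₁ K₂ K₄ ν Ψ (fun i j => expandMul (eps i - eps j) Ψ)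
    (fun i j => expandMul (eps i + eps j) Ψ) (fun p => expandMul (eps p + eps p) Ψ)

/-! ### The trace function -/

section Trace

variable {n : ℕ} {M : Type*} [AddCommGroup M] [Module ℂ M] [LieRingModule (sp n) M]
  [LieModule ℂ (sp n) M]

/-- The coefficient of `x^j x^*` in a linear map `Φ : M → M̃`. -/
def coeffMap (Φ : M →ₗ[ℂ] LaurentX n M) (j : Fin n → ℤ) : Module.End ℂ M :=
  LinearMap.proj j ∘ₗ Φ

/-- The coefficient of `x^j` in `(x^*)⁻¹ tr_M Φ z₁^{C_{1,1}} ⋯ zₙ^{C_{n,n}}`. As `z₁^{C_{1,1}} ⋯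
zₙ^{C_{n,n}}` is multiplication by `z^κ` on `M^κ`, the coefficient of `z^κ` is the trace of the
diagonal block on `M^κ` of the coefficient of `x^j x^*` in `Φ`. -/
def traceFn (hM : IsWeightModule (n := n) M) (Φ : M →ₗ[ℂ] LaurentX n M) (j : Fin n → ℤ) :
    ZSeries n := fun κ =>
  LinearMap.trace ℂ (wtSpace (n := n) M κ)
    (wtProj hM κ ∘ₗ coeffMap Φ j ∘ₗ (wtSpace (n := n) M κ).subtype)

end Trace

/-! ### Verma modules and the trace function `E_C` -/

/-- The left ideal of `U(sp(2n))` generated by the positive root vectors and by the elements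
`C_{i,i} - κ(C_{i,i})`. -/
def vermaIdeal (n : ℕ) (κ : Fin n → ℂ) : Submodule (U n) (U n) :=
  Submodule.span (U n)
    ({a | ∃ i j : Fin n, i < j ∧ a = ι (C i j)} ∪ {a | ∃ i j : Fin n, i ≤ j ∧ a = ι (CUp i j)} ∪
      {a | ∃ i : Fin n, a = ι (C i i) - algebraMap ℂ (U n) (κ i)})

/-- The Verma module of `sp(2n)` with highest weight `κ`. -/
abbrev Verma (n : ℕ) (κ : Fin n → ℂ) : Type := U n ⧸ vermaIdeal n κ

instance vermaLieRingModule (n : ℕ) (κ : Fin n → ℂ) : LieRingModule (sp n) (Verma n κ) where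
  bracket u w := ι u • w
  add_lie u v w := by
    change ι (u + v) • w = ι u • w + ι v • w
    rw [ι, map_add, add_smul]
  lie_add u v w := smul_add _ _ _
  leibniz_lie u v w := by
    change ι u • ι v • w = ι ⁅u, v⁆ • w + ι v • ι u • w
    rw [ι, ι, ι, LieHom.map_lie, LieRing.of_associative_ring_bracket, sub_smul, mul_smul, mul_smul]
    abel

instance vermaLieModule (n : ℕ) (κ : Fin n → ℂ) : LieModule ℂ (sp n) (Verma n κ) where
  smul_lie c u w := by
    change ι (c • u) • w = c • ι u • w
    rw [ι, map_smul, smul_assoc]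
  lie_smul c u w := by
    change ι u • c • w = c • ι u • w
    rw [smul_comm]

/-- The highest-weight vector `v_κ`. -/
def hwVec (n : ℕ) (κ : Fin n → ℂ) : Verma n κ := Submodule.Quotient.mk 1

/-- The weight `λ` with `λ(h_i) = -1/2` for `i < n` and `λ(h_n) = c`, where
`h_i = C_{i,i} - C_{i+1,i+1}` for `i < n` and `h_n = C_{n,n}`; that is,
`λ(C_{i,i}) = c - (n - i)/2` (with `i` counted from `1`). -/
def lam (n : ℕ) (c : ℂ) : Fin n → ℂ := fun i => c - ((n : ℂ) - ((i : ℕ) + 1)) / 2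

/-- The negative simple root vectors: `C_{p+1,p}` for `p < n`, and `C_{2n,n}` for `p = n`. -/
def negSimple {n : ℕ} (p : Fin n) : sp n :=
  if h : (p : ℕ) + 1 < n then C ⟨p + 1, h⟩ p else CLow p p

/-- `C^{ε(i)} = C_{2,1}^{i_1} C_{3,2}^{i_2} ⋯ C_{n,n-1}^{i_{n-1}} C_{2n,n}^{i_n}`. -/
def negMonomial {n : ℕ} (i : Fin n → ℕ) : U n :=
  (List.ofFn fun p : Fin n => ι (negSimple p) ^ i p).prod

/-- The exponent of `x^{(i)} = x₁^{i₁} x₂^{i₂ - i₁} ⋯ x_{n-1}^{i_{n-1} - i_{n-2}}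
xₙ^{2 iₙ - i_{n-1}}`. -/
def xExp {n : ℕ} (i : Fin n → ℕ) : Fin n → ℤ := fun p =>
  (if (p : ℕ) + 1 = n then 2 * (i p : ℤ) else (i p : ℤ)) -
    (if 0 < (p : ℕ) then (i ⟨(p : ℕ) - 1, lt_of_le_of_lt (Nat.sub_le _ _) p.2⟩ : ℤ) else 0)

/-- The coefficient `(-1)^{i_1+⋯+i_{n-1}} / (i_1! ⋯ i_n! 2^{i_n} ⟨c⟩_{i_n})`, where
`⟨c⟩_k = c (c - 1) ⋯ (c - k + 1)`. -/
def uCoeff {n : ℕ} (c : ℂ) (i : Fin n → ℕ) : ℂ :=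
  ∏ p : Fin n, (if (p : ℕ) + 1 = n then
      1 / (((i p).factorial : ℂ) * 2 ^ (i p) * ∏ t ∈ Finset.range (i p), (c - t))
    else (-1) ^ (i p) / ((i p).factorial : ℂ))

/-- The singular vector `u_λ = ∑_{i ∈ ℕⁿ} uCoeff(i) C^{ε(i)} v_λ x^{(i)} x^*` of the space of
Laurent series over the Verma module `M_λ`, `λ = lam n c`. Distinct `i` have distinct monomials
`x^{(i)}`, so that each of the sums below has at most one non-zero term. -/
def uVec (n : ℕ) (c : ℂ) : LaurentX n (Verma n (lam n c)) := fun j =>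
  ∑ᶠ i : Fin n → ℕ,
    if xExp i = j then uCoeff c i • (negMonomial i • hwVec n (lam n c)) else 0

end SpTrace

end

open SpTrace

/-! The differential equation comes from computing one trace in two ways. Let `F` be the trace
function and let `e`, `f` be root vectors for a positive root `α` and for `-α`. An intertwiner `Φ`
shifts weights by the exponents of `x`, so that only the coefficient of `x^*` has a trace
(`traceFn_eq_zero`). Moving `e` and `f` once around the trace of `Φ (e f + f e) z^h`, by the
intertwining property and cyclicity, gives
`(1 - z^α) (1 - z^{-α}) S_α = (z^{-α} - z^α) ∂_η F + 2 a b F`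
for this trace `S_α` (`IsRootPair.trace_identity`), where `∂_η` is the derivative along `[e, f]`
and `a`, `b` are the scalars by which `e` and `f` act through the variables `x`. No division is
needed, so that this holds for arbitrary formal series. As the Casimir element is a sum of squares
of the `C_{i,i}` and of multiples of the `e f + f e`, the sum of the `(z_i ∂_i)² F` and of multiples
of the `S_α` is `μ F` (`traceIdentities`).

Multiplication by the Weyl function `𝒲` removes the first-order terms. First,
`P_α = 𝒲 (1 + z^{-α}) / (1 - z^{-α})` is a Laurent polynomial, and the gradient of `𝒲` is a
combination of the `P_α` (`sum_thetaD_weylC_smul`). Secondly, `𝒲` is an eigenfunction of the Laplace operator with eigenvalue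
`|ρ|² = n (n + 1) (2 n + 1) / 6` (`laplace_weylC`), since by Vandermonde it is, up to sign, the
determinant with entries `z_i^k - z_i^{-k}`. The products of `Ψ = 𝒲 F` with the potentials are then
the multiples `-(𝒲 S_α - P_α ∂_η F) / (2 a b)` (`TraceIdentities.solvesOP`). If the weights are
bounded above along `α`, so is this series; and the second-order recursion that it satisfies along
`α` has only one such solution, the expansion `∑ k z^{-kα} Ψ` (`expandMul_eq`).

A Verma module is spanned by the words in negative root vectors applied to the highest-weight vector
(`span_wordVec`). Only finitely many words have a given weight, as each letter lowers a linear
function `height` by at least `1`; this gives finiteness and boundedness of the weights without the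
Poincaré–Birkhoff–Witt theorem. The Casimir element is central (`commute_casimir`) and its scalar is
read off at the highest-weight vector. Finally `π'` is a representation because quadratic elements
of a Weyl algebra form a copy of `sp(2n)` (`IsWeylPair.quadratic_lie`), and the series prescribed as
the image of the highest-weight vector has the weight of that vector and is annihilated by the
simple root vectors, by the `sl(2)` relation `e f^{k+1} w = (k+1) (m - k) f^k w`
(`totalRep_posSimple_uVec`). The simple root vectors generate the positive part of `sp(2n)`, whence
the intertwiner exists; it is unique because the highest-weight vector generates.
-/

noncomputable section

namespace SpTrace

attribute [local instance 100] LieRing.ofAssociativeRing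

variable {n : ℕ}

/-! ### Formal series as a module over the Laurent polynomials -/

/-- Multiplication of formal series by monomials, as a representation of the lattice `ℤⁿ`. -/
def shiftHom (n : ℕ) : Multiplicative (Fin n → ℤ) →* Module.End ℂ (ZSeries n) where
  toFun m :=
    { toFun := fun f κ => f (fun i => κ i - (m.toAdd i : ℂ))
      map_add' := fun _ _ => rfl
      map_smul' := fun _ _ => rfl }
  map_one' := by
    ext f κ
    simp
  map_mul' a b := by
    ext f κ
    change f _ = f _
    congr 1
    funext i
    simp
    ring

/-- Multiplication of formal series by Laurent polynomials, as an algebra homomorphism. -/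
def zAct (n : ℕ) : ZPoly n →ₐ[ℂ] Module.End ℂ (ZSeries n) :=
  AddMonoidAlgebra.lift ℂ _ _ (shiftHom n)

/-- Formal series are a module over Laurent polynomials. -/
instance zModule (n : ℕ) : Module (ZPoly n) (ZSeries n) :=
  Module.compHom (ZSeries n) (zAct n).toRingHom

theorem zAct_apply (P : ZPoly n) (f : ZSeries n) : zAct n P f = P • f := rfl

theorem zPow_smul (m : Fin n → ℤ) (f : ZSeries n) (κ : Fin n → ℂ) :
    (zPow m • f) κ = f (fun i => κ i - m i) := by
  rw [← zAct_apply, zAct, zPow, AddMonoidAlgebra.lift_single, one_smul]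
  rfl

theorem zMul_eq_smul (P : ZPoly n) (f : ZSeries n) : zMul P f = P • f := by
  funext κ
  rw [← zAct_apply, zAct, AddMonoidAlgebra.lift_apply, Finsupp.sum, LinearMap.sum_apply,
    Finset.sum_apply]
  rfl

instance zScalarTower (n : ℕ) : IsScalarTower ℂ (ZPoly n) (ZSeries n) where
  smul_assoc c P f := by
    rw [← zAct_apply, ← zAct_apply, map_smul]
    rfl

theorem zPow_add (a b : Fin n → ℤ) : zPow (a + b) = zPow a * zPow b := by
  simp [zPow, AddMonoidAlgebra.single_mul_single]

theorem zPow_zero : zPow (0 : Fin n → ℤ) = 1 := rfl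

theorem zPow_mul_neg (a : Fin n → ℤ) : zPow a * zPow (-a) = 1 := by
  rw [← zPow_add, add_neg_cancel, zPow_zero]

theorem zPow_pow (a : Fin n → ℤ) (k : ℕ) : zPow a ^ k = zPow (k • a) := by
  simp [zPow, AddMonoidAlgebra.single_pow]

/-- The derivation `z_i ∂/∂z_i` of the algebra of Laurent polynomials. -/
def thetaD (i : Fin n) : Derivation ℂ (ZPoly n) (ZPoly n) :=
  Derivation.mk'
    ((Finsupp.lsum ℂ fun m : Fin n → ℤ => (m i : ℂ) • AddMonoidAlgebra.lsingle m) ∘ₗ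
      (AddMonoidAlgebra.coeffLinearEquiv ℂ).toLinearMap) <| by
    intro a b
    induction a using AddMonoidAlgebra.induction_linear with
    | zero => simp
    | add a a' ha ha' => rw [add_mul, map_add, ha, ha', map_add, add_smul, smul_add]; abel
    | single m r =>
      induction b using AddMonoidAlgebra.induction_linear with
      | zero => simp
      | add b b' hb hb' => rw [mul_add, map_add, hb, hb', map_add, add_smul, smul_add]; abel
      | single m' r' =>
        simp only [AddMonoidAlgebra.single_mul_single, LinearMap.comp_apply,
          LinearEquiv.coe_coe, AddMonoidAlgebra.coeffLinearEquiv_apply,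
          AddMonoidAlgebra.coeff_single, Finsupp.lsum_apply,
          Finsupp.sum_single_index, map_zero, LinearMap.smul_apply,
          AddMonoidAlgebra.lsingle_apply, smul_eq_mul, AddMonoidAlgebra.smul_single, Pi.add_apply]
        rw [add_comm m' m, ← AddMonoidAlgebra.single_add]
        congr 1
        push_cast
        ring

theorem thetaD_single (i : Fin n) (m : Fin n → ℤ) (r : ℂ) :
    thetaD i (AddMonoidAlgebra.single m r) = (m i : ℂ) • AddMonoidAlgebra.single m r := by
  simp [thetaD]

theorem thetaD_zPow (i : Fin n) (m : Fin n → ℤ) : thetaD i (zPow m) = (m i : ℂ) • zPow m :=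
  thetaD_single i m 1

theorem theta_add (i : Fin n) (f g : ZSeries n) : theta i (f + g) = theta i f + theta i g := by
  funext κ
  simp [theta, mul_add]

theorem theta_zero (i : Fin n) : theta i (0 : ZSeries n) = 0 := by
  funext κ
  simp [theta]

/-- The Leibniz rule for `z_i ∂/∂z_i`. -/
theorem theta_smul (i : Fin n) (P : ZPoly n) (f : ZSeries n) :
    theta i (P • f) = thetaD i P • f + P • theta i f := by
  induction P using AddMonoidAlgebra.induction_linear with
  | zero => simp [theta_zero]
  | add a a' ha ha' => rw [add_smul, theta_add, ha, ha', map_add, add_smul, add_smul]; abel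
  | single m r =>
    have h : AddMonoidAlgebra.single m r = r • zPow m := by simp [zPow]
    rw [thetaD_single, h]
    funext κ
    simp only [theta, smul_assoc, Pi.add_apply, Pi.smul_apply, zPow_smul, smul_eq_mul]
    ring

/-! ### The Weyl function -/

theorem derivation_prod {R A ι' : Type*} [CommRing R] [CommRing A] [Algebra R A] [DecidableEq ι']
    (D : Derivation R A A) (s : Finset ι') (g : ι' → A) :
    D (∏ a ∈ s, g a) = ∑ a ∈ s, (∏ b ∈ s.erase a, g b) * D (g a) := by
  induction s using Finset.induction_on with
  | empty => simp
  | insert a s ha ih =>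
    rw [Finset.prod_insert ha, Finset.sum_insert ha, Finset.erase_insert ha, D.leibniz, ih,
      smul_eq_mul, smul_eq_mul, Finset.mul_sum, add_comm]
    congr 1
    refine Finset.sum_congr rfl fun b hb => ?_
    have hab : a ≠ b := fun h => ha (h ▸ hb)
    rw [Finset.erase_insert_of_ne hab, Finset.prod_insert (by simp [ha]), mul_assoc]

/-- A factor that is constant for `D` does not affect the eigenvalue of `D ∘ D`. -/
theorem derivation_derivation_mul {R A : Type*} [CommRing R] [CommRing A] [Algebra R A]
    (D : Derivation R A A) {F h : A} {c : R} (hF : D F = 0) (hh : D (D h) = c • h) :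
    D (D (F * h)) = c • (F * h) := by
  simp [D.leibniz, hF, hh]

/-- The entry `z_i^{k+1} - z_i^{-(k+1)}` of the determinant that computes the Weyl function. -/
def weylEntry (i : Fin n) (k : ℕ) : ZPoly n :=
  z i ^ (k + 1) - zInv i ^ (k + 1)

theorem thetaD_weylEntry_of_ne {i j : Fin n} (h : j ≠ i) (k : ℕ) :
    thetaD j (weylEntry i k) = 0 := by
  simp [weylEntry, z, zInv, zPow_pow, thetaD_zPow, h]

theorem thetaD_thetaD_weylEntry (i : Fin n) (k : ℕ) :
    thetaD i (thetaD i (weylEntry i k)) = ((k + 1 : ℂ) ^ 2) • weylEntry i k := by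
  simp only [weylEntry, z, zInv, zPow_pow, thetaD_zPow, map_sub, Derivation.map_smul,
    smul_sub, smul_smul]
  congr 2 <;> simp <;> ring

theorem z_mul_zInv (i : Fin n) : z i * zInv i = 1 := zPow_mul_neg _

/-- The entries are monic polynomials in `z_i + z_i⁻¹`, up to the factor `z_i - z_i⁻¹`. -/
theorem weylEntry_eq (i : Fin n) (k : ℕ) : weylEntry i k =
    (z i - zInv i) * (Polynomial.Chebyshev.S (ZPoly n) k).eval (z i + zInv i) := by
  have h := z_mul_zInv i
  induction k using Nat.twoStepInduction with
  | zero => simp [weylEntry]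
  | one => simp [weylEntry]; ring
  | more k h0 h1 =>
    have h2 : Polynomial.Chebyshev.S (ZPoly n) ((k + 2 : ℕ) : ℤ) =
        Polynomial.X * Polynomial.Chebyshev.S (ZPoly n) ((k + 1 : ℕ) : ℤ) -
          Polynomial.Chebyshev.S (ZPoly n) (k : ℤ) := by
      push_cast
      exact Polynomial.Chebyshev.S_add_two _ _
    rw [h2, Polynomial.eval_sub, Polynomial.eval_mul, Polynomial.eval_X, mul_sub, ← h0,
      mul_left_comm, ← h1]
    simp only [weylEntry]
    linear_combination (zInv i ^ (k + 1) - z i ^ (k + 1)) * h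

theorem chebyshev_S_monic (k : ℕ) :
    (Polynomial.Chebyshev.S (ZPoly n) k).natDegree = k ∧
      (Polynomial.Chebyshev.S (ZPoly n) k).Monic := by
  suffices h : Polynomial.IsMonicOfDegree (Polynomial.Chebyshev.S (ZPoly n) k) k from
    ⟨h.natDegree_eq, h.monic⟩
  induction k using Nat.twoStepInduction with
  | zero => simp [Polynomial.isMonicOfDegree_zero_iff]
  | one => simpa using Polynomial.isMonicOfDegree_X (ZPoly n)
  | more k h0 h1 =>
    have h2 : Polynomial.Chebyshev.S (ZPoly n) ((k + 2 : ℕ) : ℤ) =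
        Polynomial.X * Polynomial.Chebyshev.S (ZPoly n) ((k + 1 : ℕ) : ℤ) -
          Polynomial.Chebyshev.S (ZPoly n) (k : ℤ) := by
      push_cast
      exact Polynomial.Chebyshev.S_add_two _ _
    rw [h2]
    refine Polynomial.IsMonicOfDegree.sub ?_ (by rw [h0.natDegree_eq]; omega)
    have := (Polynomial.isMonicOfDegree_X (ZPoly n)).mul h1
    rwa [show 1 + (k + 1) = k + 2 by ring] at this

/-- By `weylEntry_eq` the determinant is a Vandermonde determinant in the `z_i + z_i⁻¹`. The sign
comes from the order of the factors in `weylC`. -/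
theorem weylC_eq_det : weylC n = (∏ i : Fin n, ∏ _j ∈ Finset.Ioi i, (-1 : ℂ)) •
    (Matrix.of fun i j : Fin n => weylEntry i j).det := by
  have h : (Matrix.of fun i j : Fin n => weylEntry i j) =
      Matrix.of fun i j : Fin n => (z i - zInv i) *
        (Matrix.of fun i j : Fin n =>
          (Polynomial.Chebyshev.S (ZPoly n) (j : ℕ)).eval (z i + zInv i)) i j := by
    ext1 i j
    simp [weylEntry_eq]
  rw [h, Matrix.det_mul_column, ← Matrix.det_eval_matrixOfPolynomials_eq_det_vandermonde
    (fun i : Fin n => z i + zInv i) (fun j : Fin n => Polynomial.Chebyshev.S (ZPoly n) (j : ℕ))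
    (fun j => (chebyshev_S_monic _).1) (fun j => (chebyshev_S_monic _).2), Matrix.det_vandermonde,
    weylC, ← mul_smul_comm, Algebra.smul_def]
  congr 1
  simp only [map_prod, ← Finset.prod_mul_distrib]
  refine Finset.prod_congr rfl fun i _ => Finset.prod_congr rfl fun j _ => ?_
  rw [map_neg, map_one]
  ring

theorem sum_sq_fin (n : ℕ) :
    ∑ k : Fin n, ((k : ℕ) + 1 : ℂ) ^ 2 = n * (n + 1) * (2 * n + 1) / 6 := by
  induction n with
  | zero => simp
  | succ n ih => rw [Fin.sum_univ_castSucc]; simp [ih]; ring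

/-- The Weyl function is an eigenfunction of the Laplace operator, with eigenvalue `|ρ|²`. -/
theorem laplace_weylC : ∑ i : Fin n, thetaD i (thetaD i (weylC n)) =
    ((n * (n + 1) * (2 * n + 1) / 6 : ℂ)) • weylC n := by
  have key : ∀ σ : Equiv.Perm (Fin n),
      ∑ i : Fin n, thetaD i (thetaD i (∏ k : Fin n, weylEntry (σ k) (k : ℕ))) =
        ((n * (n + 1) * (2 * n + 1) / 6 : ℂ)) • ∏ k : Fin n, weylEntry (σ k) (k : ℕ) := by
    -- Each `z_i` occurs in exactly one factor, and there as an eigenfunction.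
    intro σ
    rw [← Equiv.sum_comp σ, ← sum_sq_fin, Finset.sum_smul]
    refine Finset.sum_congr rfl fun k _ => ?_
    rw [← Finset.prod_erase_mul _ _ (Finset.mem_univ k)]
    refine derivation_derivation_mul _ ?_ (thetaD_thetaD_weylEntry _ _)
    rw [derivation_prod]
    refine Finset.sum_eq_zero fun a ha => ?_
    rw [thetaD_weylEntry_of_ne, mul_zero]
    exact fun h => (Finset.ne_of_mem_erase ha) (σ.injective h).symm
  rw [weylC_eq_det, Matrix.det_apply]
  simp only [Derivation.map_smul, map_sum, Finset.smul_sum, Matrix.of_apply]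
  rw [Finset.sum_comm]
  refine Finset.sum_congr rfl fun σ _ => ?_
  rw [smul_comm _ (_ : ℂ), smul_comm _ (Equiv.Perm.sign σ), ← key]
  simp only [Units.smul_def, map_zsmul, Finset.smul_sum]

/-! ### Products with the potentials -/

/-- The polynomial `(1 - z^α) (1 - z^{-α})`, so that `z^α / (z^α - 1)² = -1 / rootQ α`. -/
def rootQ (α : Fin n → ℤ) : ZPoly n := (1 - zPow α) * (1 - zPow (-α))

theorem rootQ_eq (α : Fin n → ℤ) : rootQ α = 2 - zPow α - zPow (-α) := by
  rw [rootQ]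
  linear_combination zPow_mul_neg α

/-- Cancellation of the derivative `N` in a trace identity for `S`, when `P` is
`W (1 + z^{-α}) / (1 - z^{-α})`. -/
theorem rootQ_smul_sub {α : Fin n → ℤ} {W P : ZPoly n} {S N F : ZSeries n} {k : ℂ}
    (hS : rootQ α • S = (zPow (-α) - zPow α) • N + k • F)
    (hP : (1 - zPow (-α)) * P = (1 + zPow (-α)) * W) :
    rootQ α • (W • S - P • N) = k • (W • F) := by
  have h : rootQ α * P = W * (zPow (-α) - zPow α) := by
    rw [rootQ]
    linear_combination (1 - zPow α) * hP - W * zPow_mul_neg α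
  rw [smul_sub, ← mul_smul (rootQ α) P, h, smul_comm, hS, smul_add, mul_smul, add_sub_cancel_left,
    smul_comm]

theorem isRatMul_sub {Ψ A : ZSeries n} {i j : Fin n} (h : rootQ (eps i - eps j) • A = -Ψ) :
    IsRatMul (z i * z j) ((z i - z j) ^ 2) Ψ A := by
  have hQ : (z i - z j) ^ 2 = -(z i * z j) * rootQ (eps i - eps j) := by
    rw [rootQ_eq, neg_sub, sub_eq_add_neg (eps i), sub_eq_add_neg (eps j), zPow_add, zPow_add]
    linear_combination (- z i ^ 2) * z_mul_zInv j - z j ^ 2 * z_mul_zInv i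
  rw [IsRatMul, zMul_eq_smul, zMul_eq_smul, hQ, mul_smul, h, neg_smul, smul_neg, neg_neg]

theorem isRatMul_add {Ψ A : ZSeries n} {i j : Fin n} (h : rootQ (eps i + eps j) • A = -Ψ) :
    IsRatMul (z i * z j) ((z i * z j - 1) ^ 2) Ψ A := by
  have hQ : (z i * z j - 1) ^ 2 = -(z i * z j) * rootQ (eps i + eps j) := by
    have := zPow_mul_neg (eps i + eps j)
    rw [rootQ_eq]
    rw [zPow_add] at this ⊢
    linear_combination -this
  rw [IsRatMul, zMul_eq_smul, zMul_eq_smul, hQ, mul_smul, h, neg_smul, smul_neg, neg_neg]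

theorem isRatMul_two {Ψ A : ZSeries n} {i : Fin n} (h : rootQ (eps i + eps i) • A = -Ψ) :
    IsRatMul (z i ^ 2) ((z i ^ 2 - 1) ^ 2) Ψ A := by
  have := isRatMul_add h
  rwa [← pow_two] at this

/-! ### Logarithmic derivatives of the Weyl function -/

/-- The product of the factors of the Weyl function other than the one that belongs to the roots
`±ε_i ± ε_j`. -/
def weylErasePair (i j : Fin n) : ZPoly n :=
  (∏ r : Fin n, (z r - zInv r)) *
    ∏ p ∈ (Finset.univ.sigma fun i : Fin n => Finset.Ioi i).erase ⟨i, j⟩,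
      (z p.1 + zInv p.1 - (z p.2 + zInv p.2))

/-- `𝒲 (1 + z^{-α}) / (1 - z^{-α})` for `α = ε_i - ε_j`. -/
def weylSub (i j : Fin n) : ZPoly n :=
  weylErasePair i j * ((z i + z j) * (1 - zInv i * zInv j))

/-- `𝒲 (1 + z^{-α}) / (1 - z^{-α})` for `α = ε_i + ε_j`. -/
def weylAdd (i j : Fin n) : ZPoly n :=
  weylErasePair i j * ((z i - z j) * (1 + zInv i * zInv j))

/-- `𝒲 (1 + z^{-α}) / (1 - z^{-α})` for `α = 2 ε_p`. -/
def weylLong (p : Fin n) : ZPoly n :=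
  (∏ r ∈ Finset.univ.erase p, (z r - zInv r)) *
    (∏ i : Fin n, ∏ j ∈ Finset.Ioi i, (z i + zInv i - (z j + zInv j))) * (z p + zInv p)

theorem weylErasePair_mul {i j : Fin n} (h : i < j) :
    weylErasePair i j * (z i + zInv i - (z j + zInv j)) = weylC n := by
  rw [weylErasePair, weylC, mul_assoc, Finset.prod_sigma']
  congr 1
  exact Finset.prod_erase_mul (Finset.univ.sigma fun i : Fin n => Finset.Ioi i)
    (fun p => z p.1 + zInv p.1 - (z p.2 + zInv p.2)) (a := ⟨i, j⟩) (by simpa using h)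

theorem weylSub_eq {i j : Fin n} (h : i < j) : (1 - zPow (-(eps i - eps j))) * weylSub i j =
    (1 + zPow (-(eps i - eps j))) * weylC n := by
  have key : ∀ {R : Type} [CommRing R] {a a' b b' : R}, a * a' = 1 → b * b' = 1 →
      (1 - b * a') * ((a + b) * (1 - a' * b')) = (1 + b * a') * (a + a' - (b + b')) := by
    intros
    grind
  rw [← weylErasePair_mul h, weylSub, neg_sub, sub_eq_add_neg (eps j), zPow_add, mul_left_comm,
    mul_left_comm _ (weylErasePair i j)]
  exact congrArg _ (key (z_mul_zInv i) (z_mul_zInv j))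

theorem weylAdd_eq {i j : Fin n} (h : i < j) : (1 - zPow (-(eps i + eps j))) * weylAdd i j =
    (1 + zPow (-(eps i + eps j))) * weylC n := by
  have key : ∀ {R : Type} [CommRing R] {a a' b b' : R}, a * a' = 1 → b * b' = 1 →
      (1 - a' * b') * ((a - b) * (1 + a' * b')) = (1 + a' * b') * (a + a' - (b + b')) := by
    intros
    grind
  rw [← weylErasePair_mul h, weylAdd, neg_add, zPow_add, mul_left_comm,
    mul_left_comm _ (weylErasePair i j)]
  exact congrArg _ (key (z_mul_zInv i) (z_mul_zInv j))

theorem weylLong_eq (p : Fin n) : (1 - zPow (-(eps p + eps p))) * weylLong p =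
    (1 + zPow (-(eps p + eps p))) * weylC n := by
  have h := z_mul_zInv p
  rw [weylLong, weylC,
    ← Finset.prod_erase_mul _ (fun r : Fin n => z r - zInv r) (Finset.mem_univ p), neg_add,
    zPow_add]
  generalize (∏ i : Fin n, ∏ j ∈ Finset.Ioi i, (z i + zInv i - (z j + zInv j)) : ZPoly n) = v
  generalize (∏ r ∈ Finset.univ.erase p, (z r - zInv r) : ZPoly n) = v'
  linear_combination (-2 * v * v' * zInv p) * h

theorem thetaD_z (i j : Fin n) : thetaD i (z j) = if j = i then z j else 0 := by
  rw [thetaD_zPow]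
  split_ifs with h
  · simp [h]
  · simp [Ne.symm h]

theorem thetaD_zInv (i j : Fin n) : thetaD i (zInv j) = if j = i then -zInv j else 0 := by
  rw [thetaD_zPow]
  split_ifs with h
  · simp [h]
  · simp [Ne.symm h]

/-- The gradient of the Weyl function: `2 ∇𝒲 = ∑ 𝒲 (1 + z^{-α}) / (1 - z^{-α}) α`, the sum
being over the positive roots `α`, paired with a vector `f` of series. -/
theorem sum_thetaD_weylC_smul (f : Fin n → ZSeries n) :
    ∑ i : Fin n, (2 : ℂ) • thetaD i (weylC n) • f i =
      (∑ i : Fin n, ∑ j ∈ Finset.Ioi i,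
        (weylSub i j • (f i - f j) + weylAdd i j • (f i + f j))) +
      ∑ p : Fin n, (2 : ℂ) • weylLong p • f p := by
  have h : ∀ i : Fin n, thetaD i (weylC n) =
      (∑ p ∈ Finset.univ.sigma fun i : Fin n => Finset.Ioi i, weylErasePair p.1 p.2 *
        ((if p.1 = i then z p.1 - zInv p.1 else 0) - (if p.2 = i then z p.2 - zInv p.2 else 0))) +
      weylLong i := by
    intro i
    rw [weylC, Derivation.leibniz, Finset.prod_sigma', derivation_prod, derivation_prod,
      smul_eq_mul, smul_eq_mul, Finset.mul_sum]
    congr 1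
    · refine Finset.sum_congr rfl fun p _ => ?_
      rw [weylErasePair, mul_assoc]
      congr 2
      simp only [map_add, map_sub, thetaD_z, thetaD_zInv]
      split_ifs <;> ring
    · rw [Finset.sum_eq_single i]
      · rw [weylLong, Finset.prod_sigma', map_sub, thetaD_z, thetaD_zInv, if_pos rfl, if_pos rfl]
        ring
      · intro b _ hb
        rw [map_sub, thetaD_z, thetaD_zInv, if_neg hb, if_neg hb, sub_zero, mul_zero]
      · simp
  simp only [h, add_smul, smul_add, Finset.sum_add_distrib (f := fun i => _ • (_ • f i))]
  congr 1
  rw [Finset.sum_sigma']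
  simp only [Finset.sum_smul, Finset.smul_sum]
  rw [Finset.sum_comm]
  refine Finset.sum_congr rfl fun p _ => ?_
  have h2 : ∀ i : Fin n, (2 : ℂ) • ((weylErasePair p.1 p.2 *
        ((if p.1 = i then z p.1 - zInv p.1 else 0) -
          (if p.2 = i then z p.2 - zInv p.2 else 0))) • f i) =
      (if p.1 = i then (2 : ℂ) • (weylErasePair p.1 p.2 * (z p.1 - zInv p.1)) • f i else 0) -
      (if p.2 = i then (2 : ℂ) • (weylErasePair p.1 p.2 * (z p.2 - zInv p.2)) • f i else 0) := by
    intro i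
    split_ifs <;> simp [mul_sub, sub_smul, smul_sub]
  simp only [h2, Finset.sum_sub_distrib, Finset.sum_ite_eq, Finset.mem_univ, if_true]
  have h3 : ∀ (P : ZPoly n) (g : ZSeries n), (2 : ℂ) • P • g = (2 * P) • g := by
    intro P g
    rw [two_smul, ← two_smul (ZPoly n), smul_smul]
  rw [h3, h3]
  have e1 : 2 * (weylErasePair p.1 p.2 * (z p.1 - zInv p.1)) =
      weylSub p.1 p.2 + weylAdd p.1 p.2 := by
    rw [weylSub, weylAdd]
    linear_combination (2 * weylErasePair p.1 p.2 * zInv p.1) * z_mul_zInv p.2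
  have e2 : 2 * (weylErasePair p.1 p.2 * (z p.2 - zInv p.2)) =
      weylSub p.1 p.2 - weylAdd p.1 p.2 := by
    rw [weylSub, weylAdd]
    linear_combination (2 * weylErasePair p.1 p.2 * zInv p.2) * z_mul_zInv p.1
  rw [e1, e2]
  module

/-! ### Expansions in the domain `|z₁| > ⋯ > |zₙ| > 1` -/

/-- The exponents of the series `f` are bounded above along `β`. -/
def BddAlong (β : Fin n → ℤ) (f : ZSeries n) : Prop :=
  ∀ κ : Fin n → ℂ, ∃ K : ℕ, ∀ k : ℕ, K ≤ k → f (fun i => κ i + k * β i) = 0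

namespace BddAlong

variable {β : Fin n → ℤ} {f g : ZSeries n}

theorem add (hf : BddAlong β f) (hg : BddAlong β g) : BddAlong β (f + g) := by
  intro κ
  obtain ⟨K, hK⟩ := hf κ
  obtain ⟨L, hL⟩ := hg κ
  refine ⟨max K L, fun k hk => ?_⟩
  rw [Pi.add_apply, hK k (le_of_max_le_left hk), hL k (le_of_max_le_right hk), add_zero]

theorem csmul (hf : BddAlong β f) (c : ℂ) : BddAlong β (c • f) := by
  intro κ
  obtain ⟨K, hK⟩ := hf κ
  exact ⟨K, fun k hk => by rw [Pi.smul_apply, hK k hk, smul_zero]⟩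

theorem neg (hf : BddAlong β f) : BddAlong β (-f) := by
  intro κ
  obtain ⟨K, hK⟩ := hf κ
  exact ⟨K, fun k hk => by rw [Pi.neg_apply, hK k hk, neg_zero]⟩

theorem sub (hf : BddAlong β f) (hg : BddAlong β g) : BddAlong β (f - g) := by
  rw [sub_eq_add_neg]
  exact hf.add hg.neg

theorem theta (hf : BddAlong β f) (i : Fin n) : BddAlong β (theta i f) := by
  intro κ
  obtain ⟨K, hK⟩ := hf κ
  exact ⟨K, fun k hk => by rw [SpTrace.theta, hK k hk, mul_zero]⟩

theorem smul (hf : BddAlong β f) (P : ZPoly n) : BddAlong β (P • f) := by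
  induction P using AddMonoidAlgebra.induction_linear with
  | zero => exact fun κ => ⟨0, fun k _ => by rw [zero_smul, Pi.zero_apply]⟩
  | add a b ha hb => rw [add_smul]; exact ha.add hb
  | single m r =>
    have h : AddMonoidAlgebra.single m r = r • zPow m := by simp [zPow]
    rw [h, smul_assoc]
    refine csmul (fun κ => ?_) r
    obtain ⟨K, hK⟩ := hf (fun i => κ i - m i)
    refine ⟨K, fun k hk => ?_⟩
    rw [zPow_smul, ← hK k hk]
    congr 1
    funext i
    ring

theorem finite_support (hf : BddAlong β f) (κ : Fin n → ℂ) :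
    {k : ℕ | f (fun i => κ i + k * β i) ≠ 0}.Finite := by
  obtain ⟨K, hK⟩ := hf κ
  refine (Set.finite_Iio K).subset fun k hk => ?_
  by_contra h
  exact hk (hK k (not_lt.1 h))

end BddAlong

/-- Among the series bounded above along `β`, the product with `z^β / (z^β - 1)²` is unique, and is
given by the expansion `∑ k z^{-kβ}`. -/
theorem expandMul_eq {β : Fin n → ℤ} {Ψ A : ZSeries n} (hA : BddAlong β A)
    (h : rootQ β • A = -Ψ) : expandMul β Ψ = A := by
  have hΨ : BddAlong β Ψ := by
    rw [← neg_neg Ψ, ← h]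
    exact (hA.smul _).neg
  funext κ
  obtain ⟨K, hK⟩ := hA κ
  obtain ⟨L, hL⟩ := hΨ κ
  -- The second difference of `A` along `β` is `Ψ`; summation by parts against `k` telescopes.
  have hrec : ∀ k : ℕ, Ψ (fun i => κ i + (k + 1 : ℕ) * β i) =
      A (fun i => κ i + k * β i) + A (fun i => κ i + (k + 2 : ℕ) * β i) -
        2 * A (fun i => κ i + (k + 1 : ℕ) * β i) := by
    intro k
    have h1 := congrFun h (fun i => κ i + (k + 1 : ℕ) * β i)
    rw [rootQ_eq, sub_smul, sub_smul, two_smul] at h1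
    simp only [Pi.sub_apply, Pi.add_apply, zPow_smul, Pi.neg_apply] at h1
    have e1 : (fun i => κ i + ((k + 1 : ℕ) : ℂ) * (β i : ℂ) - (β i : ℂ)) =
        fun i => κ i + k * β i := by
      funext i; push_cast; ring
    have e2 : (fun i => κ i + ((k + 1 : ℕ) : ℂ) * (β i : ℂ) - ((-β i : ℤ) : ℂ)) =
        fun i => κ i + (k + 2 : ℕ) * β i := by
      funext i; push_cast; ring
    rw [e1, e2] at h1
    linear_combination h1
  have hsum : ∀ N : ℕ, ∑ k ∈ Finset.range (N + 1), (k : ℂ) * Ψ (fun i => κ i + k * β i) =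
      A κ + N * A (fun i => κ i + (N + 1 : ℕ) * β i) -
        (N + 1) * A (fun i => κ i + N * β i) := by
    intro N
    induction N with
    | zero => simp
    | succ N ih =>
      rw [Finset.sum_range_succ, ih, hrec]
      push_cast
      ring_nf
  have hsub : (Function.support fun k : ℕ => (k : ℂ) * Ψ (fun i => κ i + k * β i)) ⊆
      (Finset.range (max K L + 1) : Finset ℕ) := by
    intro k hk
    rw [Finset.coe_range, Set.mem_Iio]
    by_contra h'
    exact hk (by dsimp only; rw [hL k (by omega), mul_zero])
  rw [expandMul, finsum_eq_sum_of_support_subset _ hsub, hsum, hK _ (by omega), hK _ (by omega)]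
  ring

/-! ### From the trace identities to the Olshanetsky–Perelomov equation -/

/-- The trace identities for the root vectors and for the Casimir element. `Sm i j`, `Sp i j`,
`Sl p` are the traces of `Φ (e f + f e)` for the roots `ε_i - ε_j`, `ε_i + ε_j`, `2 ε_p`. -/
structure TraceIdentities (μ : ℂ) (F : ZSeries n) (Sm Sp : Fin n → Fin n → ZSeries n)
    (Sl : Fin n → ZSeries n) : Prop where
  sub : ∀ i j : Fin n, i < j → rootQ (eps i - eps j) • Sm i j =
    (zPow (-(eps i - eps j)) - zPow (eps i - eps j)) • (theta i F - theta j F) +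
      (-1 / 2 : ℂ) • F
  add : ∀ i j : Fin n, i < j → rootQ (eps i + eps j) • Sp i j =
    (zPow (-(eps i + eps j)) - zPow (eps i + eps j)) • (theta i F + theta j F) +
      (-1 / 2 : ℂ) • F
  long : ∀ p : Fin n, rootQ (eps p + eps p) • Sl p =
    (zPow (-(eps p + eps p)) - zPow (eps p + eps p)) • theta p F + (-3 / 8 : ℂ) • F
  casimir : (∑ i : Fin n, theta i (theta i F)) +
    (∑ i : Fin n, ∑ j ∈ Finset.Ioi i, (Sm i j + Sp i j)) + ∑ p : Fin n, (2 : ℂ) • Sl p = μ • F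

/-- The Laplace operator conjugated by the Weyl function. -/
theorem laplace_weylC_smul (F : ZSeries n) :
    ∑ i : Fin n, theta i (theta i (weylC n • F)) =
      weylC n • (∑ i : Fin n, theta i (theta i F)) +
      ((∑ i : Fin n, ∑ j ∈ Finset.Ioi i,
        (weylSub i j • (theta i F - theta j F) + weylAdd i j • (theta i F + theta j F))) +
      ∑ p : Fin n, (2 : ℂ) • weylLong p • theta p F) +
      ((n * (n + 1) * (2 * n + 1) / 6 : ℂ)) • weylC n • F := by
  rw [← sum_thetaD_weylC_smul (fun i => theta i F), ← smul_assoc _ (weylC n), ← laplace_weylC,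
    Finset.sum_smul, Finset.smul_sum, ← Finset.sum_add_distrib, ← Finset.sum_add_distrib]
  refine Finset.sum_congr rfl fun i _ => ?_
  rw [theta_smul, theta_add, theta_smul, theta_smul, two_smul]
  abel

namespace TraceIdentities

variable {μ : ℂ} {F : ZSeries n} {Sm Sp : Fin n → Fin n → ZSeries n} {Sl : Fin n → ZSeries n}

theorem rootQ_sub (h : TraceIdentities μ F Sm Sp Sl) {i j : Fin n} (hij : i < j) :
    rootQ (eps i - eps j) •
      ((2 : ℂ) • (weylC n • Sm i j - weylSub i j • (theta i F - theta j F))) =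
        -(weylC n • F) := by
  rw [smul_comm, rootQ_smul_sub (h.sub i j hij) (weylSub_eq hij), smul_smul]
  norm_num

theorem rootQ_add (h : TraceIdentities μ F Sm Sp Sl) {i j : Fin n} (hij : i < j) :
    rootQ (eps i + eps j) •
      ((2 : ℂ) • (weylC n • Sp i j - weylAdd i j • (theta i F + theta j F))) =
        -(weylC n • F) := by
  rw [smul_comm, rootQ_smul_sub (h.add i j hij) (weylAdd_eq hij), smul_smul]
  norm_num

theorem rootQ_long (h : TraceIdentities μ F Sm Sp Sl) (p : Fin n) :
    rootQ (eps p + eps p) •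
      ((8 / 3 : ℂ) • (weylC n • Sl p - weylLong p • theta p F)) = -(weylC n • F) := by
  rw [smul_comm, rootQ_smul_sub (h.long p) (weylLong_eq p), smul_smul]
  norm_num

/-- The first-order terms of the conjugated Laplace operator cancel those in the products with the
potentials. -/
theorem opEquation (h : TraceIdentities μ F Sm Sp Sl) :
    OPEquation (1 / 2) (1 / 2) (3 / 4) (μ + n * (n + 1) * (2 * n + 1) / 6) (weylC n • F)
      (fun i j => (2 : ℂ) • (weylC n • Sm i j - weylSub i j • (theta i F - theta j F)))
      (fun i j => (2 : ℂ) • (weylC n • Sp i j - weylAdd i j • (theta i F + theta j F)))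
      (fun p => (8 / 3 : ℂ) • (weylC n • Sl p - weylLong p • theta p F)) := by
  have e1 : ∀ f : ZSeries n, (1 / 2 : ℂ) • (2 : ℂ) • f = f := fun f => by
    rw [smul_smul]; norm_num
  have e2 : ∀ f : ZSeries n, (3 / 4 : ℂ) • (8 / 3 : ℂ) • f = (2 : ℂ) • f := fun f => by
    rw [smul_smul]; norm_num
  have hc := congrArg (fun f => weylC n • f) h.casimir
  simp only [smul_add, Finset.smul_sum, Finset.sum_add_distrib] at hc
  rw [OPEquation, laplace_weylC_smul, add_smul, ← smul_comm (weylC n) μ, ← hc]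
  simp only [e1, e2, Finset.sum_add_distrib, Finset.sum_sub_distrib, smul_sub, Finset.smul_sum,
    smul_comm (weylC n) (2 : ℂ)]
  abel

theorem solvesOP (h : TraceIdentities μ F Sm Sp Sl) :
    SolvesOP (1 / 2) (1 / 2) (3 / 4) (μ + n * (n + 1) * (2 * n + 1) / 6) (weylC n • F) :=
  ⟨_, _, _, ⟨fun _ _ hij => isRatMul_sub (h.rootQ_sub hij),
    fun _ _ hij => isRatMul_add (h.rootQ_add hij), fun p => isRatMul_two (h.rootQ_long p)⟩,
    h.opEquation⟩

theorem solvesOPExpanded (h : TraceIdentities μ F Sm Sp Sl)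
    (hF : ∀ β : Fin n → ℤ, IsPosRoot β → BddAlong β F)
    (hm : ∀ (β : Fin n → ℤ) (i j : Fin n), IsPosRoot β → BddAlong β (Sm i j))
    (hp : ∀ (β : Fin n → ℤ) (i j : Fin n), IsPosRoot β → BddAlong β (Sp i j))
    (hl : ∀ (β : Fin n → ℤ) (i : Fin n), IsPosRoot β → BddAlong β (Sl i)) :
    SolvesOPExpanded (1 / 2) (1 / 2) (3 / 4) (μ + n * (n + 1) * (2 * n + 1) / 6)
      (weylC n • F) := by
  have eA : ∀ i j : Fin n, i < j → expandMul (eps i - eps j) (weylC n • F) =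
      (2 : ℂ) • (weylC n • Sm i j - weylSub i j • (theta i F - theta j F)) := by
    intro i j hij
    have hβ : IsPosRoot (eps i - eps j) := Or.inl ⟨i, j, hij, Or.inl rfl⟩
    refine expandMul_eq ?_ (h.rootQ_sub hij)
    exact (((hm _ _ _ hβ).smul _).sub
      ((((hF _ hβ).theta _).sub ((hF _ hβ).theta _)).smul _)).csmul _
  have eB : ∀ i j : Fin n, i < j → expandMul (eps i + eps j) (weylC n • F) =
      (2 : ℂ) • (weylC n • Sp i j - weylAdd i j • (theta i F + theta j F)) := by
    intro i j hij
    have hβ : IsPosRoot (eps i + eps j) := Or.inl ⟨i, j, hij, Or.inr rfl⟩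
    refine expandMul_eq ?_ (h.rootQ_add hij)
    exact (((hp _ _ _ hβ).smul _).sub
      ((((hF _ hβ).theta _).add ((hF _ hβ).theta _)).smul _)).csmul _
  have eD : ∀ p : Fin n, expandMul (eps p + eps p) (weylC n • F) =
      (8 / 3 : ℂ) • (weylC n • Sl p - weylLong p • theta p F) := by
    intro p
    have hβ : IsPosRoot (eps p + eps p) := Or.inr ⟨p, rfl⟩
    refine expandMul_eq ?_ (h.rootQ_long p)
    exact (((hl _ _ hβ).smul _).sub (((hF _ hβ).theta _).smul _)).csmul _
  refine ⟨fun κ β hβ => ((hF β hβ).smul _).finite_support κ, ⟨fun i j hij => ?_,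
    fun i j hij => ?_, fun p => ?_⟩, ?_⟩
  · dsimp only
    rw [eA i j hij]
    exact isRatMul_sub (h.rootQ_sub hij)
  · dsimp only
    rw [eB i j hij]
    exact isRatMul_add (h.rootQ_add hij)
  · dsimp only
    rw [eD p]
    exact isRatMul_two (h.rootQ_long p)
  · refine Eq.trans ?_ h.opEquation
    congr 2
    · refine Finset.sum_congr rfl fun i _ => Finset.sum_congr rfl fun j hij => ?_
      dsimp only
      rw [eA i j (Finset.mem_Ioi.1 hij), eB i j (Finset.mem_Ioi.1 hij)]
    · refine Finset.sum_congr rfl fun p _ => ?_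
      dsimp only
      rw [eD p]

end TraceIdentities

/-! ### Root vectors and their brackets -/

theorem J_mul_J : Matrix.J (Fin n) ℂ * Matrix.J (Fin n) ℂ = -1 := Matrix.J_squared _ _

theorem mem_sp_iff' (A : Matrix (Fin n ⊕ Fin n) (Fin n ⊕ Fin n) ℂ) :
    A ∈ sp n ↔ A = Matrix.J (Fin n) ℂ * A.transpose * Matrix.J (Fin n) ℂ := by
  rw [mem_sp_iff, mul_neg]
  have h := J_mul_J (n := n)
  constructor
  · intro hA
    rw [mul_assoc, hA, mul_neg, ← mul_assoc, h, neg_mul, one_mul, neg_neg]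
  · intro hA
    conv_rhs => rw [hA]
    rw [mul_assoc, ← mul_assoc (Matrix.J (Fin n) ℂ), h, neg_mul, one_mul, neg_neg]

/-- Twice the projection of `gl(2n)` onto `sp(2n)` along the symmetric part for the anti-involution
`A ↦ -J Aᵀ J`. -/
def toSp (n : ℕ) : Matrix (Fin n ⊕ Fin n) (Fin n ⊕ Fin n) ℂ →ₗ[ℂ] sp n where
  toFun A := ⟨A + Matrix.J (Fin n) ℂ * A.transpose * Matrix.J (Fin n) ℂ, by
    have h := J_mul_J (n := n)
    rw [mem_sp_iff', Matrix.transpose_add, Matrix.transpose_mul, Matrix.transpose_mul,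
      Matrix.transpose_transpose, Matrix.J_transpose]
    generalize Matrix.J (Fin n) ℂ = J at *
    have e : J * (A.transpose + -J * (A * -J)) * J =
        J * A.transpose * J + (J * J) * A * (J * J) := by noncomm_ring
    rw [e, h]
    noncomm_ring⟩
  map_add' A B := by
    ext1
    change A + B + Matrix.J (Fin n) ℂ * (A + B).transpose * Matrix.J (Fin n) ℂ =
      (A + Matrix.J (Fin n) ℂ * A.transpose * Matrix.J (Fin n) ℂ) +
        (B + Matrix.J (Fin n) ℂ * B.transpose * Matrix.J (Fin n) ℂ)
    rw [Matrix.transpose_add, mul_add, add_mul]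
    abel
  map_smul' c A := by
    ext1
    simp

theorem toSp_coe (X : sp n) : toSp n X.1 = (2 : ℂ) • X := by
  ext1
  change X.1 + Matrix.J (Fin n) ℂ * X.1.transpose * Matrix.J (Fin n) ℂ = (2 : ℂ) • X.1
  rw [← (mem_sp_iff' X.1).1 X.2, two_smul]

/-- The projection `gl(2n) → sp(2n)` commutes with the adjoint action of `sp(2n)`. -/
theorem lie_toSp (X : sp n) (A : Matrix (Fin n ⊕ Fin n) (Fin n ⊕ Fin n) ℂ) :
    ⁅X, toSp n A⁆ = toSp n (X.1 * A - A * X.1) := by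
  ext1
  have h := J_mul_J (n := n)
  have hX := (mem_sp_iff _).1 X.2
  have hX' : Matrix.J (Fin n) ℂ * X.1.transpose = -X.1 * Matrix.J (Fin n) ℂ := by
    conv_rhs => rw [(mem_sp_iff' X.1).1 X.2]
    rw [neg_mul, mul_assoc, h, mul_neg, neg_neg, mul_one]
  rw [LieSubalgebra.coe_bracket, LieRing.of_associative_ring_bracket]
  change X.1 * (A + Matrix.J (Fin n) ℂ * A.transpose * Matrix.J (Fin n) ℂ) -
    (A + Matrix.J (Fin n) ℂ * A.transpose * Matrix.J (Fin n) ℂ) * X.1 =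
    (X.1 * A - A * X.1) +
      Matrix.J (Fin n) ℂ * (X.1 * A - A * X.1).transpose * Matrix.J (Fin n) ℂ
  rw [Matrix.transpose_sub, Matrix.transpose_mul, Matrix.transpose_mul]
  generalize Matrix.J (Fin n) ℂ = J at *
  have e : J * (A.transpose * X.1.transpose - X.1.transpose * A.transpose) * J =
      J * A.transpose * (X.1.transpose * J) - (J * X.1.transpose) * A.transpose * J := by
    noncomm_ring
  rw [e, hX, hX']
  noncomm_ring

theorem toSp_inl_inl (p q : Fin n) : toSp n (E (.inl p) (.inl q)) = C p q := by
  ext1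
  change E (.inl p) (.inl q) + Matrix.J (Fin n) ℂ * (E (.inl p) (.inl q)).transpose *
    Matrix.J (Fin n) ℂ = E (.inl p) (.inl q) - E (.inr q) (.inr p)
  ext (i | i) (j | j) <;>
    simp [Matrix.mul_apply, Matrix.J, Matrix.single_apply, Matrix.one_apply, ite_and] <;> grind

theorem toSp_inr_inr (p q : Fin n) : toSp n (E (.inr p) (.inr q)) = -C q p := by
  ext1
  change E (.inr p) (.inr q) + Matrix.J (Fin n) ℂ * (E (.inr p) (.inr q)).transpose *
    Matrix.J (Fin n) ℂ = -(E (.inl q) (.inl p) - E (.inr p) (.inr q))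
  ext (i | i) (j | j) <;>
    simp [Matrix.mul_apply, Matrix.J, Matrix.single_apply, Matrix.one_apply, ite_and] <;> grind

theorem toSp_inl_inr (p q : Fin n) :
    toSp n (E (.inl p) (.inr q)) = (1 + if p = q then (1 : ℂ) else 0) • CUp p q := by
  ext1
  change E (.inl p) (.inr q) + Matrix.J (Fin n) ℂ * (E (.inl p) (.inr q)).transpose *
    Matrix.J (Fin n) ℂ = (1 + if p = q then (1 : ℂ) else 0) •
      if p = q then E (.inl p) (.inr p) else E (.inl p) (.inr q) + E (.inl q) (.inr p)
  by_cases h : p = q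
  · subst h
    ext (i | i) (j | j) <;>
      simp [Matrix.mul_apply, Matrix.J, Matrix.single_apply, Matrix.one_apply, ite_and] <;> grind
  · ext (i | i) (j | j) <;>
      simp [Matrix.mul_apply, Matrix.J, Matrix.single_apply, Matrix.one_apply, ite_and, h] <;>
      grind

theorem toSp_inr_inl (p q : Fin n) :
    toSp n (E (.inr p) (.inl q)) = (1 + if p = q then (1 : ℂ) else 0) • CLow p q := by
  ext1
  change E (.inr p) (.inl q) + Matrix.J (Fin n) ℂ * (E (.inr p) (.inl q)).transpose *
    Matrix.J (Fin n) ℂ = (1 + if p = q then (1 : ℂ) else 0) •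
      if p = q then E (.inr p) (.inl p) else E (.inr p) (.inl q) + E (.inr q) (.inl p)
  by_cases h : p = q
  · subst h
    ext (i | i) (j | j) <;>
      simp [Matrix.mul_apply, Matrix.J, Matrix.single_apply, Matrix.one_apply, ite_and] <;> grind
  · ext (i | i) (j | j) <;>
      simp [Matrix.mul_apply, Matrix.J, Matrix.single_apply, Matrix.one_apply, ite_and, h] <;>
      grind

theorem CUp_eq_toSp (p q : Fin n) : CUp p q =
    (1 + if p = q then (1 : ℂ) else 0)⁻¹ • toSp n (E (.inl p) (.inr q)) := by
  rw [toSp_inl_inr, smul_smul, inv_mul_cancel₀, one_smul]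
  split_ifs <;> norm_num

theorem CLow_eq_toSp (p q : Fin n) : CLow p q =
    (1 + if p = q then (1 : ℂ) else 0)⁻¹ • toSp n (E (.inr p) (.inl q)) := by
  rw [toSp_inr_inl, smul_smul, inv_mul_cancel₀, one_smul]
  split_ifs <;> norm_num

/-- The weight of the basis vector with index `a` of the standard representation, as a function on
the Cartan subalgebra, at `C_{i,i}`. -/
def stdWt (i : Fin n) : Fin n ⊕ Fin n → ℤ :=
  Sum.elim (fun j => eps j i) (fun j => -eps j i)

theorem C_eq_diagonal (i : Fin n) : (C i i).1 = Matrix.diagonal fun a => (stdWt i a : ℂ) := by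
  ext (a | a) (b | b) <;>
    simp [C, stdWt, Matrix.single_apply, Matrix.diagonal_apply, Pi.single_apply] <;> grind

theorem lie_cartan_toSp (i : Fin n) (a b : Fin n ⊕ Fin n) :
    ⁅C i i, toSp n (E a b)⁆ = ((stdWt i a - stdWt i b : ℤ) : ℂ) • toSp n (E a b) := by
  rw [lie_toSp, C_eq_diagonal, ← map_smul]
  congr 1
  ext c d
  simp only [Matrix.sub_apply, Matrix.diagonal_mul, Matrix.mul_diagonal, Matrix.smul_apply,
    Matrix.single_apply, smul_eq_mul]
  split_ifs with h
  · obtain ⟨rfl, rfl⟩ := h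
    push_cast
    ring
  · simp

theorem lie_cartan_C (i p q : Fin n) :
    ⁅(C i i : sp n), C p q⁆ = (((eps p - eps q : Fin n → ℤ) i : ℤ) : ℂ) • C p q := by
  rw [← toSp_inl_inl p q, lie_cartan_toSp]
  rfl

theorem lie_cartan_CUp (i p q : Fin n) :
    ⁅(C i i : sp n), CUp p q⁆ = (((eps p + eps q : Fin n → ℤ) i : ℤ) : ℂ) • CUp p q := by
  rw [CUp_eq_toSp, lie_smul, lie_cartan_toSp, smul_comm]
  simp [stdWt]

theorem lie_cartan_CLow (i p q : Fin n) :
    ⁅(C i i : sp n), CLow p q⁆ = (((-(eps p + eps q) : Fin n → ℤ) i : ℤ) : ℂ) • CLow p q := by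
  rw [CLow_eq_toSp, lie_smul, lie_cartan_toSp, smul_comm]
  simp [stdWt]
  grind

theorem E_mul_E (a b c d : Fin n ⊕ Fin n) : E a b * E c d = if b = c then E a d else 0 := by
  split_ifs
  · subst b
    simp
  · exact Matrix.single_mul_single_of_ne _ _ _ _ ‹_› _

theorem lie_C_C (i j : Fin n) : ⁅(C i j : sp n), C j i⁆ = C i i - C j j := by
  rw [← toSp_inl_inl j i, lie_toSp, ← toSp_inl_inl i i, ← toSp_inl_inl j j, ← map_sub]
  simp [C, sub_mul, mul_sub, E_mul_E, -Matrix.single_mul_single_same]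

theorem lie_CUp_CLow {i j : Fin n} (h : i ≠ j) : ⁅(CUp i j : sp n), CLow j i⁆ = C i i + C j j := by
  rw [CLow_eq_toSp, if_neg h.symm, add_zero, inv_one, one_smul, lie_toSp]
  have : (CUp i j).1 * E (.inr j) (.inl i) - E (.inr j) (.inl i) * (CUp i j).1 =
      E (.inl i) (.inl i) - E (.inr j) (.inr j) := by
    simp [CUp, h, add_mul, mul_add, E_mul_E, -Matrix.single_mul_single_same]
  rw [this, map_sub, toSp_inl_inl, toSp_inr_inr, sub_neg_eq_add]

theorem lie_CUp_CLow_self (p : Fin n) : ⁅(CUp p p : sp n), CLow p p⁆ = C p p := by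
  rw [CLow_eq_toSp, if_pos rfl, lie_smul, lie_toSp]
  have : (CUp p p).1 * E (.inr p) (.inl p) - E (.inr p) (.inl p) * (CUp p p).1 =
      E (.inl p) (.inl p) - E (.inr p) (.inr p) := by
    simp [CUp]
  rw [this, map_sub, toSp_inl_inl, toSp_inr_inr, sub_neg_eq_add, ← two_smul ℂ (C p p), smul_smul]
  norm_num

theorem CUp_comm (i j : Fin n) : (CUp i j : sp n) = CUp j i := by
  by_cases h : i = j
  · rw [h]
  · ext1; simp [CUp, h, Ne.symm h, add_comm]

theorem CLow_comm (i j : Fin n) : (CLow i j : sp n) = CLow j i := by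
  by_cases h : i = j
  · rw [h]
  · ext1; simp [CLow, h, Ne.symm h, add_comm]

/-- `sp(2n)` is spanned by the elements `toSp (E a b)`. -/
theorem eq_sum_toSp (X : sp n) : X = (1 / 2 : ℂ) • ∑ a, ∑ b, X.1 a b • toSp n (E a b) := by
  have h : X.1 = ∑ a, ∑ b, X.1 a b • E a b := by
    conv_lhs => rw [Matrix.matrix_eq_sum_single X.1]
    simp
  have h2 := toSp_coe X
  rw [h] at h2
  simp only [map_sum, map_smul] at h2
  rw [h2, smul_smul]
  norm_num

/-! ### The Casimir element -/

theorem sum_sum_eq_diag_add {A : Type*} [AddCommMonoid A] (f : Fin n → Fin n → A) :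
    ∑ i, ∑ j, f i j = ∑ i, f i i + ∑ i, ∑ j ∈ Finset.Ioi i, (f i j + f j i) := by
  have h : ∀ i, ∑ j, f i j = f i i + (∑ j ∈ Finset.Ioi i, f i j + ∑ j ∈ Finset.Iio i, f i j) := by
    intro i
    rw [← Finset.add_sum_erase _ _ (Finset.mem_univ i)]
    congr 1
    rw [← Finset.sum_union]
    · refine Finset.sum_congr ?_ fun _ _ => rfl
      ext j
      simp only [Finset.mem_erase, Finset.mem_univ, and_true, Finset.mem_union, Finset.mem_Ioi,
        Finset.mem_Iio]
      rw [or_comm]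
      exact ne_iff_lt_or_gt
    · rw [Finset.disjoint_left]
      intro j h1 h2
      exact absurd (Finset.mem_Ioi.1 h1) (not_lt.2 (Finset.mem_Iio.1 h2).le)
  simp only [h, Finset.sum_add_distrib]
  congr 2
  exact Finset.sum_comm' (by simp)

/-- The Casimir element in terms of the images `toSp (E a b)` of the matrix units. A short root
occurs twice in the sum, and a long root once but with `toSp (E a b)` equal to twice the root
vector. -/
theorem two_smul_casimir (n : ℕ) : (2 : ℂ) • casimir n =
    ∑ a, ∑ b, ι (toSp n (E a b)) * ι (toSp n (E b a)) := by
  have h1 : ∀ G : Fin n → Fin n → U n, (∀ i j, G i j = G j i) →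
      ∑ p, ∑ q, ((1 + if p = q then (1 : ℂ) else 0) ^ 2) • G p q =
        (2 : ℂ) • ((∑ s, ∑ r ∈ Finset.Ioi s, G s r) + (2 : ℂ) • ∑ p, G p p) := by
    intro G hG
    rw [sum_sum_eq_diag_add, add_comm, smul_add, Finset.smul_sum, Finset.smul_sum]
    congr 1
    · refine Finset.sum_congr rfl fun i _ => ?_
      rw [Finset.smul_sum]
      refine Finset.sum_congr rfl fun j hj => ?_
      have hij := Finset.mem_Ioi.1 hj
      rw [if_neg hij.ne, if_neg hij.ne', hG j i]
      module
    · rw [Finset.smul_sum]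
      refine Finset.sum_congr rfl fun i _ => ?_
      rw [if_pos rfl]
      module
  have hU := h1 (fun p q => ι (CUp p q) * ι (CLow q p)) fun i j => by rw [CLow_comm, CUp_comm]
  have hL := h1 (fun p q => ι (CLow p q) * ι (CUp q p)) fun i j => by rw [CLow_comm, CUp_comm]
  have eU : ∀ p q : Fin n, ι (toSp n (E (.inl p) (.inr q))) * ι (toSp n (E (.inr q) (.inl p))) =
      ((1 + if p = q then (1 : ℂ) else 0) ^ 2) • (ι (CUp p q) * ι (CLow q p)) := by
    intro p q
    rw [toSp_inl_inr, toSp_inr_inl, ι, ι, map_smul, map_smul, smul_mul_smul_comm, sq]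
    simp only [eq_comm]
  have eL : ∀ p q : Fin n, ι (toSp n (E (.inr p) (.inl q))) * ι (toSp n (E (.inl q) (.inr p))) =
      ((1 + if p = q then (1 : ℂ) else 0) ^ 2) • (ι (CLow p q) * ι (CUp q p)) := by
    intro p q
    rw [toSp_inl_inr, toSp_inr_inl, ι, ι, map_smul, map_smul, smul_mul_smul_comm, sq]
    simp only [eq_comm]
  have eC : ∀ p q : Fin n, ι (toSp n (E (.inr p) (.inr q))) * ι (toSp n (E (.inr q) (.inr p))) =
      ι (C q p) * ι (C p q) := by
    intro p q
    rw [toSp_inr_inr, toSp_inr_inr, ι, ι, map_neg, map_neg, neg_mul_neg]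
  simp only [Fintype.sum_sum_type, Finset.sum_add_distrib, eU, eL, eC, hU, hL, toSp_inl_inl]
  rw [Finset.sum_comm (f := fun p q : Fin n => ι (C q p) * ι (C p q)), casimir]
  have hs : ∀ s : Fin n, ∑ r ∈ Finset.Ioi s, (ι (CLow r s) * ι (CUp s r) +
      ι (CUp s r) * ι (CLow r s)) = ∑ r ∈ Finset.Ioi s, ι (CLow s r) * ι (CUp r s) +
        ∑ r ∈ Finset.Ioi s, ι (CUp s r) * ι (CLow r s) := by
    intro s
    rw [← Finset.sum_add_distrib]
    refine Finset.sum_congr rfl fun r _ => ?_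
    rw [CLow_comm r s, CUp_comm r s]
  have h2 : (2 : U n) = algebraMap ℂ (U n) 2 := by rw [map_ofNat]
  simp only [hs, Finset.sum_add_distrib]
  rw [h2, ← Algebra.smul_def]
  module

/-- An element which acts on a family of elements `G a b` as a matrix acts on matrix units commutes
with `∑ G a b * G b a`. -/
theorem commute_sum_mul {A m : Type*} [Ring A] [Algebra ℂ A] [Fintype m] (x : m → m → ℂ) (y : A)
    (G : m → m → A)
    (h : ∀ a b, y * G a b - G a b * y = ∑ c, x c a • G c b - ∑ c, x b c • G a c) :
    Commute y (∑ a, ∑ b, G a b * G b a) := by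
  have h1 : ∀ a b, y * (G a b * G b a) - G a b * G b a * y =
      (∑ c, x c a • (G c b * G b a) - ∑ c, x a c • (G a b * G b c)) -
        (∑ c, x b c • (G a c * G b a) - ∑ c, x c b • (G a b * G c a)) := by
    intro a b
    have e : y * (G a b * G b a) - G a b * G b a * y =
        (y * G a b - G a b * y) * G b a + G a b * (y * G b a - G b a * y) := by noncomm_ring
    rw [e, h, h]
    simp only [sub_mul, mul_sub, Finset.sum_mul, Finset.mul_sum, smul_mul_assoc, mul_smul_comm]
    abel
  rw [commute_iff_eq, ← sub_eq_zero, Finset.mul_sum, Finset.sum_mul, ← Finset.sum_sub_distrib]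
  simp only [Finset.mul_sum, Finset.sum_mul, ← Finset.sum_sub_distrib, h1]
  simp only [Finset.sum_sub_distrib]
  have e1 : ∑ a, ∑ b, ∑ c, x a c • (G a b * G b c) = ∑ a, ∑ b, ∑ c, x c a • (G c b * G b a) := by
    calc _ = ∑ b, ∑ a, ∑ c, x a c • (G a b * G b c) := Finset.sum_comm
      _ = ∑ b, ∑ c, ∑ a, x a c • (G a b * G b c) :=
        Finset.sum_congr rfl fun _ _ => Finset.sum_comm
      _ = _ := Finset.sum_comm
  have e2 : ∑ a, ∑ b, ∑ c, x c b • (G a b * G c a) = ∑ a, ∑ b, ∑ c, x b c • (G a c * G b a) :=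
    Finset.sum_congr rfl fun _ _ => Finset.sum_comm
  rw [e1, e2, sub_self, sub_self, sub_self]

/-- The Casimir element is central. -/
theorem commute_casimir (X : sp n) : Commute (ι X) (casimir n) := by
  have key : Commute (ι X) ((2 : ℂ) • casimir n) := by
    rw [two_smul_casimir]
    refine commute_sum_mul X.1 _ _ fun a b => ?_
    have h : X.1 * E a b - E a b * X.1 = ∑ c, X.1 c a • E c b - ∑ c, X.1 b c • E a c := by
      ext c d
      simp only [Matrix.sub_apply, Matrix.sum_apply, Matrix.smul_apply, Matrix.mul_apply,
        Matrix.single_apply, smul_eq_mul, mul_ite, ite_mul, mul_one, mul_zero, one_mul, zero_mul,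
        ite_and, Finset.sum_ite_eq, Finset.sum_ite_eq', Finset.mem_univ, if_true]
      simp [Finset.sum_ite_irrel]
    rw [← LieRing.of_associative_ring_bracket, ι, ι, ← LieHom.map_lie, lie_toSp, h]
    simp only [map_sub, map_sum, map_smul]
  have := key.smul_right ((1 / 2 : ℂ))
  rw [smul_smul] at this
  norm_num at this
  exact this

/-! ### Root vectors acting through the variables `x` -/

section

variable {M : Type*} [AddCommGroup M] [Module ℂ M]

theorem coeffMap_lie [LieRingModule (sp n) M] {Φ : M →ₗ[ℂ] LaurentX n M}
    (hΦ : IsIntertwiner Φ) (u : sp n) (w : M) (j : Fin n → ℤ) :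
    coeffMap Φ j ⁅u, w⁆ = ⁅u, coeffMap Φ j w⁆ + pointRep u (Φ w) j := hΦ u w j

theorem pointRep_cartan (i : Fin n) (g : LaurentX n M) (j : Fin n → ℤ) :
    pointRep (C i i) g j = (j i : ℂ) • g j := by
  rw [pointRep_C, if_pos rfl]
  change ((((j - eps i) i : ℤ) : ℂ) + 1 / 2) • g (j - eps i + eps i) + (1 / 2 : ℂ) • g j = _
  rw [sub_add_cancel, ← add_smul]
  congr 1
  simp
  ring

/-- Root vectors `e`, `f` for the roots `α`, `-α`, with `[e, f] = ∑ η_i C_{i,i}`, which act through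
the variables `x` between the monomials `x^*` and `x^{-α} x^*` by the scalars `a` and `b`. -/
structure IsRootPair (M : Type*) [AddCommGroup M] [Module ℂ M] (α : Fin n → ℤ) (η : Fin n → ℂ)
    (a b : ℂ) (e f : sp n) : Prop where
  lie_e : ∀ i, ⁅(C i i : sp n), e⁆ = (α i : ℂ) • e
  lie_f : ∀ i, ⁅(C i i : sp n), f⁆ = (((-α) i : ℤ) : ℂ) • f
  lie_e_f : ⁅e, f⁆ = ∑ i, η i • C i i
  pointRep_e : ∀ g : LaurentX n M, pointRep e g 0 = a • g (-α)
  pointRep_f : ∀ g : LaurentX n M, pointRep f g (-α) = b • g 0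

theorem isRootPair_sub {i j : Fin n} (h : i ≠ j) : IsRootPair M (eps i - eps j)
    (Pi.single i 1 - Pi.single j 1) (1 / 2) (-1 / 2) (C i j) (C j i) where
  lie_e k := lie_cartan_C k i j
  lie_f k := by rw [lie_cartan_C, neg_sub]
  lie_e_f := by
    rw [lie_C_C]
    simp [sub_smul, Finset.sum_sub_distrib, Pi.single_apply, ite_smul]
  pointRep_e g := by
    rw [pointRep_C, if_neg h, zero_smul, add_zero]
    change ((((0 - eps i : Fin n → ℤ) j : ℤ) : ℂ) + 1 / 2) • g (0 - eps i + eps j) = _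
    congr 1
    · simp [h.symm]
    · congr 1; abel
  pointRep_f g := by
    rw [pointRep_C, if_neg h.symm, zero_smul, add_zero]
    change ((((-(eps i - eps j) - eps j : Fin n → ℤ) i : ℤ) : ℂ) + 1 / 2) •
      g (-(eps i - eps j) - eps j + eps i) = _
    congr 1
    · simp [h]; norm_num
    · congr 1; abel

theorem isRootPair_add {i j : Fin n} (h : i ≠ j) : IsRootPair M (eps i + eps j)
    (Pi.single i 1 + Pi.single j 1) (-1) (1 / 4) (CUp i j) (CLow j i) where
  lie_e k := lie_cartan_CUp k i j
  lie_f k := by rw [lie_cartan_CLow, add_comm]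
  lie_e_f := by
    rw [lie_CUp_CLow h]
    simp [add_smul, Finset.sum_add_distrib, Pi.single_apply, ite_smul]
  pointRep_e g := by
    rw [pointRep_CUp, if_neg h]
    change (-(1 / (1 + 0)) : ℂ) • g (0 - eps i - eps j) = _
    congr 1
    · norm_num
    · congr 1; abel
  pointRep_f g := by
    rw [pointRep_CLow, if_neg h.symm]
    change (1 / (1 + 0) : ℂ) • ((((-(eps i + eps j) : Fin n → ℤ) j : ℤ) : ℂ) + 1 / 2) •
      ((((-(eps i + eps j) + eps j : Fin n → ℤ) i : ℤ) : ℂ) + 1 / 2) •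
      g (-(eps i + eps j) + eps j + eps i) = _
    rw [smul_smul, smul_smul]
    congr 1
    · simp [h, h.symm]; norm_num
    · congr 1; abel

theorem isRootPair_long (p : Fin n) : IsRootPair M (eps p + eps p)
    (Pi.single p 1) (-1 / 2) (3 / 8) (CUp p p) (CLow p p) where
  lie_e k := lie_cartan_CUp k p p
  lie_f k := lie_cartan_CLow k p p
  lie_e_f := by
    rw [lie_CUp_CLow_self]
    simp [Pi.single_apply, ite_smul]
  pointRep_e g := by
    rw [pointRep_CUp, if_pos rfl]
    change (-(1 / (1 + 1)) : ℂ) • g (0 - eps p - eps p) = _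
    congr 1
    · norm_num
    · congr 1; abel
  pointRep_f g := by
    rw [pointRep_CLow, if_pos rfl]
    change (1 / (1 + 1) : ℂ) • ((((-(eps p + eps p) : Fin n → ℤ) p : ℤ) : ℂ) + 1 / 2) •
      ((((-(eps p + eps p) + eps p : Fin n → ℤ) p : ℤ) : ℂ) + 1 / 2) •
      g (-(eps p + eps p) + eps p + eps p) = _
    rw [smul_smul, smul_smul]
    congr 1
    · simp; norm_num
    · congr 1; abel

end

/-! ### Traces of diagonal blocks -/

section

variable {M : Type*} [AddCommGroup M] [Module ℂ M] [LieRingModule (sp n) M]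
  [LieModule ℂ (sp n) M]

theorem wtProj_of_mem (hM : IsWeightModule (n := n) M) {κ : Fin n → ℂ} {w : M}
    (hw : w ∈ wtSpace (n := n) M κ) : wtProj hM κ w = ⟨w, hw⟩ := by
  classical
  have h : (LinearEquiv.ofBijective (DirectSum.coeLinearMap (wtSpace (n := n) M)) hM).symm w =
      DirectSum.lof ℂ (Fin n → ℂ) (fun κ => wtSpace (n := n) M κ) κ ⟨w, hw⟩ := by
    rw [LinearEquiv.symm_apply_eq]
    exact (DirectSum.coeLinearMap_lof (wtSpace (n := n) M) κ ⟨w, hw⟩).symm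
  rw [wtProj, LinearMap.comp_apply, LinearEquiv.coe_coe, h, DirectSum.component.lof_self]

theorem wtProj_of_mem_ne (hM : IsWeightModule (n := n) M) {κ κ' : Fin n → ℂ} {w : M}
    (hw : w ∈ wtSpace (n := n) M κ') (h : κ' ≠ κ) : wtProj hM κ w = 0 := by
  classical
  have h : (LinearEquiv.ofBijective (DirectSum.coeLinearMap (wtSpace (n := n) M)) hM).symm w =
      DirectSum.lof ℂ (Fin n → ℂ) (fun κ => wtSpace (n := n) M κ) κ' ⟨w, hw⟩ := by
    rw [LinearEquiv.symm_apply_eq]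
    exact (DirectSum.coeLinearMap_lof (wtSpace (n := n) M) κ' ⟨w, hw⟩).symm
  rw [wtProj, LinearMap.comp_apply, LinearEquiv.coe_coe, h, DirectSum.component.of,
    dif_neg (by assumption)]

/-- The trace of the diagonal block of an endomorphism on the weight space `M^κ`. -/
def blockTr (hM : IsWeightModule (n := n) M) (κ : Fin n → ℂ) : Module.End ℂ M →ₗ[ℂ] ℂ where
  toFun T := LinearMap.trace ℂ (wtSpace (n := n) M κ)
    (wtProj hM κ ∘ₗ T ∘ₗ (wtSpace (n := n) M κ).subtype)
  map_add' S T := by rw [LinearMap.add_comp, LinearMap.comp_add, map_add]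
  map_smul' c T := by rw [LinearMap.smul_comp, LinearMap.comp_smul, map_smul, RingHom.id_apply]

theorem traceFn_apply (hM : IsWeightModule (n := n) M) (Φ : M →ₗ[ℂ] LaurentX n M)
    (j : Fin n → ℤ) (κ : Fin n → ℂ) : traceFn hM Φ j κ = blockTr hM κ (coeffMap Φ j) := rfl

theorem blockTr_congr (hM : IsWeightModule (n := n) M) {κ : Fin n → ℂ} {S T : Module.End ℂ M}
    (h : ∀ w ∈ wtSpace (n := n) M κ, S w = T w) : blockTr hM κ S = blockTr hM κ T := by
  change LinearMap.trace ℂ _ _ = LinearMap.trace ℂ _ _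
  congr 1
  ext1 w
  simp only [LinearMap.comp_apply, Submodule.subtype_apply, h w.1 w.2]

theorem blockTr_eq_zero (hM : IsWeightModule (n := n) M) {κ κ' : Fin n → ℂ} {T : Module.End ℂ M}
    (h : ∀ w ∈ wtSpace (n := n) M κ, T w ∈ wtSpace (n := n) M κ') (hκ : κ' ≠ κ) :
    blockTr hM κ T = 0 := by
  change LinearMap.trace ℂ _ _ = 0
  rw [← map_zero (LinearMap.trace ℂ (wtSpace (n := n) M κ))]
  congr 1
  ext1 w
  simp only [LinearMap.comp_apply, Submodule.subtype_apply, wtProj_of_mem_ne hM (h w.1 w.2) hκ,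
    LinearMap.zero_apply]

theorem blockTr_of_bot (hM : IsWeightModule (n := n) M) {κ : Fin n → ℂ} (T : Module.End ℂ M)
    (h : wtSpace (n := n) M κ = ⊥) : blockTr hM κ T = 0 := by
  rw [← map_zero (blockTr hM κ)]
  refine blockTr_congr hM fun w hw => ?_
  rw [h, Submodule.mem_bot] at hw
  rw [hw, map_zero, map_zero]

/-- Cyclicity of the trace, for maps between two weight spaces. -/
theorem blockTr_mul_comm (hM : IsWeightModule (n := n) M)
    [∀ κ : Fin n → ℂ, FiniteDimensional ℂ (wtSpace (n := n) M κ)] {κ κ' : Fin n → ℂ}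
    {A B : Module.End ℂ M} (hA : ∀ w ∈ wtSpace (n := n) M κ, A w ∈ wtSpace (n := n) M κ')
    (hB : ∀ w ∈ wtSpace (n := n) M κ', B w ∈ wtSpace (n := n) M κ) :
    blockTr hM κ (B * A) = blockTr hM κ' (A * B) := by
  have h1 : wtProj hM κ ∘ₗ (B * A) ∘ₗ (wtSpace (n := n) M κ).subtype =
      B.restrict hB ∘ₗ A.restrict hA := by
    ext1 w
    exact wtProj_of_mem hM (hB _ (hA _ w.2))
  have h2 : wtProj hM κ' ∘ₗ (A * B) ∘ₗ (wtSpace (n := n) M κ').subtype =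
      A.restrict hA ∘ₗ B.restrict hB := by
    ext1 w
    exact wtProj_of_mem hM (hA _ (hB _ w.2))
  change LinearMap.trace ℂ _ _ = LinearMap.trace ℂ _ _
  rw [h1, h2, LinearMap.trace_comp_comm']

/-- The endomorphism of `M` by which an element of `sp(2n)` acts. -/
abbrev act (M : Type*) [AddCommGroup M] [Module ℂ M] [LieRingModule (sp n) M]
    [LieModule ℂ (sp n) M] (u : sp n) : Module.End ℂ M := LieModule.toEnd ℂ (sp n) M u

theorem act_mul_act (u v : sp n) : act M u * act M v = act M v * act M u + act M ⁅u, v⁆ := by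
  ext1 w
  change ⁅u, ⁅v, w⁆⁆ = ⁅v, ⁅u, w⁆⁆ + ⁅⁅u, v⁆, w⁆
  rw [lie_lie]
  abel

theorem act_mem_wtSpace {u : sp n} {α : Fin n → ℤ} (hu : ∀ i, ⁅(C i i : sp n), u⁆ = (α i : ℂ) • u)
    {κ : Fin n → ℂ} {w : M} (hw : w ∈ wtSpace (n := n) M κ) :
    act M u w ∈ wtSpace (n := n) M (fun i => κ i + α i) := by
  intro i
  change ⁅(C i i : sp n), ⁅u, w⁆⁆ = (κ i + α i) • ⁅u, w⁆
  rw [leibniz_lie, hu, smul_lie, hw i, lie_smul, add_smul, add_comm]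

/-! ### Trace identities for root vectors -/

/-- The coefficient of `x^j` in an intertwiner shifts weights by `-j`. -/
theorem coeffMap_mem_wtSpace {Φ : M →ₗ[ℂ] LaurentX n M} (hΦ : IsIntertwiner Φ) (j : Fin n → ℤ)
    {κ : Fin n → ℂ} {w : M} (hw : w ∈ wtSpace (n := n) M κ) :
    coeffMap Φ j w ∈ wtSpace (n := n) M (fun i => κ i - j i) := by
  intro i
  have h := coeffMap_lie hΦ (C i i) w j
  rw [hw i, map_smul, pointRep_cartan] at h
  rw [sub_smul, h]
  exact (add_sub_cancel_right _ _).symm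

/-- The trace of `Φ (e f + f e)` is computed by moving `e` and `f` once around the trace, with the
auxiliary traces `T` of `Φ e f` at `x^0` and `R` of `Φ f` at `x^{-α}`. -/
theorem IsRootPair.trace_identity {α : Fin n → ℤ} {η : Fin n → ℂ} {a b : ℂ} {e f : sp n}
    (h : IsRootPair M α η a b e f) (hM : IsWeightModule (n := n) M)
    [∀ κ : Fin n → ℂ, FiniteDimensional ℂ (wtSpace (n := n) M κ)]
    {Φ : M →ₗ[ℂ] LaurentX n M} (hΦ : IsIntertwiner Φ) :
    (rootQ α • (fun κ => blockTr hM κ (coeffMap Φ 0 * (act M e * act M f + act M f * act M e))) :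
      ZSeries n) =
    (zPow (-α) - zPow α) • (∑ i, η i • theta i (traceFn hM Φ 0)) +
      (2 * (a * b)) • traceFn hM Φ 0 := by
  set F : ZSeries n := traceFn hM Φ 0 with hF
  set N : ZSeries n := ∑ i, η i • theta i F with hN
  set R : ZSeries n := fun κ => blockTr hM κ (coeffMap Φ (-α) * act M f) with hR
  set T : ZSeries n := fun κ => blockTr hM κ (coeffMap Φ 0 * (act M e * act M f)) with hT
  have hNκ : ∀ κ, blockTr hM κ (coeffMap Φ 0 * act M ⁅e, f⁆) = N κ := by
    intro κ
    have h1 : blockTr hM κ (coeffMap Φ 0 * act M ⁅e, f⁆) =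
        blockTr hM κ ((∑ i, η i * κ i) • coeffMap Φ 0) := by
      refine blockTr_congr hM fun w hw => ?_
      have h2 : act M ⁅e, f⁆ w = (∑ i, η i * κ i) • w := by
        rw [h.lie_e_f]
        change ⁅∑ i, η i • (C i i : sp n), w⁆ = _
        rw [sum_lie, Finset.sum_smul]
        refine Finset.sum_congr rfl fun i _ => ?_
        rw [smul_lie, hw i, smul_smul]
      rw [Module.End.mul_apply, h2, map_smul, LinearMap.smul_apply]
    rw [h1, map_smul, ← traceFn_apply, hN, Finset.sum_apply, smul_eq_mul, Finset.sum_mul]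
    refine Finset.sum_congr rfl fun i _ => ?_
    rw [Pi.smul_apply, theta, smul_eq_mul, mul_assoc]
  -- Moving `f` around the trace in `R` shifts the weight by `α` and leaves the multiple `b` of `F`.
  have hRe : R = zPow (-α) • R + b • F := by
    funext κ
    have h1 : coeffMap Φ (-α) * act M f = act M f * coeffMap Φ (-α) + b • coeffMap Φ 0 := by
      ext1 w
      have h2 := coeffMap_lie hΦ f w (-α)
      rw [h.pointRep_f] at h2
      exact h2
    have h2 : blockTr hM κ (act M f * coeffMap Φ (-α)) =
        blockTr hM (fun i => κ i + α i) (coeffMap Φ (-α) * act M f) := by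
      refine blockTr_mul_comm hM (fun w hw => ?_) fun w hw => ?_
      · simpa using coeffMap_mem_wtSpace hΦ (-α) hw
      · simpa using act_mem_wtSpace h.lie_f hw
    rw [hR]
    simp only [Pi.add_apply, zPow_smul, Pi.smul_apply]
    rw [h1, map_add, h2, map_smul, h1]
    simp [hF, traceFn_apply]
  -- Moving `e` around the trace in `T` leaves the multiple `a` of `R`.
  have hTe : T = zPow α • T - zPow α • N + a • R := by
    funext κ
    have h1 : coeffMap Φ 0 * (act M e * act M f) =
        act M e * (coeffMap Φ 0 * act M f) + a • (coeffMap Φ (-α) * act M f) := by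
      ext1 w
      have h2 := coeffMap_lie hΦ e ⁅f, w⁆ 0
      rw [h.pointRep_e] at h2
      exact h2
    have h2 : blockTr hM κ (act M e * (coeffMap Φ 0 * act M f)) =
        blockTr hM (fun i => κ i - α i) (coeffMap Φ 0 * act M f * act M e) := by
      refine blockTr_mul_comm hM (fun w hw => ?_) fun w hw => ?_
      · have := coeffMap_mem_wtSpace hΦ 0 (act_mem_wtSpace h.lie_f hw)
        simpa [sub_eq_add_neg] using this
      · simpa using act_mem_wtSpace h.lie_e hw
    have h3 : coeffMap Φ 0 * act M f * act M e =
        coeffMap Φ 0 * (act M e * act M f) - coeffMap Φ 0 * act M ⁅e, f⁆ := by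
      rw [act_mul_act e f, mul_add, mul_assoc, add_sub_cancel_right]
    simp only [Pi.add_apply, Pi.sub_apply, zPow_smul, Pi.smul_apply]
    conv_lhs => rw [hT]
    dsimp only
    rw [h1, map_add, h2, h3, map_sub, hNκ, map_smul]
  have hS : (fun κ => blockTr hM κ (coeffMap Φ 0 * (act M e * act M f + act M f * act M e)) :
      ZSeries n) = (2 : ZPoly n) • T - N := by
    funext κ
    rw [Pi.sub_apply, two_smul, Pi.add_apply, ← hNκ, hT]
    dsimp only
    rw [← map_add, ← map_sub]
    congr 1
    rw [act_mul_act e f]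
    noncomm_ring
  have hz := zPow_mul_neg α
  have hT1 : (1 - zPow α) • T = -(zPow α • N) + a • R := by
    rw [sub_smul, one_smul]
    conv_lhs => lhs; rw [hTe]
    abel
  have hR1 : (1 - zPow (-α)) • R = b • F := by
    rw [sub_smul, one_smul]
    conv_lhs => lhs; rw [hRe]
    abel
  have e1 : rootQ α • T = -((1 - zPow (-α)) * zPow α) • N + (a * b) • F := by
    rw [rootQ, mul_comm, mul_smul, hT1, smul_add, smul_comm _ a, hR1, smul_smul a b, smul_neg,
      neg_smul, mul_smul (1 - zPow (-α)) (zPow α) N]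
  have e2 : 2 * -((1 - zPow (-α)) * zPow α) - rootQ α = zPow (-α) - zPow α := by
    rw [rootQ]
    linear_combination hz
  rw [hS, smul_sub, smul_comm, e1, ← e2, smul_add, sub_smul, mul_smul 2 (_ : ZPoly n) N,
    two_smul (ZPoly n) ((a * b) • F), two_mul (a * b), add_smul (a * b)]
  abel

/-! ### The trace function of a module on which the Casimir element is a scalar -/

theorem actU_ι_mul_ι (u v : sp n) : actU M (ι u * ι v) = act M u * act M v := by
  rw [actU, map_mul, ι, ι, UniversalEnvelopingAlgebra.lift_ι_apply,
    UniversalEnvelopingAlgebra.lift_ι_apply]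

/-- The trace of `Φ (e f + f e) z₁^{C_{1,1}} ⋯ zₙ^{C_{n,n}}`, at `x^0`. -/
def pairTr (hM : IsWeightModule (n := n) M) (Φ : M →ₗ[ℂ] LaurentX n M) (e f : sp n) :
    ZSeries n :=
  fun κ => blockTr hM κ (coeffMap Φ 0 * (act M e * act M f + act M f * act M e))

/-- The terms of the Casimir element, grouped by positive roots. -/
theorem actU_casimir : actU M (casimir n) = (∑ i : Fin n, act M (C i i) * act M (C i i)) +
    (∑ i : Fin n, ∑ j ∈ Finset.Ioi i, ((act M (C i j) * act M (C j i) +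
      act M (C j i) * act M (C i j)) +
      (act M (CUp i j) * act M (CLow j i) + act M (CLow j i) * act M (CUp i j)))) +
    ∑ p : Fin n, (2 : ℂ) • (act M (CUp p p) * act M (CLow p p) +
      act M (CLow p p) * act M (CUp p p)) := by
  have hadd : ∀ a b : U n, actU M (a + b) = actU M a + actU M b := fun a b => map_add _ a b
  have hsum : ∀ (s : Finset (Fin n)) (g : Fin n → U n),
      actU M (∑ i ∈ s, g i) = ∑ i ∈ s, actU M (g i) := fun s g => map_sum _ g s
  have htwo : ∀ a : U n, actU M (2 * a) = (2 : ℂ) • actU M a := fun a => by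
    rw [actU, map_mul, map_ofNat, ← map_ofNat (algebraMap ℂ (Module.End ℂ M)) 2,
      ← Algebra.smul_def]
    rfl
  rw [casimir, sum_sum_eq_diag_add]
  simp only [hadd, hsum, htwo, actU_ι_mul_ι, Finset.sum_add_distrib, Finset.smul_sum, smul_add]
  abel

theorem traceIdentities (hM : IsWeightModule (n := n) M)
    [∀ κ : Fin n → ℂ, FiniteDimensional ℂ (wtSpace (n := n) M κ)] {μ : ℂ}
    (hμ : actU M (casimir n) = μ • LinearMap.id) {Φ : M →ₗ[ℂ] LaurentX n M}
    (hΦ : IsIntertwiner Φ) :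
    TraceIdentities μ (traceFn hM Φ 0) (fun i j => pairTr hM Φ (C i j) (C j i))
      (fun i j => pairTr hM Φ (CUp i j) (CLow j i))
      (fun p => pairTr hM Φ (CUp p p) (CLow p p)) where
  sub i j hij := by
    refine ((isRootPair_sub hij.ne).trace_identity hM hΦ).trans ?_
    congr 2
    · simp [sub_smul, Finset.sum_sub_distrib, Pi.single_apply, ite_smul]
    · norm_num
  add i j hij := by
    refine ((isRootPair_add hij.ne).trace_identity hM hΦ).trans ?_
    congr 2
    · simp [add_smul, Finset.sum_add_distrib, Pi.single_apply, ite_smul]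
    · norm_num
  long p := by
    refine ((isRootPair_long p).trace_identity hM hΦ).trans ?_
    congr 2
    · simp [Pi.single_apply, ite_smul]
    · norm_num
  casimir := by
    funext κ
    have h1 : blockTr hM κ (coeffMap Φ 0 * actU M (casimir n)) = μ * traceFn hM Φ 0 κ := by
      have h3 : coeffMap Φ 0 * (μ • LinearMap.id) = μ • coeffMap Φ 0 := by
        rw [mul_smul_comm]
        rfl
      rw [hμ, h3, map_smul, smul_eq_mul, traceFn_apply]
    have h2 : ∀ i, blockTr hM κ (coeffMap Φ 0 * (act M (C i i) * act M (C i i))) =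
        κ i * (κ i * traceFn hM Φ 0 κ) := by
      intro i
      rw [traceFn_apply, ← mul_assoc (κ i), ← smul_eq_mul (a := κ i * κ i), ← map_smul]
      refine blockTr_congr hM fun w hw => ?_
      change coeffMap Φ 0 ⁅(C i i : sp n), ⁅(C i i : sp n), w⁆⁆ = _
      rw [hw i, lie_smul, hw i, smul_smul, map_smul]
      rfl
    rw [actU_casimir] at h1
    simp only [mul_add, Finset.mul_sum, map_add, map_sum, h2, mul_smul_comm, map_smul] at h1
    simp only [Pi.add_apply, Finset.sum_apply, theta, Pi.smul_apply, pairTr, mul_add, map_add,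
      smul_eq_mul] at h1 ⊢
    exact h1

/-- The trace function of an intertwiner does not involve `x`. -/
theorem traceFn_eq_zero (hM : IsWeightModule (n := n) M) {Φ : M →ₗ[ℂ] LaurentX n M}
    (hΦ : IsIntertwiner Φ) {j : Fin n → ℤ} (hj : j ≠ 0) : traceFn hM Φ j = 0 := by
  funext κ
  rw [traceFn_apply]
  refine blockTr_eq_zero hM (fun w hw => coeffMap_mem_wtSpace hΦ j hw) fun h => hj ?_
  funext i
  simpa using congrFun h i

theorem traceFn_solvesOP (hM : IsWeightModule (n := n) M)
    (hfin : ∀ κ : Fin n → ℂ, FiniteDimensional ℂ (wtSpace (n := n) M κ)) {μ : ℂ}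
    (hμ : actU M (casimir n) = μ • LinearMap.id) {Φ : M →ₗ[ℂ] LaurentX n M}
    (hΦ : IsIntertwiner Φ) :
    SolvesOP (1 / 2) (1 / 2) (3 / 4) (μ + n * (n + 1) * (2 * n + 1) / 6)
      (zMul (weylC n) (traceFn hM Φ 0)) := by
  rw [zMul_eq_smul]
  exact (traceIdentities hM hμ hΦ).solvesOP

theorem traceFn_solvesOPExpanded (hM : IsWeightModule (n := n) M)
    (hfin : ∀ κ : Fin n → ℂ, FiniteDimensional ℂ (wtSpace (n := n) M κ)) {μ : ℂ}
    (hμ : actU M (casimir n) = μ • LinearMap.id) {Φ : M →ₗ[ℂ] LaurentX n M}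
    (hΦ : IsIntertwiner Φ) (hb : WeightsBoundedAbove (n := n) M) :
    SolvesOPExpanded (1 / 2) (1 / 2) (3 / 4) (μ + n * (n + 1) * (2 * n + 1) / 6)
      (zMul (weylC n) (traceFn hM Φ 0)) := by
  have hT : ∀ (β : Fin n → ℤ) (T : Module.End ℂ M), IsPosRoot β →
      BddAlong β (fun κ => blockTr hM κ T) := by
    intro β T hβ κ
    obtain ⟨K, hK⟩ := hb κ β hβ
    exact ⟨K, fun k hk => blockTr_of_bot hM T (hK k hk)⟩
  rw [zMul_eq_smul]
  exact (traceIdentities hM hμ hΦ).solvesOPExpanded (fun β hβ => hT β _ hβ)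
    (fun β _ _ hβ => hT β _ hβ) (fun β _ _ hβ => hT β _ hβ) (fun β _ hβ => hT β _ hβ)

end

/-! ### Generators of the universal enveloping algebra and of Verma modules -/

/-- `U(sp(2n))` is generated by `sp(2n)`. -/
theorem mem_subalgebra_of_ι (S : Subalgebra ℂ (U n)) (h : ∀ X : sp n, ι X ∈ S) (a : U n) :
    a ∈ S := by
  let f : sp n →ₗ⁅ℂ⁆ S :=
    { toFun := fun X => ⟨ι X, h X⟩
      map_add' := fun X Y => Subtype.ext (map_add _ X Y)
      map_smul' := fun c X => Subtype.ext (map_smul _ c X)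
      map_lie' := fun {X Y} => Subtype.ext (LieHom.map_lie _ X Y) }
  have hf : S.val.comp (UniversalEnvelopingAlgebra.lift ℂ f) = AlgHom.id ℂ (U n) := by
    apply UniversalEnvelopingAlgebra.hom_ext
    ext1 X
    change ((UniversalEnvelopingAlgebra.lift ℂ f (ι X) : S) : U n) = ι X
    rw [ι, UniversalEnvelopingAlgebra.lift_ι_apply]
    rfl
  have := DFunLike.congr_fun hf a
  change ((UniversalEnvelopingAlgebra.lift ℂ f a : S) : U n) = a at this
  rw [← this]
  exact Subtype.property _

theorem casimir_mul (a : U n) : casimir n * a = a * casimir n := by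
  have := mem_subalgebra_of_ι (Subalgebra.centralizer ℂ {casimir n})
    (fun X => by
      rw [Subalgebra.mem_centralizer_iff]
      rintro _ rfl
      exact (commute_casimir X).symm) a
  rw [Subalgebra.mem_centralizer_iff] at this
  exact this _ rfl

variable {κ₀ : Fin n → ℂ}

theorem actU_verma (a : U n) (w : Verma n κ₀) : actU (Verma n κ₀) a w = a • w := by
  have h : UniversalEnvelopingAlgebra.lift ℂ (LieModule.toEnd ℂ (sp n) (Verma n κ₀)) =
      Algebra.lsmul ℂ ℂ (Verma n κ₀) := by
    apply UniversalEnvelopingAlgebra.hom_ext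
    ext1 X
    change UniversalEnvelopingAlgebra.lift ℂ _ (ι X) = _
    rw [ι, UniversalEnvelopingAlgebra.lift_ι_apply]
    rfl
  rw [actU, h]
  rfl

theorem exists_smul_hwVec (w : Verma n κ₀) : ∃ a : U n, a • hwVec n κ₀ = w := by
  obtain ⟨a, rfl⟩ := Submodule.Quotient.mk_surjective _ w
  refine ⟨a, ?_⟩
  rw [hwVec, ← Submodule.Quotient.mk_smul, smul_eq_mul, mul_one]

theorem smul_hwVec_eq_zero {a : U n} (h : a ∈ vermaIdeal n κ₀) : a • hwVec n κ₀ = 0 := by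
  rw [hwVec, ← Submodule.Quotient.mk_smul, smul_eq_mul, mul_one]
  exact (Submodule.Quotient.mk_eq_zero _).2 h

theorem lie_verma (X : sp n) (w : Verma n κ₀) : ⁅X, w⁆ = ι X • w := rfl

theorem C_hwVec {i j : Fin n} (h : i < j) : ⁅(C i j : sp n), hwVec n κ₀⁆ = 0 :=
  smul_hwVec_eq_zero (Submodule.subset_span (Or.inl (Or.inl ⟨i, j, h, rfl⟩)))

theorem CUp_hwVec (i j : Fin n) : ⁅(CUp i j : sp n), hwVec n κ₀⁆ = 0 := by
  rcases le_total i j with h | h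
  · exact smul_hwVec_eq_zero (Submodule.subset_span (Or.inl (Or.inr ⟨i, j, h, rfl⟩)))
  · rw [CUp_comm]
    exact smul_hwVec_eq_zero (Submodule.subset_span (Or.inl (Or.inr ⟨j, i, h, rfl⟩)))

theorem cartan_hwVec (i : Fin n) : ⁅(C i i : sp n), hwVec n κ₀⁆ = κ₀ i • hwVec n κ₀ := by
  have : (ι (C i i) - algebraMap ℂ (U n) (κ₀ i)) • hwVec n κ₀ = 0 :=
    smul_hwVec_eq_zero (Submodule.subset_span (Or.inr ⟨i, rfl⟩))
  rw [sub_smul, algebraMap_smul, sub_eq_zero] at this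
  exact this

/-- A subspace of a Verma module that contains the highest-weight vector and is stable under
`sp(2n)` is everything. -/
theorem eq_top_of_stable (N : Submodule ℂ (Verma n κ₀)) (hv : hwVec n κ₀ ∈ N)
    (h : ∀ X : sp n, ∀ w ∈ N, ⁅X, w⁆ ∈ N) : N = ⊤ := by
  let S : Subalgebra ℂ (U n) :=
    { carrier := {a | ∀ w ∈ N, a • w ∈ N}
      mul_mem' := fun {a b} ha hb w hw => by rw [mul_smul]; exact ha _ (hb _ hw)
      add_mem' := fun {a b} ha hb w hw => by rw [add_smul]; exact N.add_mem (ha _ hw) (hb _ hw)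
      algebraMap_mem' := fun c w hw => by rw [algebraMap_smul]; exact N.smul_mem c hw }
  rw [eq_top_iff]
  intro w _
  obtain ⟨a, rfl⟩ := exists_smul_hwVec w
  exact mem_subalgebra_of_ι S (fun X w hw => h X w hw) a _ hv

/-! ### The Casimir element on Verma modules -/

/-- The scalar is `(κ₀, κ₀ + 2ρ)`: on the highest-weight vector `e f + f e` acts as `[e, f]`. -/
theorem casimir_hwVec : actU (Verma n κ₀) (casimir n) (hwVec n κ₀) =
    (∑ i : Fin n, κ₀ i * (κ₀ i + 2 * ((n : ℂ) - (i : ℕ)))) • hwVec n κ₀ := by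
  have hpair : ∀ e f : sp n, ⁅e, hwVec n κ₀⁆ = 0 →
      (act (Verma n κ₀) e * act (Verma n κ₀) f + act (Verma n κ₀) f * act (Verma n κ₀) e)
        (hwVec n κ₀) = ⁅⁅e, f⁆, hwVec n κ₀⁆ := by
    intro e f he
    change ⁅e, ⁅f, hwVec n κ₀⁆⁆ + ⁅f, ⁅e, hwVec n κ₀⁆⁆ = _
    rw [lie_lie, he, lie_zero, add_zero, sub_zero]
  rw [actU_casimir]
  simp only [LinearMap.add_apply, LinearMap.sum_apply, LinearMap.smul_apply]
  have h1 : ∀ i : Fin n, (act (Verma n κ₀) (C i i) * act (Verma n κ₀) (C i i)) (hwVec n κ₀) =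
      (κ₀ i * κ₀ i) • hwVec n κ₀ := by
    intro i
    change ⁅(C i i : sp n), ⁅(C i i : sp n), hwVec n κ₀⁆⁆ = _
    rw [cartan_hwVec, lie_smul, cartan_hwVec, smul_smul]
  have h2 : ∀ i : Fin n, ∀ j ∈ Finset.Ioi i,
      (((act (Verma n κ₀) (C i j) * act (Verma n κ₀) (C j i)) (hwVec n κ₀) +
        (act (Verma n κ₀) (C j i) * act (Verma n κ₀) (C i j)) (hwVec n κ₀)) +
      ((act (Verma n κ₀) (CUp i j) * act (Verma n κ₀) (CLow j i)) (hwVec n κ₀) +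
        (act (Verma n κ₀) (CLow j i) * act (Verma n κ₀) (CUp i j)) (hwVec n κ₀))) =
      (2 * κ₀ i) • hwVec n κ₀ := by
    intro i j hij
    have hij := Finset.mem_Ioi.1 hij
    have e1 := hpair (C i j) (C j i) (C_hwVec hij)
    have e2 := hpair (CUp i j) (CLow j i) (CUp_hwVec i j)
    rw [lie_C_C, sub_lie, cartan_hwVec, cartan_hwVec] at e1
    rw [lie_CUp_CLow hij.ne, add_lie, cartan_hwVec, cartan_hwVec] at e2
    rw [LinearMap.add_apply] at e1 e2
    rw [e1, e2]
    module
  have h3 : ∀ p : Fin n, (2 : ℂ) •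
      ((act (Verma n κ₀) (CUp p p) * act (Verma n κ₀) (CLow p p)) (hwVec n κ₀) +
        (act (Verma n κ₀) (CLow p p) * act (Verma n κ₀) (CUp p p)) (hwVec n κ₀)) =
      (2 * κ₀ p) • hwVec n κ₀ := by
    intro p
    have e := hpair (CUp p p) (CLow p p) (CUp_hwVec p p)
    rw [lie_CUp_CLow_self, cartan_hwVec, LinearMap.add_apply] at e
    rw [e, smul_smul]
  rw [Finset.sum_congr rfl fun i _ => h1 i,
    Finset.sum_congr rfl fun i _ => Finset.sum_congr rfl (h2 i),
    Finset.sum_congr rfl fun p _ => h3 p]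
  simp only [Finset.sum_const, Fin.card_Ioi, ← Finset.sum_smul, ← Finset.sum_add_distrib,
    ← Nat.cast_smul_eq_nsmul ℂ, smul_smul, ← add_smul]
  congr 1
  refine Finset.sum_congr rfl fun i _ => ?_
  have : n - 1 - (i : ℕ) = n - ((i : ℕ) + 1) := by omega
  rw [this, Nat.cast_sub i.2]
  push_cast
  ring

theorem actU_casimir_verma : actU (Verma n κ₀) (casimir n) =
    (∑ i : Fin n, κ₀ i * (κ₀ i + 2 * ((n : ℂ) - (i : ℕ)))) • LinearMap.id := by
  refine LinearMap.ext fun w => ?_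
  obtain ⟨a, rfl⟩ := exists_smul_hwVec w
  have h : actU (Verma n κ₀) (casimir n) (a • hwVec n κ₀) =
      a • actU (Verma n κ₀) (casimir n) (hwVec n κ₀) := by
    rw [actU_verma, actU_verma, smul_smul, smul_smul, casimir_mul]
  rw [h, casimir_hwVec]
  exact smul_comm a _ (hwVec n κ₀)

theorem casimir_lam (n : ℕ) (c : ℂ) :
    ∑ i : Fin n, lam n c i * (lam n c i + 2 * ((n : ℂ) - (i : ℕ))) =
      ∑ i ∈ Finset.range n, (c - i / 2) * (c + 3 * i / 2 + 2) := by
  rw [← Finset.sum_range_reflect, Finset.sum_range]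
  refine Finset.sum_congr rfl fun i _ => ?_
  have : n - 1 - (i : ℕ) = n - ((i : ℕ) + 1) := by omega
  rw [this, Nat.cast_sub i.2, lam]
  push_cast
  ring

/-! ### Weights of Verma modules -/

/-- The negative roots, a root `-ε_i - ε_j` being listed once for each of its two presentations. -/
abbrev NegRoot (n : ℕ) : Type := {p : Fin n × Fin n // p.2 < p.1} ⊕ Fin n × Fin n

/-- The root vector of a negative root. -/
def negVec : NegRoot n → sp n :=
  Sum.elim (fun p => C p.1.1 p.1.2) (fun p => CLow p.1 p.2)

/-- The coordinates of a negative root. -/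
def negWt : NegRoot n → Fin n → ℤ :=
  Sum.elim (fun p => eps p.1.1 - eps p.1.2) (fun p => -(eps p.1 + eps p.2))

theorem lie_cartan_negVec (a : NegRoot n) (i : Fin n) :
    ⁅(C i i : sp n), negVec a⁆ = (negWt a i : ℂ) • negVec a := by
  rcases a with p | p
  · exact lie_cartan_C i _ _
  · exact lie_cartan_CLow i _ _

/-- A linear function that is at least `1` on all positive roots. -/
def height : (Fin n → ℤ) →ₗ[ℤ] ℤ := ∑ i : Fin n, ((n : ℤ) - (i : ℕ)) • LinearMap.proj i

theorem height_eps (i : Fin n) : height (eps i) = (n : ℤ) - (i : ℕ) := by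
  simp [height, LinearMap.sum_apply, Pi.single_apply]

theorem one_le_height {β : Fin n → ℤ} (h : IsPosRoot β) : 1 ≤ height β := by
  rcases h with ⟨i, j, hij, rfl | rfl⟩ | ⟨i, rfl⟩
  · rw [map_sub, height_eps, height_eps]; omega
  · rw [map_add, height_eps, height_eps]; omega
  · rw [map_add, height_eps]; omega

theorem height_negWt (a : NegRoot n) : height (negWt a) ≤ -1 := by
  rcases a with ⟨p, hp⟩ | p
  · change height (eps p.1 - eps p.2) ≤ -1
    rw [map_sub, height_eps, height_eps]; omega
  · change height (-(eps p.1 + eps p.2)) ≤ -1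
    rw [map_neg, map_add, height_eps, height_eps]; omega

/-- A product of negative root vectors, applied to the highest-weight vector. -/
def wordVec (κ₀ : Fin n → ℂ) : List (NegRoot n) → Verma n κ₀
  | [] => hwVec n κ₀
  | a :: l => ⁅negVec a, wordVec κ₀ l⁆

/-- The sum of the roots of a word. -/
def wordWt (l : List (NegRoot n)) : Fin n → ℤ := (l.map negWt).sum

theorem wordVec_mem (l : List (NegRoot n)) :
    wordVec κ₀ l ∈ wtSpace (n := n) (Verma n κ₀) (fun i => κ₀ i + wordWt l i) := by
  induction l with
  | nil =>
    intro i
    simpa [wordWt, wordVec] using cartan_hwVec i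
  | cons a l ih =>
    have h := act_mem_wtSpace (lie_cartan_negVec a) ih
    have e : (fun i => κ₀ i + (wordWt (a :: l) i : ℂ)) =
        fun i => κ₀ i + (wordWt l i : ℂ) + (negWt a i : ℂ) := by
      funext i
      simp only [wordWt, List.map_cons, List.sum_cons, Pi.add_apply]
      push_cast
      ring
    rw [e]
    exact h

/-- A word is no longer than the height of its weight, so that only finitely many words have a given
weight. -/
theorem length_le_height (l : List (NegRoot n)) : (l.length : ℤ) ≤ -height (wordWt l) := by
  induction l with
  | nil => simp [wordWt]
  | cons a l ih =>
    have := height_negWt a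
    have e : wordWt (a :: l) = negWt a + wordWt l := by simp [wordWt]
    rw [e, map_add, List.length_cons]
    push_cast
    omega

/-- Words in negative root vectors span a Verma module. Their span is stable under `sp(2n)`: an
element `X` is moved to the right through a word, at the cost of shorter words acted on by
commutators. -/
theorem span_wordVec (κ₀ : Fin n → ℂ) : Submodule.span ℂ (Set.range (wordVec κ₀)) = ⊤ := by
  set N := Submodule.span ℂ (Set.range (wordVec κ₀)) with hN
  have hmem : ∀ l, wordVec κ₀ l ∈ N := fun l => Submodule.subset_span ⟨l, rfl⟩
  have hneg : ∀ (a : NegRoot n), ∀ w ∈ N, ⁅negVec a, w⁆ ∈ N := by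
    intro a w hw
    refine Submodule.span_induction (p := fun w _ => ⁅negVec a, w⁆ ∈ N) ?_ ?_ ?_ ?_ hw
    · rintro _ ⟨l, rfl⟩
      exact hmem (a :: l)
    · rw [lie_zero]; exact N.zero_mem
    · intro x y _ _ hx hy
      rw [lie_add]; exact N.add_mem hx hy
    · intro c x _ hx
      rw [lie_smul]; exact N.smul_mem c hx
  have hC : ∀ i j : Fin n, ⁅(C i j : sp n), hwVec n κ₀⁆ ∈ N := by
    intro i j
    rcases lt_trichotomy i j with h | rfl | h
    · rw [C_hwVec h]; exact N.zero_mem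
    · rw [cartan_hwVec]; exact N.smul_mem _ (hmem [])
    · exact hmem [Sum.inl ⟨(i, j), h⟩]
  have hword : ∀ (l : List (NegRoot n)) (X : sp n), ⁅X, wordVec κ₀ l⁆ ∈ N := by
    intro l
    induction l with
    | nil =>
      intro X
      rw [eq_sum_toSp X, smul_lie, sum_lie]
      refine N.smul_mem _ (N.sum_mem fun a _ => ?_)
      rw [sum_lie]
      refine N.sum_mem fun b _ => ?_
      rw [smul_lie]
      refine N.smul_mem _ ?_
      change ⁅toSp n (E a b), hwVec n κ₀⁆ ∈ N
      rcases a with i | i <;> rcases b with j | j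
      · rw [toSp_inl_inl]; exact hC i j
      · rw [toSp_inl_inr, smul_lie, CUp_hwVec, smul_zero]; exact N.zero_mem
      · rw [toSp_inr_inl, smul_lie]; exact N.smul_mem _ (hmem [Sum.inr (i, j)])
      · rw [toSp_inr_inr, neg_lie]; exact N.neg_mem (hC j i)
    | cons a l ih =>
      intro X
      change ⁅X, ⁅negVec a, wordVec κ₀ l⁆⁆ ∈ N
      rw [leibniz_lie]
      exact N.add_mem (ih _) (hneg a _ (ih X))
  refine eq_top_of_stable N (hmem []) fun X w hw => ?_
  refine Submodule.span_induction (p := fun w _ => ⁅X, w⁆ ∈ N) ?_ ?_ ?_ ?_ hw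
  · rintro _ ⟨l, rfl⟩
    exact hword l X
  · rw [lie_zero]; exact N.zero_mem
  · intro x y _ _ hx hy
    rw [lie_add]; exact N.add_mem hx hy
  · intro c x _ hx
    rw [lie_smul]; exact N.smul_mem c hx

/-- Weight spaces are independent, as simultaneous eigenspaces of commuting operators. -/
theorem iSupIndep_wtSpace (M : Type*) [AddCommGroup M] [Module ℂ M] [LieRingModule (sp n) M]
    [LieModule ℂ (sp n) M] : iSupIndep (wtSpace (n := n) M) := by
  have hcomm : ∀ i j : Fin n, Commute (act M (C i i : sp n)) (act M (C j j : sp n)) := by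
    intro i j
    rw [commute_iff_eq, act_mul_act, lie_cartan_C]
    simp
  refine iSupIndep.mono (Module.End.independent_iInf_maxGenEigenspace_of_forall_mapsTo
    (fun i : Fin n => act M (C i i : sp n))
    fun i j φ => Module.End.mapsTo_maxGenEigenspace_of_comm (hcomm j i) φ) fun κ w hw => ?_
  rw [Submodule.mem_iInf]
  intro i
  refine Module.End.mem_maxGenEigenspace _ _ _ |>.2 ⟨1, ?_⟩
  rw [pow_one, LinearMap.sub_apply, sub_eq_zero]
  exact hw i

theorem isWeightModule_verma (κ₀ : Fin n → ℂ) : IsWeightModule (n := n) (Verma n κ₀) := by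
  classical
  rw [IsWeightModule, DirectSum.isInternal_submodule_iff_iSupIndep_and_iSup_eq_top]
  refine ⟨iSupIndep_wtSpace _, ?_⟩
  rw [eq_top_iff, ← span_wordVec, Submodule.span_le]
  rintro _ ⟨l, rfl⟩
  exact Submodule.mem_iSup_of_mem _ (wordVec_mem l)

theorem wtSpace_verma (κ₀ κ : Fin n → ℂ) :
    (⊤ : Submodule ℂ (wtSpace (n := n) (Verma n κ₀) κ)) = Submodule.span ℂ
      ((fun l => wtProj (isWeightModule_verma κ₀) κ (wordVec κ₀ l)) ''
        {l | (fun i => κ₀ i + wordWt l i) = κ}) := by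
  rw [eq_comm, eq_top_iff]
  intro w _
  have h1 : w = wtProj (isWeightModule_verma κ₀) κ w.1 := (wtProj_of_mem _ w.2).symm
  have h2 : w.1 ∈ Submodule.span ℂ (Set.range (wordVec κ₀)) := by
    rw [span_wordVec]; trivial
  have h3 := Submodule.mem_map_of_mem (f := wtProj (isWeightModule_verma κ₀) κ) h2
  rw [← h1, Submodule.map_span] at h3
  refine (Submodule.span_le.2 ?_) h3
  rintro _ ⟨_, ⟨l, rfl⟩, rfl⟩
  by_cases h : (fun i => κ₀ i + (wordWt l i : ℂ)) = κ
  · exact Submodule.subset_span ⟨l, h, rfl⟩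
  · rw [wtProj_of_mem_ne _ (wordVec_mem l) h]
    exact Submodule.zero_mem _

theorem finiteDimensional_wtSpace_verma (κ₀ κ : Fin n → ℂ) :
    FiniteDimensional ℂ (wtSpace (n := n) (Verma n κ₀) κ) := by
  have hfin : {l : List (NegRoot n) | (fun i => κ₀ i + (wordWt l i : ℂ)) = κ}.Finite := by
    rcases Set.eq_empty_or_nonempty
      {l : List (NegRoot n) | (fun i => κ₀ i + (wordWt l i : ℂ)) = κ} with h | ⟨l₀, h₀⟩
    · rw [h]; exact Set.finite_empty
    · refine (List.finite_length_le (NegRoot n) (-height (wordWt l₀)).toNat).subset fun l hl => ?_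
      have e : wordWt l = wordWt l₀ := by
        funext i
        have := congrFun (hl.trans h₀.symm) i
        simpa using this
      have := length_le_height l
      rw [e] at this
      change l.length ≤ _
      omega
  refine ⟨?_⟩
  rw [wtSpace_verma]
  exact Submodule.fg_span (hfin.image _)

theorem exists_word_of_ne_bot {κ : Fin n → ℂ} (h : wtSpace (n := n) (Verma n κ₀) κ ≠ ⊥) :
    ∃ l : List (NegRoot n), (fun i => κ₀ i + (wordWt l i : ℂ)) = κ := by
  by_contra hl
  push Not at hl
  refine h ?_
  rw [eq_bot_iff]
  intro w hw
  have h1 : (⟨w, hw⟩ : wtSpace (n := n) (Verma n κ₀) κ) ∈ (⊤ : Submodule ℂ _) := trivial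
  rw [wtSpace_verma, Set.eq_empty_of_forall_notMem (s := {l | _}) fun l h => hl l h,
    Set.image_empty, Submodule.span_empty, Submodule.mem_bot] at h1
  exact congrArg Subtype.val h1

theorem weightsBoundedAbove_verma (κ₀ : Fin n → ℂ) :
    WeightsBoundedAbove (n := n) (Verma n κ₀) := by
  intro κ β hβ
  by_cases hex : ∃ k₀ : ℕ, wtSpace (n := n) (Verma n κ₀) (fun i => κ i + k₀ * β i) ≠ ⊥
  · obtain ⟨k₀, hk₀⟩ := hex
    obtain ⟨l₀, hl₀⟩ := exists_word_of_ne_bot hk₀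
    refine ⟨k₀ + (-height (wordWt l₀)).toNat + 1, fun k hk => ?_⟩
    by_contra hne
    obtain ⟨l, hl⟩ := exists_word_of_ne_bot hne
    have e : wordWt l = wordWt l₀ + ((k : ℤ) - k₀) • β := by
      funext i
      have h1 := congrFun hl i
      have h2 := congrFun hl₀ i
      have h3 : (wordWt l i : ℂ) = ((wordWt l₀ i + ((k : ℤ) - k₀) * β i : ℤ) : ℂ) := by
        push_cast
        linear_combination h1 - h2
      simpa using Int.cast_injective h3
    have h1 := length_le_height l
    rw [e, map_add, map_smul, smul_eq_mul] at h1
    have h2 := one_le_height hβ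
    have h3 : (k : ℤ) - k₀ ≤ ((k : ℤ) - k₀) * height β := by nlinarith
    omega
  · push Not at hex
    exact ⟨0, fun k _ => hex k⟩

/-! ### The oscillator representation -/

/-- The conditions on the blocks of a matrix in `sp(2n)`. -/
theorem sp_entries (u : sp n) (p q : Fin n) :
    u.1 (.inr p) (.inr q) = -u.1 (.inl q) (.inl p) ∧
    u.1 (.inl p) (.inr q) = u.1 (.inl q) (.inr p) ∧
    u.1 (.inr p) (.inl q) = u.1 (.inr q) (.inl p) := by
  have h := (mem_sp_iff' u.1).1 u.2
  refine ⟨?_, ?_, ?_⟩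
  · conv_lhs => rw [h]
    simp [Matrix.mul_apply, Matrix.J, Matrix.one_apply]
  · conv_lhs => rw [h]
    simp [Matrix.mul_apply, Matrix.J, Matrix.one_apply]
  · conv_lhs => rw [h]
    simp [Matrix.mul_apply, Matrix.J, Matrix.one_apply]

section Weyl

variable {A : Type*} [Ring A] [Algebra ℂ A]

/-- The relations between coordinates `X p` and derivations `D p`. -/
structure IsWeylPair (X D : Fin n → A) : Prop where
  X_comm : ∀ p q, X p * X q = X q * X p
  D_comm : ∀ p q, D p * D q = D q * D p
  D_mul_X : ∀ p q, D p * X q = X q * D p + if p = q then 1 else 0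

/-- The quadratic element that corresponds to a matrix, normally ordered up to the symmetrizing
constants `1 / 2`. -/
def quadratic (X D : Fin n → A) (u : Matrix (Fin n ⊕ Fin n) (Fin n ⊕ Fin n) ℂ) : A :=
  (∑ p : Fin n, ∑ q : Fin n, u (.inl p) (.inl q) •
      (X p * D q + (if p = q then (1 / 2 : ℂ) else 0) • (1 : A)))
  - (1 / 2 : ℂ) • (∑ p : Fin n, ∑ q : Fin n, u (.inl p) (.inr q) • (X p * X q))
  + (1 / 2 : ℂ) • (∑ p : Fin n, ∑ q : Fin n, u (.inr p) (.inl q) • (D p * D q))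

/-- The row vector `(X, D)`, which spans a copy of the standard representation. -/
def rowVec (X D : Fin n → A) : Fin n ⊕ Fin n → A := Sum.elim X D

/-- The column vector `(D, -X)`, dual to `(X, D)`. -/
def colVec (X D : Fin n → A) : Fin n ⊕ Fin n → A := Sum.elim D (fun p => -X p)

/-- The linear map `T ↦ [T, y]`. -/
def commL (y : A) : A →ₗ[ℂ] A := LinearMap.mulRight ℂ y - LinearMap.mulLeft ℂ y

theorem commL_apply (y T : A) : commL y T = T * y - y * T := rfl

variable {X D : Fin n → A}

theorem quadratic_add (u v : Matrix (Fin n ⊕ Fin n) (Fin n ⊕ Fin n) ℂ) :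
    quadratic X D (u + v) = quadratic X D u + quadratic X D v := by
  simp only [quadratic, Matrix.add_apply, add_smul _ _ (_ : A), Finset.sum_add_distrib, smul_add]
  abel

theorem quadratic_smul (c : ℂ) (u : Matrix (Fin n ⊕ Fin n) (Fin n ⊕ Fin n) ℂ) :
    quadratic X D (c • u) = c • quadratic X D u := by
  simp only [quadratic, Matrix.smul_apply, smul_assoc, ← Finset.smul_sum, smul_comm _ c]
  simp only [smul_add, smul_sub]

theorem commL_quadratic_eq (y : A) (u : Matrix (Fin n ⊕ Fin n) (Fin n ⊕ Fin n) ℂ) :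
    commL y (quadratic X D u) = (∑ p : Fin n, ∑ q : Fin n, u (.inl p) (.inl q) •
        commL y (X p * D q + (if p = q then (1 / 2 : ℂ) else 0) • (1 : A)))
      - (1 / 2 : ℂ) • (∑ p : Fin n, ∑ q : Fin n, u (.inl p) (.inr q) • commL y (X p * X q))
      + (1 / 2 : ℂ) • (∑ p : Fin n, ∑ q : Fin n, u (.inr p) (.inl q) • commL y (D p * D q)) := by
  rw [quadratic, map_add, map_sub, map_smul, map_smul]
  simp only [map_sum, map_smul]

/-- On `sp(2n)` the quadratic element is `1 / 2 ∑ u_{a,b} y_a y*_b`, with `y = (X, D)` and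
`y* = (D, -X)`. -/
theorem IsWeylPair.quadratic_eq (h : IsWeylPair X D) (u : sp n) : quadratic X D u.1 =
    (1 / 2 : ℂ) • ∑ a, ∑ b, u.1 a b • (rowVec X D a * colVec X D b) := by
  have h1 : ∑ p : Fin n, ∑ q : Fin n, u.1 (.inr p) (.inr q) • (D p * -X q) =
      ∑ p : Fin n, ∑ q : Fin n, u.1 (.inl p) (.inl q) • (X p * D q + if p = q then 1 else 0) := by
    rw [Finset.sum_comm]
    refine Finset.sum_congr rfl fun p _ => Finset.sum_congr rfl fun q _ => ?_
    rw [(sp_entries u q p).1, mul_neg, smul_neg, neg_smul, neg_neg, h.D_mul_X]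
    simp only [eq_comm]
  have h2 : ∀ p q : Fin n, ((if p = q then (1 / 2 : ℂ) else 0) • (1 : A)) =
      (1 / 2 : ℂ) • if p = q then 1 else 0 := by
    intro p q
    split_ifs <;> simp
  simp only [Fintype.sum_sum_type, rowVec, colVec, Sum.elim_inl, Sum.elim_inr,
    Finset.sum_add_distrib]
  rw [h1]
  simp only [quadratic, h2, mul_neg, smul_neg, smul_add, Finset.sum_add_distrib,
    Finset.sum_neg_distrib]
  simp only [smul_comm _ (1 / 2 : ℂ), ← Finset.smul_sum]
  module

/-- The commutator with `quadratic X D u` acts on `(X, D)` through the standard representation. -/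
theorem IsWeylPair.commL_quadratic (h : IsWeylPair X D) (u : sp n) (c : Fin n ⊕ Fin n) :
    commL (rowVec X D c) (quadratic X D u.1) = ∑ a, u.1 a c • rowVec X D a := by
  have hDX := h.D_mul_X
  have hXD : ∀ p q, X p * D q = D q * X p - if q = p then 1 else 0 := fun p q => by
    rw [hDX, add_sub_cancel_right]
  rcases c with r | r
  · have e1 : ∀ (p q : Fin n) (c : ℂ), commL (X r) (X p * D q + c • 1) =
        if q = r then X p else 0 := by
      intro p q c
      rw [commL_apply, add_mul, mul_add, smul_mul_assoc, mul_smul_comm, one_mul, mul_one, mul_assoc,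
        hDX, mul_add, ← mul_assoc, ← mul_assoc, h.X_comm p r, mul_ite, mul_one, mul_zero]
      abel
    have e2 : ∀ p q : Fin n, commL (X r) (X p * X q) = 0 := by
      intro p q
      rw [commL_apply, mul_assoc, h.X_comm q r, ← mul_assoc, ← mul_assoc, h.X_comm p r, sub_self]
    have e3 : ∀ p q : Fin n, commL (X r) (D p * D q) =
        (if q = r then D p else 0) + if p = r then D q else 0 := by
      intro p q
      rw [commL_apply, mul_assoc, hDX, mul_add, ← mul_assoc, hDX, add_mul, mul_ite, mul_one,
        mul_zero, ite_mul, one_mul, zero_mul, mul_assoc]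
      abel
    rw [commL_quadratic_eq]
    simp only [rowVec, Sum.elim_inl, e1, e2, e3, smul_add, smul_ite, smul_zero,
      Finset.sum_add_distrib, Finset.sum_ite_eq', Finset.mem_univ, if_true,
      Finset.sum_const_zero, sub_zero, Fintype.sum_sum_type, Sum.elim_inr,
      Finset.sum_ite_irrel]
    have e4 : ∑ q : Fin n, u.1 (.inr r) (.inl q) • D q = ∑ q : Fin n, u.1 (.inr q) (.inl r) • D q :=
      Finset.sum_congr rfl fun q _ => by rw [(sp_entries u r q).2.2]
    rw [e4]
    module
  · have e1 : ∀ (p q : Fin n) (c : ℂ), commL (D r) (X p * D q + c • 1) =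
        -if p = r then D q else 0 := by
      intro p q c
      rw [commL_apply, add_mul, mul_add, smul_mul_assoc, mul_smul_comm, one_mul, mul_one, mul_assoc,
        ← mul_assoc (D r), hDX r p, h.D_comm q r, add_mul, ite_mul, one_mul, zero_mul, mul_assoc]
      simp only [eq_comm]
      abel
    have e2 : ∀ p q : Fin n, commL (D r) (X p * X q) =
        -((if p = r then X q else 0) + if q = r then X p else 0) := by
      intro p q
      rw [commL_apply, mul_assoc, hXD q, ← mul_assoc (D r), hDX r p, mul_sub, add_mul,
        mul_ite, mul_one, mul_zero, ite_mul, one_mul, zero_mul, mul_assoc]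
      simp only [eq_comm]
      abel
    have e3 : ∀ p q : Fin n, commL (D r) (D p * D q) = 0 := by
      intro p q
      rw [commL_apply, mul_assoc, h.D_comm q r, ← mul_assoc, ← mul_assoc, h.D_comm p r, sub_self]
    rw [commL_quadratic_eq]
    simp only [rowVec, Sum.elim_inl, e1, e2, e3, smul_add, smul_neg, smul_ite, smul_zero,
      Finset.sum_add_distrib, Finset.sum_neg_distrib,
      Finset.sum_ite_eq', Finset.mem_univ, if_true, Finset.sum_const_zero, add_zero,
      Fintype.sum_sum_type, Sum.elim_inr, Finset.sum_ite_irrel]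
    have e4 : ∑ q : Fin n, u.1 (.inl r) (.inr q) • X q = ∑ q : Fin n, u.1 (.inl q) (.inr r) • X q :=
      Finset.sum_congr rfl fun q _ => by rw [(sp_entries u r q).2.1]
    have e5 : ∑ q : Fin n, u.1 (.inr q) (.inr r) • D q =
        -∑ q : Fin n, u.1 (.inl r) (.inl q) • D q := by
      rw [← Finset.sum_neg_distrib]
      exact Finset.sum_congr rfl fun q _ => by rw [(sp_entries u q r).1, neg_smul]
    rw [e4, e5]
    module

/-- The commutator with `quadratic X D u` acts on `(D, -X)` through the dual of the standard
representation. -/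
theorem IsWeylPair.commL_quadratic' (h : IsWeylPair X D) (u : sp n) (c : Fin n ⊕ Fin n) :
    commL (colVec X D c) (quadratic X D u.1) = -∑ b, u.1 c b • colVec X D b := by
  rcases c with r | r
  · refine (h.commL_quadratic u (.inr r)).trans ?_
    simp only [Fintype.sum_sum_type, rowVec, colVec, Sum.elim_inl, Sum.elim_inr, smul_neg,
      Finset.sum_neg_distrib, neg_add, neg_neg]
    rw [add_comm, ← Finset.sum_neg_distrib]
    congr 1
    · exact Finset.sum_congr rfl fun q _ => by rw [(sp_entries u q r).1, neg_smul]
    · exact Finset.sum_congr rfl fun q _ => by rw [(sp_entries u q r).2.1]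
  · have e : commL (colVec X D (.inr r)) (quadratic X D u.1) =
        -commL (rowVec X D (.inl r)) (quadratic X D u.1) := by
      simp only [commL_apply, rowVec, colVec, Sum.elim_inl, Sum.elim_inr]
      noncomm_ring
    rw [e, h.commL_quadratic]
    congr 1
    simp only [Fintype.sum_sum_type, rowVec, colVec, Sum.elim_inl, Sum.elim_inr, smul_neg]
    rw [add_comm]
    congr 1
    · exact Finset.sum_congr rfl fun q _ => by rw [(sp_entries u q r).2.2]
    · exact Finset.sum_congr rfl fun q _ => by rw [(sp_entries u r q).1, neg_smul, neg_neg]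

/-- The quadratic elements of a Weyl algebra are a copy of `sp(2n)`. -/
theorem IsWeylPair.quadratic_lie (h : IsWeylPair X D) (u v : sp n) :
    quadratic X D (⁅u, v⁆ : sp n).1 =
      quadratic X D u.1 * quadratic X D v.1 - quadratic X D v.1 * quadratic X D u.1 := by
  have e : ∀ a b, quadratic X D u.1 * (rowVec X D a * colVec X D b) -
      (rowVec X D a * colVec X D b) * quadratic X D u.1 =
      ∑ c, u.1 c a • (rowVec X D c * colVec X D b) -
        ∑ c, u.1 b c • (rowVec X D a * colVec X D c) := by
    intro a b
    have e1 := h.commL_quadratic u a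
    have e2 := h.commL_quadratic' u b
    rw [commL_apply] at e1 e2
    have e3 : quadratic X D u.1 * (rowVec X D a * colVec X D b) -
        (rowVec X D a * colVec X D b) * quadratic X D u.1 =
        (quadratic X D u.1 * rowVec X D a - rowVec X D a * quadratic X D u.1) * colVec X D b +
        rowVec X D a * (quadratic X D u.1 * colVec X D b - colVec X D b * quadratic X D u.1) := by
      noncomm_ring
    rw [e3, e1, e2, Finset.sum_mul, mul_neg, Finset.mul_sum, ← sub_eq_add_neg]
    simp only [smul_mul_assoc, mul_smul_comm]
  rw [h.quadratic_eq ⁅u, v⁆, h.quadratic_eq v, mul_smul_comm, smul_mul_assoc, ← smul_sub]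
  congr 1
  rw [Finset.mul_sum, Finset.sum_mul, ← Finset.sum_sub_distrib]
  simp only [Finset.mul_sum, Finset.sum_mul, ← Finset.sum_sub_distrib, mul_smul_comm,
    smul_mul_assoc, ← smul_sub, e]
  rw [LieSubalgebra.coe_bracket, LieRing.of_associative_ring_bracket]
  simp only [Matrix.sub_apply, Matrix.mul_apply, sub_smul, Finset.sum_smul, smul_sub,
    Finset.smul_sum, Finset.sum_sub_distrib, smul_smul]
  congr 1
  · calc _ = ∑ a, ∑ c, ∑ b, (u.1 a c * v.1 c b) • (rowVec X D a * colVec X D b) :=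
        Finset.sum_congr rfl fun _ _ => Finset.sum_comm
      _ = ∑ c, ∑ a, ∑ b, (u.1 a c * v.1 c b) • (rowVec X D a * colVec X D b) := Finset.sum_comm
      _ = ∑ c, ∑ b, ∑ a, (u.1 a c * v.1 c b) • (rowVec X D a * colVec X D b) :=
        Finset.sum_congr rfl fun _ _ => Finset.sum_comm
      _ = _ := by simp only [mul_comm]
  · exact Finset.sum_congr rfl fun _ _ => Finset.sum_comm

end Weyl

section Rep

variable {M : Type*} [AddCommGroup M] [Module ℂ M]

theorem isWeylPair_xMul_xDer (n : ℕ) (M : Type*) [AddCommGroup M] [Module ℂ M] :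
    IsWeylPair (A := Module.End ℂ (LaurentX n M)) xMul xDer where
  X_comm p q := xMul_comm q p
  D_comm p q := xDer_comm q p
  D_mul_X p q := by
    refine LinearMap.ext fun f => funext fun j => ?_
    change ((j p : ℂ) + 1 / 2) • f (j + eps p - eps q) =
      ((((j - eps q) p : ℤ) : ℂ) + 1 / 2) • f (j - eps q + eps p) +
        (if p = q then (1 : Module.End ℂ (LaurentX n M)) else 0) f j
    rw [add_sub_right_comm]
    split_ifs with h
    · subst h
      change _ = _ + f j
      rw [sub_add_cancel]
      simp only [Pi.sub_apply, Pi.single_eq_same]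
      push_cast
      module
    · change _ = _ + 0
      simp [h]

theorem pointRep_eq_quadratic (u : sp n) :
    (pointRep u : Module.End ℂ (LaurentX n M)) = quadratic xMul xDer u.1 := rfl

theorem pointRep_lie (u v : sp n) : (pointRep ⁅u, v⁆ : Module.End ℂ (LaurentX n M)) =
    pointRep u * pointRep v - pointRep v * pointRep u :=
  (isWeylPair_xMul_xDer n M).quadratic_lie u v

theorem pointRep_add (u v : sp n) : (pointRep (u + v) : Module.End ℂ (LaurentX n M)) =
    pointRep u + pointRep v := quadratic_add u.1 v.1

theorem pointRep_smul (c : ℂ) (u : sp n) : (pointRep (c • u) : Module.End ℂ (LaurentX n M)) =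
    c • pointRep u := quadratic_smul c u.1

theorem commute_compLeft_pointRep (T : Module.End ℂ M) (u : sp n) :
    Commute (T.compLeft (Fin n → ℤ) : Module.End ℂ (LaurentX n M)) (pointRep u) := by
  have hX : ∀ p, Commute (T.compLeft (Fin n → ℤ) : Module.End ℂ (LaurentX n M)) (xMul p) :=
    fun p => rfl
  have hD : ∀ p, Commute (T.compLeft (Fin n → ℤ) : Module.End ℂ (LaurentX n M)) (xDer p) := by
    intro p
    refine LinearMap.ext fun f => funext fun j => ?_
    exact map_smul T _ _
  rw [pointRep_eq_quadratic, quadratic]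
  refine ((Commute.sum_right _ _ _ fun p _ => Commute.sum_right _ _ _ fun q _ =>
    ((((hX p).mul_right (hD q)).add_right ((Commute.one_right _).smul_right _)).smul_right _)
    ).sub_right ?_).add_right ?_
  · exact (Commute.sum_right _ _ _ fun p _ => Commute.sum_right _ _ _ fun q _ =>
      ((hX p).mul_right (hX q)).smul_right _).smul_right _
  · exact (Commute.sum_right _ _ _ fun p _ => Commute.sum_right _ _ _ fun q _ =>
      ((hD p).mul_right (hD q)).smul_right _).smul_right _

/-- The representation `π = π_M + π'` of `sp(2n)` on `M̃`. -/
def totalRep (M : Type*) [AddCommGroup M] [Module ℂ M] [LieRingModule (sp n) M]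
    [LieModule ℂ (sp n) M] : sp n →ₗ⁅ℂ⁆ Module.End ℂ (LaurentX n M) where
  toFun u := (act M u).compLeft (Fin n → ℤ) + pointRep u
  map_add' u v := by
    rw [pointRep_add]
    have : (act M (u + v)).compLeft (Fin n → ℤ) =
        (act M u).compLeft (Fin n → ℤ) + (act M v).compLeft (Fin n → ℤ) :=
      LinearMap.ext fun f => funext fun j => add_lie u v (f j)
    rw [this]
    abel
  map_smul' c u := by
    rw [pointRep_smul]
    have : (act M (c • u)).compLeft (Fin n → ℤ) = c • (act M u).compLeft (Fin n → ℤ) :=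
      LinearMap.ext fun f => funext fun j => smul_lie c u (f j)
    rw [this, ← smul_add]
    rfl
  map_lie' {u v} := by
    rw [LieRing.of_associative_ring_bracket, pointRep_lie]
    have h1 : (act M ⁅u, v⁆).compLeft (Fin n → ℤ) =
        (act M u).compLeft (Fin n → ℤ) * (act M v).compLeft (Fin n → ℤ) -
          (act M v).compLeft (Fin n → ℤ) * (act M u).compLeft (Fin n → ℤ) :=
      LinearMap.ext fun f => funext fun j => lie_lie u v (f j)
    have h2 := (commute_compLeft_pointRep (act M u) v).eq
    have h3 := (commute_compLeft_pointRep (act M v) u).eq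
    rw [h1, add_mul, mul_add, mul_add, add_mul, mul_add, mul_add, h2, h3]
    abel

theorem totalRep_apply [LieRingModule (sp n) M] [LieModule ℂ (sp n) M] (u : sp n)
    (f : LaurentX n M) (j : Fin n → ℤ) : totalRep M u f j = ⁅u, f j⁆ + pointRep u f j := rfl

end Rep

/-! ### Simple root vectors -/

/-- The simple roots `ε_p - ε_{p+1}` for `p < n` and `2 ε_n`. -/
def simpleRoot (p : Fin n) : Fin n → ℤ :=
  if h : (p : ℕ) + 1 < n then eps p - eps ⟨p + 1, h⟩ else eps p + eps p

/-- The simple root vectors `C_{p,p+1}` for `p < n` and `C_{n,2n}`. -/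
def posSimple (p : Fin n) : sp n :=
  if h : (p : ℕ) + 1 < n then C p ⟨p + 1, h⟩ else CUp p p

/-- The value of a weight on the simple coroot `h_p`. -/
def corootVal (p : Fin n) (κ : Fin n → ℂ) : ℂ :=
  if h : (p : ℕ) + 1 < n then κ p - κ ⟨p + 1, h⟩ else κ p

theorem lie_cartan_negSimple (p i : Fin n) :
    ⁅(C i i : sp n), negSimple p⁆ = (((-simpleRoot p) i : ℤ) : ℂ) • negSimple p := by
  unfold negSimple simpleRoot
  split_ifs with h
  · rw [lie_cartan_C, neg_sub]
  · rw [lie_cartan_CLow]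

theorem lie_posSimple_negSimple_of_ne {p q : Fin n} (h : p ≠ q) :
    ⁅posSimple p, negSimple q⁆ = 0 := by
  have h' : (p : ℕ) ≠ q := fun e => h (Fin.ext e)
  unfold posSimple negSimple
  split_ifs with h1 h2 h2
  · rw [← toSp_inl_inl ⟨q + 1, h2⟩ q, lie_toSp]
    simp [C, sub_mul, mul_sub, E_mul_E, -Matrix.single_mul_single_same, h', Fin.ext_iff]
    grind
  · rw [CLow_eq_toSp, lie_smul, lie_toSp]
    simp [C, sub_mul, mul_sub, E_mul_E, -Matrix.single_mul_single_same, h, Fin.ext_iff]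
    grind
  · rw [← toSp_inl_inl ⟨q + 1, h2⟩ q, lie_toSp]
    simp [CUp, E_mul_E, -Matrix.single_mul_single_same, Fin.ext_iff]
    grind
  · exact absurd (by omega) h'

/-- The bracket of the simple root vectors with index `p` is the simple coroot `h_p`. -/
theorem lie_posSimple_negSimple_act {M : Type*} [AddCommGroup M] [Module ℂ M]
    [LieRingModule (sp n) M] [LieModule ℂ (sp n) M] (p : Fin n) {κ : Fin n → ℂ} {w : M}
    (hw : w ∈ wtSpace (n := n) M κ) :
    ⁅⁅posSimple p, negSimple p⁆, w⁆ = corootVal p κ • w := by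
  unfold posSimple negSimple corootVal
  split_ifs with h
  · rw [lie_C_C, sub_lie, hw, hw, sub_smul]
  · rw [lie_CUp_CLow_self, hw]

theorem corootVal_simpleRoot (p : Fin n) (κ : Fin n → ℂ) (k : ℕ) :
    corootVal p (fun i => κ i - k * simpleRoot p i) = corootVal p κ - 2 * k := by
  unfold corootVal simpleRoot
  split_ifs with h
  · simp [Fin.ext_iff]
    ring
  · simp
    ring

/-! ### Weights and `sl(2)`-theory for products of simple root vectors -/

section

variable {κ₀ : Fin n → ℂ}

theorem pow_negSimple_mem_wtSpace (p : Fin n) (k : ℕ) {κ : Fin n → ℂ} {w : Verma n κ₀}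
    (hw : w ∈ wtSpace (n := n) (Verma n κ₀) κ) :
    ι (negSimple p) ^ k • w ∈
      wtSpace (n := n) (Verma n κ₀) (fun i => κ i - k * simpleRoot p i) := by
  induction k with
  | zero => simpa using hw
  | succ k ih =>
    have h := act_mem_wtSpace (lie_cartan_negSimple p) ih
    have e : (fun i => κ i - ((k + 1 : ℕ) : ℂ) * (simpleRoot p i : ℂ)) =
        fun i => κ i - k * simpleRoot p i + ((-simpleRoot p) i : ℤ) := by
      funext i
      simp only [Pi.neg_apply]
      push_cast
      ring
    rw [e, pow_succ', mul_smul]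
    exact h

/-- The commutation rule `e f^{k+1} w = (k+1) (m - k) f^k w` for a vector `w` with `e w = 0` and
`h w = m w`. -/
theorem posSimple_pow_negSimple (p : Fin n) {κ : Fin n → ℂ} {w : Verma n κ₀}
    (hw : w ∈ wtSpace (n := n) (Verma n κ₀) κ) (he : ⁅posSimple p, w⁆ = 0) (k : ℕ) :
    ⁅posSimple p, ι (negSimple p) ^ (k + 1) • w⁆ =
      ((k + 1 : ℂ) * (corootVal p κ - k)) • ι (negSimple p) ^ k • w := by
  have hstep : ∀ k : ℕ, ⁅posSimple p, ι (negSimple p) ^ (k + 1) • w⁆ =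
      ι (negSimple p) • ⁅posSimple p, ι (negSimple p) ^ k • w⁆ +
        (corootVal p κ - 2 * k) • ι (negSimple p) ^ k • w := by
    intro k
    rw [pow_succ', mul_smul, ← lie_verma (negSimple p), leibniz_lie,
      lie_posSimple_negSimple_act p (pow_negSimple_mem_wtSpace p k hw), corootVal_simpleRoot,
      lie_verma (negSimple p), add_comm]
  induction k with
  | zero =>
    rw [hstep, pow_zero, one_smul, he, smul_zero, zero_add]
    congr 1
    simp
  | succ k ih =>
    rw [hstep, ih, smul_comm (ι (negSimple p)) (_ : ℂ), ← mul_smul (ι (negSimple p)), ← pow_succ',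
      ← add_smul]
    congr 1
    push_cast
    ring

/-- The product of powers of the negative simple root vectors with indices in a list. -/
def listMonomial (L : List (Fin n)) (i : Fin n → ℕ) : U n :=
  (L.map fun p => ι (negSimple p) ^ i p).prod

theorem negMonomial_eq (i : Fin n → ℕ) : negMonomial i = listMonomial (List.finRange n) i := by
  rw [negMonomial, listMonomial, List.ofFn_eq_map]

theorem listMonomial_append (L L' : List (Fin n)) (i : Fin n → ℕ) :
    listMonomial (L ++ L') i = listMonomial L i * listMonomial L' i := by
  rw [listMonomial, List.map_append, List.prod_append]
  rfl

theorem listMonomial_cons (p : Fin n) (L : List (Fin n)) (i : Fin n → ℕ) :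
    listMonomial (p :: L) i = ι (negSimple p) ^ i p * listMonomial L i := by
  rw [listMonomial, List.map_cons, List.prod_cons]
  rfl

theorem listMonomial_congr {L : List (Fin n)} {i i' : Fin n → ℕ} (h : ∀ p ∈ L, i p = i' p) :
    listMonomial L i = listMonomial L i' := by
  rw [listMonomial, listMonomial, List.map_congr_left fun p hp => by rw [h p hp]]

theorem hwVec_mem : hwVec n κ₀ ∈ wtSpace (n := n) (Verma n κ₀) κ₀ := cartan_hwVec

theorem listMonomial_mem_wtSpace (L : List (Fin n)) (i : Fin n → ℕ) :
    listMonomial L i • hwVec n κ₀ ∈ wtSpace (n := n) (Verma n κ₀)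
      (fun k => κ₀ k - ((L.map fun q => (i q : ℤ) • simpleRoot q).sum k : ℤ)) := by
  induction L with
  | nil => simpa [listMonomial] using hwVec_mem
  | cons p L ih =>
    have h := pow_negSimple_mem_wtSpace p (i p) ih
    rw [listMonomial_cons, mul_smul]
    convert h using 2
    funext k
    simp
    ring

theorem posSimple_mul_listMonomial {p : Fin n} {L : List (Fin n)} (hp : p ∉ L) (i : Fin n → ℕ) :
    Commute (ι (posSimple p)) (listMonomial L i) := by
  have h1 : ∀ q, p ≠ q → Commute (ι (posSimple p)) (ι (negSimple q)) := by
    intro q hq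
    rw [commute_iff_eq, ← sub_eq_zero, ← LieRing.of_associative_ring_bracket, ι, ι,
      ← LieHom.map_lie, lie_posSimple_negSimple_of_ne hq, map_zero]
  refine Commute.list_prod_right _ _ fun x hx => ?_
  obtain ⟨q, hq, rfl⟩ := List.mem_map.1 hx
  exact (h1 q fun e => hp (e ▸ hq)).pow_right _

theorem posSimple_hwVec (p : Fin n) : ⁅posSimple p, hwVec n κ₀⁆ = 0 := by
  unfold posSimple
  split_ifs with h
  · exact C_hwVec (by simp [Fin.lt_def])
  · exact CUp_hwVec p p

theorem posSimple_listMonomial {p : Fin n} {L : List (Fin n)} (hp : p ∉ L) (i : Fin n → ℕ) :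
    ⁅posSimple p, listMonomial L i • hwVec n κ₀⁆ = 0 := by
  rw [lie_verma, smul_smul, (posSimple_mul_listMonomial hp i).eq, mul_smul, ← lie_verma,
    posSimple_hwVec, smul_zero]

/-- The exponent of `x` in the singular vector, as a linear map on `ℤⁿ`. -/
def xExpL (n : ℕ) : (Fin n → ℤ) →ₗ[ℤ] (Fin n → ℤ) where
  toFun i p := (if (p : ℕ) + 1 = n then 2 * i p else i p) -
    (if 0 < (p : ℕ) then i ⟨(p : ℕ) - 1, lt_of_le_of_lt (Nat.sub_le _ _) p.2⟩ else 0)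
  map_add' i i' := by
    funext p
    simp only [Pi.add_apply]
    split_ifs <;> ring
  map_smul' c i := by
    funext p
    simp only [Pi.smul_apply, smul_eq_mul, RingHom.id_apply]
    split_ifs <;> ring

theorem xExp_eq (i : Fin n → ℕ) : xExp i = xExpL n (fun p => (i p : ℤ)) := rfl

theorem xExpL_single (p : Fin n) : xExpL n (Pi.single p 1) = simpleRoot p := by
  funext k
  simp only [xExpL, LinearMap.coe_mk, AddHom.coe_mk, simpleRoot]
  split_ifs <;> simp [Pi.single_apply, Fin.ext_iff] <;> grind

/-- The exponent of `x` is the sum of simple roots by which the weight of the summand is lowered. -/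
theorem xExpL_eq_sum (m : Fin n → ℤ) : xExpL n m = ∑ q, m q • simpleRoot q := by
  conv_lhs => rw [← Finset.univ_sum_single m]
  rw [map_sum]
  refine Finset.sum_congr rfl fun q _ => ?_
  rw [← xExpL_single, ← map_smul, ← Pi.single_smul, smul_eq_mul, mul_one]

theorem xExpL_injective (n : ℕ) : Function.Injective (xExpL n) := by
  rw [injective_iff_map_eq_zero]
  intro m hm
  have h : ∀ k : ℕ, ∀ hk : k < n, m ⟨k, hk⟩ = 0 := by
    intro k
    induction k with
    | zero =>
      intro hk
      have := congrFun hm ⟨0, hk⟩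
      simp only [xExpL, LinearMap.coe_mk, AddHom.coe_mk, Pi.zero_apply] at this
      split_ifs at this <;> omega
    | succ k ih =>
      intro hk
      have h1 := congrFun hm ⟨k + 1, hk⟩
      have h2 := ih (by omega)
      simp only [xExpL, LinearMap.coe_mk, AddHom.coe_mk, Pi.zero_apply, Nat.add_sub_cancel,
        h2] at h1
      split_ifs at h1 <;> omega
  exact funext fun k => h k k.2

theorem xExp_injective (n : ℕ) : Function.Injective (xExp (n := n)) := by
  intro i i' h
  have := xExpL_injective n h
  funext p
  simpa using congrFun this p

theorem xExp_add_single (i : Fin n → ℕ) (p : Fin n) :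
    xExp (i + Pi.single p 1) = xExp i + simpleRoot p := by
  rw [xExp_eq, xExp_eq, ← xExpL_single, ← map_add]
  congr 1
  funext q
  by_cases h : q = p
  · subst h; simp
  · simp [h]

theorem negMonomial_mem_wtSpace (i : Fin n → ℕ) : negMonomial i • hwVec n κ₀ ∈
    wtSpace (n := n) (Verma n κ₀) (fun k => κ₀ k - (xExp i k : ℤ)) := by
  have h := listMonomial_mem_wtSpace (κ₀ := κ₀) (List.finRange n) i
  rw [← negMonomial_eq] at h
  convert h using 5
  rw [xExp_eq, xExpL_eq_sum, ← List.ofFn_eq_map, List.sum_ofFn]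

/-- The action of a simple root vector on a product of negative simple root vectors. The number
`xExp i q + i p`, where `q = p + 1`, only depends on the factors to the right of `C_{p+1,p}`. -/
theorem posSimple_negMonomial (i : Fin n → ℕ) (p : Fin n) :
    ⁅posSimple p, negMonomial (i + Pi.single p 1) • hwVec n κ₀⁆ =
      ((i p + 1 : ℂ) * ((if h : (p : ℕ) + 1 < n then
        κ₀ p - (κ₀ ⟨p + 1, h⟩ - (xExp i ⟨p + 1, h⟩ + i p : ℤ)) else κ₀ p) - i p)) •
        negMonomial i • hwVec n κ₀ := by
  obtain ⟨L₁, L₂, hL⟩ := List.append_of_mem (List.mem_finRange p)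
  have hsort := List.pairwise_lt_finRange n
  rw [hL, List.pairwise_append, List.pairwise_cons] at hsort
  obtain ⟨-, ⟨h2, -⟩, h1⟩ := hsort
  have hp1 : p ∉ L₁ := fun h => (h1 p h p List.mem_cons_self).false
  have hp2 : p ∉ L₂ := fun h => (h2 p h).false
  have e1 : listMonomial L₁ (i + Pi.single p 1) = listMonomial L₁ i :=
    listMonomial_congr fun q hq => by
      simp [show q ≠ p from fun e => hp1 (e ▸ hq)]
  have e2 : listMonomial L₂ (i + Pi.single p 1) = listMonomial L₂ i :=
    listMonomial_congr fun q hq => by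
      simp [show q ≠ p from fun e => hp2 (e ▸ hq)]
  -- The part of the product to the right of the `p`-th factor, written as a full product.
  set i₂ : Fin n → ℕ := fun q => if p < q then i q else 0 with hi₂
  have e3 : listMonomial L₂ i = negMonomial i₂ := by
    have e31 : listMonomial L₁ i₂ = listMonomial L₁ 0 :=
      listMonomial_congr fun q hq => by simp [hi₂, (h1 q hq p List.mem_cons_self).le]
    have e32 : listMonomial L₂ i₂ = listMonomial L₂ i :=
      listMonomial_congr fun q hq => by simp [hi₂, h2 q hq]
    have e33 : listMonomial L₁ 0 = 1 := by simp [listMonomial]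
    have e34 : i₂ p = 0 := by simp [hi₂]
    rw [negMonomial_eq, hL, listMonomial_append, listMonomial_cons, e31, e32, e33, e34, pow_zero,
      one_mul, one_mul]
  have hw := negMonomial_mem_wtSpace (κ₀ := κ₀) i₂
  rw [← e3] at hw
  have hval : corootVal p (fun k => κ₀ k - ((xExp i₂ k : ℤ) : ℂ)) =
      if h : (p : ℕ) + 1 < n then
        κ₀ p - (κ₀ ⟨p + 1, h⟩ - (xExp i ⟨p + 1, h⟩ + i p : ℤ)) else κ₀ p := by
    have hp0 : xExp i₂ p = 0 := by
      have : ¬ p < ⟨(p : ℕ) - 1, lt_of_le_of_lt (Nat.sub_le _ _) p.2⟩ := by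
        simp [Fin.lt_def]
      simp [xExp, hi₂, this]
    unfold corootVal
    split_ifs with h
    · have : xExp i₂ ⟨p + 1, h⟩ = xExp i ⟨p + 1, h⟩ + i p := by
        have hlt : p < ⟨p + 1, h⟩ := Fin.lt_def.2 (Nat.lt_succ_self _)
        simp [xExp, hi₂, hlt]
      dsimp only
      rw [hp0, this]
      simp
    · dsimp only
      rw [hp0]
      simp
  have key := posSimple_pow_negSimple p hw (posSimple_listMonomial hp2 i) (i p)
  rw [hval] at key
  rw [negMonomial_eq, negMonomial_eq, hL, listMonomial_append, listMonomial_append,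
    listMonomial_cons, listMonomial_cons, e1, e2, Pi.add_apply, Pi.single_eq_same, lie_verma,
    smul_smul, ← mul_assoc, (posSimple_mul_listMonomial hp1 i).eq, mul_assoc, mul_smul, mul_smul,
    mul_smul, ← lie_verma, key, smul_comm (listMonomial L₁ i) (_ : ℂ), ← mul_smul, ← mul_smul,
    mul_assoc]

theorem posSimple_negMonomial_eq_zero {i : Fin n → ℕ} {p : Fin n} (hi : i p = 0) :
    ⁅posSimple p, negMonomial i • hwVec n κ₀⁆ = 0 := by
  obtain ⟨L₁, L₂, hL⟩ := List.append_of_mem (List.mem_finRange p)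
  have hnd := List.nodup_finRange n
  rw [hL] at hnd
  have h := posSimple_listMonomial (κ₀ := κ₀) (List.nodup_cons.1 (List.nodup_middle.1 hnd)).1 i
  rw [negMonomial_eq, hL, listMonomial_append, listMonomial_cons, hi, pow_zero, one_mul,
    ← listMonomial_append]
  exact h

end

/-! ### The singular vector -/

/-- The factor of `uCoeff` with index `p`. -/
def uFactor (c : ℂ) (p : Fin n) (k : ℕ) : ℂ :=
  if (p : ℕ) + 1 = n then 1 / ((k.factorial : ℂ) * 2 ^ k * ∏ t ∈ Finset.range k, (c - t))
  else (-1) ^ k / (k.factorial : ℂ)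

/-- A recursion for one factor of `uCoeff` is one for `uCoeff`. -/
theorem uCoeff_add_single (c : ℂ) (i : Fin n → ℕ) (p : Fin n) {x y : ℂ}
    (h : uFactor c p (i p + 1) * x = uFactor c p (i p) * y) :
    uCoeff c (i + Pi.single p 1) * x = uCoeff c i * y := by
  have e : ∀ i : Fin n → ℕ, uCoeff c i =
      uFactor c p (i p) * ∏ q ∈ Finset.univ.erase p, uFactor c q (i q) := fun i =>
    (Finset.mul_prod_erase Finset.univ (fun q => uFactor c q (i q)) (Finset.mem_univ p)).symm
  have e' : ∏ q ∈ Finset.univ.erase p, uFactor c q ((i + Pi.single p 1 : Fin n → ℕ) q) =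
      ∏ q ∈ Finset.univ.erase p, uFactor c q (i q) :=
    Finset.prod_congr rfl fun q hq => by
      rw [Pi.add_apply, Pi.single_eq_of_ne (Finset.ne_of_mem_erase hq), add_zero]
  rw [e, e i, e', Pi.add_apply, Pi.single_eq_same]
  linear_combination (∏ q ∈ Finset.univ.erase p, uFactor c q (i q)) * h

theorem uFactor_succ_of_lt (c : ℂ) {p : Fin n} (hp : (p : ℕ) + 1 < n) (k : ℕ) :
    uFactor c p (k + 1) * (k + 1) = uFactor c p k * (-1) := by
  have h1 : (k.factorial : ℂ) ≠ 0 := Nat.cast_ne_zero.2 k.factorial_ne_zero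
  have h2 : (k + 1 : ℂ) ≠ 0 := Nat.cast_add_one_ne_zero k
  rw [uFactor, uFactor, if_neg hp.ne, if_neg hp.ne, Nat.factorial_succ]
  push_cast
  field_simp
  ring

theorem uFactor_succ_last {c : ℂ} (hc : ∀ k : ℕ, c ≠ k) {p : Fin n} (hp : ¬ (p : ℕ) + 1 < n)
    (k : ℕ) : uFactor c p (k + 1) * ((k + 1) * (c - k)) = uFactor c p k * (1 / 2) := by
  have hp' : (p : ℕ) + 1 = n := by omega
  have h1 : (k.factorial : ℂ) ≠ 0 := Nat.cast_ne_zero.2 k.factorial_ne_zero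
  have h2 : (k + 1 : ℂ) ≠ 0 := Nat.cast_add_one_ne_zero k
  have h3 : c - k ≠ 0 := sub_ne_zero.2 (hc k)
  have h4 : ∏ t ∈ Finset.range k, (c - t) ≠ 0 :=
    Finset.prod_ne_zero_iff.2 fun t _ => sub_ne_zero.2 (hc t)
  rw [uFactor, uFactor, if_pos hp', if_pos hp', Nat.factorial_succ, Finset.prod_range_succ]
  push_cast
  field_simp
  ring

variable {c : ℂ}

theorem uVec_xExp (c : ℂ) (i : Fin n → ℕ) :
    uVec n c (xExp i) = uCoeff c i • (negMonomial i • hwVec n (lam n c)) := by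
  rw [uVec, finsum_eq_single _ i fun i' h => if_neg fun e => h (xExp_injective n e), if_pos rfl]

theorem uVec_eq_zero (c : ℂ) {j : Fin n → ℤ} (h : ∀ i : Fin n → ℕ, xExp i ≠ j) :
    uVec n c j = 0 := by
  rw [uVec]
  exact (finsum_congr fun i => if_neg (h i)).trans finsum_zero

theorem totalRep_cartan_uVec (c : ℂ) (k : Fin n) :
    totalRep _ (C k k : sp n) (uVec n c) = lam n c k • uVec n c := by
  funext j
  rw [totalRep_apply, pointRep_cartan, Pi.smul_apply]
  by_cases h : ∃ i : Fin n → ℕ, xExp i = j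
  · obtain ⟨i, rfl⟩ := h
    rw [uVec_xExp, lie_smul, negMonomial_mem_wtSpace i k]
    generalize negMonomial i • hwVec n (lam n c) = w
    module
  · rw [uVec_eq_zero c fun i hi => h ⟨i, hi⟩, lie_zero, smul_zero, smul_zero, add_zero]

theorem pointRep_posSimple {M : Type*} [AddCommGroup M] [Module ℂ M] (p : Fin n)
    (g : LaurentX n M) (j : Fin n → ℤ) : pointRep (posSimple p) g j =
      (if h : (p : ℕ) + 1 < n then (j ⟨p + 1, h⟩ : ℂ) + 1 / 2 else -1 / 2) •
        g (j - simpleRoot p) := by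
  unfold posSimple simpleRoot
  split_ifs with h
  · have hne : p ≠ ⟨p + 1, h⟩ := by simp [Fin.ext_iff]
    rw [pointRep_C, if_neg hne, zero_smul, add_zero]
    change ((((j - eps p) ⟨p + 1, h⟩ : ℤ) : ℂ) + 1 / 2) • g (j - eps p + eps ⟨p + 1, h⟩) = _
    rw [Pi.sub_apply, show eps p (⟨p + 1, h⟩ : Fin n) = 0 from Pi.single_eq_of_ne hne.symm _,
      sub_zero, sub_add]
  · rw [pointRep_CUp, if_pos rfl]
    change (-(1 / (1 + 1)) : ℂ) • g (j - eps p - eps p) = _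
    rw [sub_sub]
    norm_num

/-- The simple root vectors annihilate the singular vector. -/
theorem totalRep_posSimple_uVec (hc : ∀ k : ℕ, c ≠ k) (p : Fin n) :
    totalRep _ (posSimple p) (uVec n c) = 0 := by
  funext j
  rw [totalRep_apply, pointRep_posSimple, Pi.zero_apply]
  by_cases h : ∃ i : Fin n → ℕ, xExp i + simpleRoot p = j
  · obtain ⟨i, rfl⟩ := h
    rw [add_sub_cancel_right, ← xExp_add_single, uVec_xExp, uVec_xExp, lie_smul,
      posSimple_negMonomial, smul_smul, smul_smul, ← add_smul, xExp_add_single]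
    convert zero_smul ℂ _
    split_ifs with hp
    · have h1 := uCoeff_add_single c i p (uFactor_succ_of_lt c hp (i p))
      have h2 : lam n c p - lam n c ⟨p + 1, hp⟩ = -1 / 2 := by
        simp only [lam]
        push_cast
        ring
      have h3 : simpleRoot p ⟨p + 1, hp⟩ = -1 := by
        simp [simpleRoot, hp, Fin.ext_iff]
      rw [Pi.add_apply, h3]
      push_cast
      linear_combination ((xExp i ⟨p + 1, hp⟩ : ℂ) - 1 / 2) * h1 +
        uCoeff c (i + Pi.single p 1) * (i p + 1) * h2
    · have h1 := uCoeff_add_single c i p (uFactor_succ_last hc hp (i p))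
      have h2 : lam n c p = c := by
        have : (n : ℂ) = (p : ℕ) + 1 := by
          have : n = (p : ℕ) + 1 := by omega
          exact_mod_cast this
        rw [lam, this]
        ring
      rw [h2]
      linear_combination h1
  · have h1 : uVec n c (j - simpleRoot p) = 0 :=
      uVec_eq_zero c fun i hi => h ⟨i, by rw [hi, sub_add_cancel]⟩
    rw [h1, smul_zero, add_zero]
    by_cases h' : ∃ i : Fin n → ℕ, xExp i = j
    · obtain ⟨i, rfl⟩ := h'
      have hi : i p = 0 := by
        by_contra hne
        refine h ⟨i - Pi.single p 1, ?_⟩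
        rw [← xExp_add_single]
        congr 1
        funext q
        by_cases hq : q = p
        · subst hq
          simp
          omega
        · simp [hq]
      rw [uVec_xExp, lie_smul, posSimple_negMonomial_eq_zero hi, smul_zero]
    · rw [uVec_eq_zero c fun i hi => h' ⟨i, hi⟩, lie_zero]

/-! ### Simple root vectors generate the positive part -/

theorem lie_C_C_of_ne {i k : Fin n} (j : Fin n) (h : i ≠ k) : ⁅(C i j : sp n), C j k⁆ = C i k := by
  rw [← toSp_inl_inl j k, lie_toSp, ← toSp_inl_inl i k]
  simp [C, sub_mul, mul_sub, E_mul_E, -Matrix.single_mul_single_same, h.symm]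

theorem toSp_inl_inr_comm (p q : Fin n) :
    toSp n (E (.inl p) (.inr q)) = toSp n (E (.inl q) (.inr p)) := by
  rw [toSp_inl_inr, toSp_inl_inr, CUp_comm]
  simp only [eq_comm]

/-- The second term only appears for the long root `2 ε_j`. -/
theorem lie_C_toSp_inl_inr (i j k : Fin n) : ⁅(C i j : sp n), toSp n (E (.inl j) (.inr k))⁆ =
    toSp n (E (.inl i) (.inr k)) + if k = j then toSp n (E (.inl i) (.inr j)) else 0 := by
  rw [lie_toSp]
  have : (C i j).1 * E (.inl j) (.inr k) - E (.inl j) (.inr k) * (C i j).1 =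
      E (.inl i) (.inr k) + if k = j then E (.inl j) (.inr i) else 0 := by
    simp [C, sub_mul, mul_sub, E_mul_E, -Matrix.single_mul_single_same]
  rw [this, map_add, apply_ite (toSp n), map_zero, toSp_inl_inr_comm j i]

/-- Induction on `j - i`, through `C_{i,j} = [C_{i,j-1}, C_{j-1,j}]`. -/
theorem C_mem_of_posSimple (S : LieSubalgebra ℂ (sp n)) (h : ∀ p : Fin n, posSimple p ∈ S)
    {i j : Fin n} (hij : i < j) : C i j ∈ S := by
  have key : ∀ d : ℕ, ∀ i : ℕ, ∀ hd : i + d + 1 < n,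
      C (⟨i, by omega⟩ : Fin n) ⟨i + d + 1, hd⟩ ∈ S := by
    intro d
    induction d with
    | zero =>
      intro i hd
      have := h ⟨i, by omega⟩
      rw [posSimple, dif_pos hd] at this
      exact this
    | succ d ih =>
      intro i hd
      have h1 := ih i (by omega)
      have h2 := h ⟨i + d + 1, by omega⟩
      have hd' : i + d + 1 + 1 < n := by omega
      rw [posSimple, dif_pos hd'] at h2
      have h3 := S.lie_mem h1 h2
      rwa [lie_C_C_of_ne _ (by simp [Fin.ext_iff]; omega)] at h3
  have := key (j - i - 1) i (by have := Fin.lt_def.1 hij; omega)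
  convert this using 2
  have := Fin.lt_def.1 hij
  exact Fin.ext (by simp; omega)

/-- The long simple root vector is brought to all indices by brackets with the `C_{i,n}`. -/
theorem CUp_mem_of_posSimple (S : LieSubalgebra ℂ (sp n)) (h : ∀ p : Fin n, posSimple p ∈ S)
    (i j : Fin n) : CUp i j ∈ S := by
  have hn : 0 < n := lt_of_le_of_lt (Nat.zero_le _) i.2
  set m : Fin n := ⟨n - 1, by omega⟩ with hm
  have hlt : ∀ k : Fin n, k ≠ m → k < m := fun k hk => by
    rw [Fin.lt_def]
    have h1 : (k : ℕ) ≠ n - 1 := fun e => hk (Fin.ext e)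
    have := k.2
    change (k : ℕ) < n - 1
    omega
  have hmm : toSp n (E (.inl m) (.inr m)) ∈ S := by
    have := h m
    rw [posSimple, dif_neg (by simp [hm]; omega)] at this
    rw [toSp_inl_inr]
    exact S.smul_mem _ this
  have him : ∀ k : Fin n, toSp n (E (.inl k) (.inr m)) ∈ S := by
    intro k
    by_cases hk : k = m
    · rw [hk]; exact hmm
    · have h1 := S.lie_mem (C_mem_of_posSimple S h (hlt k hk)) hmm
      rw [lie_C_toSp_inl_inr, if_pos rfl, ← two_smul ℂ] at h1
      have h2 := S.smul_mem (1 / 2 : ℂ) h1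
      rw [smul_smul] at h2
      norm_num at h2
      exact h2
  have hij : toSp n (E (.inl i) (.inr j)) ∈ S := by
    by_cases hi : i = m
    · rw [hi, toSp_inl_inr_comm]; exact him j
    · by_cases hj : j = m
      · rw [hj]; exact him i
      · have h1 := him j
        rw [toSp_inl_inr_comm] at h1
        have h2 := S.lie_mem (C_mem_of_posSimple S h (hlt i hi)) h1
        rwa [lie_C_toSp_inl_inr, if_neg hj, add_zero] at h2
  rw [CUp_eq_toSp]
  exact S.smul_mem _ hij

/-- The elements of `sp(2n)` that annihilate a vector of `M̃`. -/
def annihilator {M : Type*} [AddCommGroup M] [Module ℂ M] [LieRingModule (sp n) M]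
    [LieModule ℂ (sp n) M] (f : LaurentX n M) : LieSubalgebra ℂ (sp n) where
  carrier := {X | totalRep M X f = 0}
  add_mem' {X Y} hX hY := by
    change totalRep M (X + Y) f = 0
    rw [map_add, LinearMap.add_apply, hX, hY, add_zero]
  zero_mem' := by
    change totalRep M 0 f = 0
    rw [map_zero, LinearMap.zero_apply]
  smul_mem' k X hX := by
    change totalRep M (k • X) f = 0
    rw [map_smul, LinearMap.smul_apply, hX, smul_zero]
  lie_mem' {X Y} hX hY := by
    change totalRep M ⁅X, Y⁆ f = 0
    change totalRep M X f = 0 at hX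
    change totalRep M Y f = 0 at hY
    rw [LieHom.map_lie, LieRing.of_associative_ring_bracket, LinearMap.sub_apply,
      Module.End.mul_apply, Module.End.mul_apply, hX, hY, map_zero, map_zero, sub_zero]

/-! ### The intertwiner of a Verma module -/

/-- The action of `U(sp(2n))` on `M̃` that extends `totalRep`. -/
def totalU (M : Type*) [AddCommGroup M] [Module ℂ M] [LieRingModule (sp n) M]
    [LieModule ℂ (sp n) M] : U n →ₐ[ℂ] Module.End ℂ (LaurentX n M) :=
  UniversalEnvelopingAlgebra.lift ℂ (totalRep M)

theorem totalU_ι {M : Type*} [AddCommGroup M] [Module ℂ M] [LieRingModule (sp n) M]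
    [LieModule ℂ (sp n) M] (X : sp n) : totalU M (ι X) = totalRep M X :=
  UniversalEnvelopingAlgebra.lift_ι_apply ℂ _ X

theorem totalU_vermaIdeal (hc : ∀ k : ℕ, c ≠ k) {a : U n} (ha : a ∈ vermaIdeal n (lam n c)) :
    totalU _ a (uVec n c) = 0 := by
  have hS : ∀ p : Fin n, posSimple p ∈ annihilator (uVec n c) := totalRep_posSimple_uVec hc
  refine Submodule.span_induction (p := fun a _ => totalU _ a (uVec n c) = 0) ?_ ?_ ?_ ?_ ha
  · rintro _ ((⟨i, j, hij, rfl⟩ | ⟨i, j, _, rfl⟩) | ⟨i, rfl⟩)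
    · rw [totalU_ι]
      exact C_mem_of_posSimple _ hS hij
    · rw [totalU_ι]
      exact CUp_mem_of_posSimple _ hS i j
    · rw [map_sub, totalU_ι, AlgHom.commutes, LinearMap.sub_apply, totalRep_cartan_uVec]
      exact sub_self _
  · rw [map_zero, LinearMap.zero_apply]
  · intro x y _ _ hx hy
    rw [map_add, LinearMap.add_apply, hx, hy, add_zero]
  · intro b x _ hx
    rw [smul_eq_mul, map_mul, Module.End.mul_apply, hx, map_zero]

theorem isIntertwiner_iff {M : Type*} [AddCommGroup M] [Module ℂ M] [LieRingModule (sp n) M]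
    [LieModule ℂ (sp n) M] (Φ : M →ₗ[ℂ] LaurentX n M) :
    IsIntertwiner Φ ↔ ∀ (u : sp n) (w : M), Φ ⁅u, w⁆ = totalRep M u (Φ w) :=
  ⟨fun h u w => funext fun j => h u w j, fun h u w j => congrFun (h u w) j⟩

/-- The highest-weight vector can be mapped to the singular vector. -/
theorem exists_intertwiner (hc : ∀ k : ℕ, c ≠ k) :
    ∃ Φ : Verma n (lam n c) →ₗ[ℂ] LaurentX n (Verma n (lam n c)),
      IsIntertwiner Φ ∧ Φ (hwVec n (lam n c)) = uVec n c := by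
  let g : U n →ₗ[ℂ] LaurentX n (Verma n (lam n c)) :=
    LinearMap.applyₗ (uVec n c) ∘ₗ (totalU (Verma n (lam n c))).toLinearMap
  have hg : (vermaIdeal n (lam n c)).restrictScalars ℂ ≤ LinearMap.ker g :=
    fun a ha => totalU_vermaIdeal hc ha
  let Φ : Verma n (lam n c) →ₗ[ℂ] LaurentX n (Verma n (lam n c)) :=
    Submodule.liftQ _ g hg ∘ₗ
      (Submodule.Quotient.restrictScalarsEquiv ℂ (vermaIdeal n (lam n c))).symm.toLinearMap
  have hΦ : ∀ a : U n, Φ (a • hwVec n (lam n c)) = totalU _ a (uVec n c) := by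
    intro a
    rw [hwVec, ← Submodule.Quotient.mk_smul, smul_eq_mul, mul_one]
    rfl
  refine ⟨Φ, (isIntertwiner_iff Φ).2 fun u w => ?_, ?_⟩
  · obtain ⟨a, rfl⟩ := exists_smul_hwVec w
    rw [lie_verma, smul_smul, hΦ, hΦ, map_mul, totalU_ι, Module.End.mul_apply]
  · have := hΦ 1
    rwa [one_smul, map_one, Module.End.one_apply] at this

theorem intertwiner_unique {κ₀ : Fin n → ℂ}
    {Φ Φ' : Verma n κ₀ →ₗ[ℂ] LaurentX n (Verma n κ₀)} (h : IsIntertwiner Φ)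
    (h' : IsIntertwiner Φ') (hv : Φ' (hwVec n κ₀) = Φ (hwVec n κ₀)) : Φ' = Φ := by
  rw [isIntertwiner_iff] at h h'
  have := eq_top_of_stable (LinearMap.eqLocus Φ' Φ) hv fun X w hw => by
    change Φ' ⁅X, w⁆ = Φ ⁅X, w⁆
    rw [h, h', show Φ' w = Φ w from hw]
  exact LinearMap.eqLocus_eq_top.1 this

end SpTrace

end

open SpTrace
theorem theorem7p1 (n : ℕ) (hn : 1 ≤ n) :
    (∀ (M : Type*) [AddCommGroup M] [Module ℂ M] [LieRingModule (sp n) M] [LieModule ℂ (sp n) M]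
        (hM : IsWeightModule (n := n) M)
        (_ : ∀ κ : Fin n → ℂ, FiniteDimensional ℂ (wtSpace (n := n) M κ))
        (μ : ℂ) (_ : actU M (casimir n) = μ • LinearMap.id)
        (Φ : M →ₗ[ℂ] LaurentX n M) (_ : IsIntertwiner Φ),
      (∀ j : Fin n → ℤ, j ≠ 0 → traceFn hM Φ j = 0) ∧
      SolvesOP (1 / 2) (1 / 2) (3 / 4) (μ + n * (n + 1) * (2 * n + 1) / 6)
        (zMul (weylC n) (traceFn hM Φ 0)) ∧
      (WeightsBoundedAbove (n := n) M →
        SolvesOPExpanded (1 / 2) (1 / 2) (3 / 4) (μ + n * (n + 1) * (2 * n + 1) / 6)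
          (zMul (weylC n) (traceFn hM Φ 0)))) ∧
    (∀ (c μ : ℂ), (∀ k : ℕ, c ≠ k) →
      μ = ∑ i ∈ Finset.range n, (c - i / 2) * (c + 3 * i / 2 + 2) →
      ∃ hM : IsWeightModule (n := n) (Verma n (lam n c)),
        (∀ κ : Fin n → ℂ, FiniteDimensional ℂ (wtSpace (n := n) (Verma n (lam n c)) κ)) ∧
        WeightsBoundedAbove (n := n) (Verma n (lam n c)) ∧
        actU (Verma n (lam n c)) (casimir n) = μ • LinearMap.id ∧
        ∃ Φ : Verma n (lam n c) →ₗ[ℂ] LaurentX n (Verma n (lam n c)),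
          (∀ Φ' : Verma n (lam n c) →ₗ[ℂ] LaurentX n (Verma n (lam n c)),
            (IsIntertwiner Φ' ∧ Φ' (hwVec n (lam n c)) = uVec n c) ↔ Φ' = Φ) ∧
          (∀ j : Fin n → ℤ, j ≠ 0 → traceFn hM Φ j = 0) ∧
          SolvesOPExpanded (1 / 2) (1 / 2) (3 / 4) (μ + n * (n + 1) * (2 * n + 1) / 6)
            (zMul (weylC n) (traceFn hM Φ 0))) := by
  refine ⟨fun M _ _ _ _ hM hfin μ hμ Φ hΦ => ⟨fun j hj => traceFn_eq_zero hM hΦ hj,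
    traceFn_solvesOP hM hfin hμ hΦ, traceFn_solvesOPExpanded hM hfin hμ hΦ⟩, ?_⟩
  intro c μ hc hμ
  have hcas : actU (Verma n (lam n c)) (casimir n) = μ • LinearMap.id := by
    rw [actU_casimir_verma, casimir_lam, hμ]
  obtain ⟨Φ, hΦ, hΦv⟩ := exists_intertwiner (n := n) hc
  refine ⟨isWeightModule_verma _, finiteDimensional_wtSpace_verma _, weightsBoundedAbove_verma _,
    hcas, Φ, fun Φ' => ⟨fun h => intertwiner_unique hΦ h.1 (h.2.trans hΦv.symm), ?_⟩,
    fun j hj => traceFn_eq_zero _ hΦ hj,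
    traceFn_solvesOPExpanded _ (finiteDimensional_wtSpace_verma _) hcas hΦ
      (weightsBoundedAbove_verma _)⟩
  rintro rfl
  exact ⟨hΦ, hΦv⟩
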